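/- **Theorem 3.1 (Sharp non-asymptotic deviation results).** Let $b:\mathbb R^d\to\mathbb R^d$ and $\sigma:\mathbb R^d\to\mathbb R^{d\times r}$ be Lipschitz continuous, $\Sigma=\sigma\sigma^*$, and let $\mathcal A f=b\cdot\nabla f+\tfrac12\mathrm{Tr}(\Sigma D^2f)$ be the generator of $dY_t=b(Y_t)\,dt+\sigma(Y_t)\,dW_t$. For steps $\gamma_k>0$ ($k\ge1$) put $\Gamma_n=\sum_{k=1}^n\gamma_k$, and consider the Euler scheme and its empirical measure $$X_{n+1}=X_n+\gamma_{n+1}b(X_n)+\sqrt{\gamma_{n+1}}\,\sigma(X_n)U_{n+1},\qquad \nu_n=\frac1{\Gamma_n}\sum_{k=1}^n\gamma_k\,\delta_{X_{k-1}}.$$ Assume (A), that is: * (C1) there is $\lambda_0>0$ with $\mathbb E[e^{\lambda|X_0|^2}]<\infty$ for all $\lambda<\lambda_0$. * (GC) $(U_n)_{n\ge1}$ is an i.i.d. sequence in $\mathbb R^r$, independent of $X_0$, with $\mathbb E[U_1]=0$, $\mathbb E[U_1^iU_1^j]=\delta_{ij}$, $\mathbb E[U_1^iU_1^jU_1^k]=0$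 for all $i,j,k$, and $\mathbb E[e^{\lambda g(U_1)}]\le e^{\lambda\mathbb E[g(U_1)]+\lambda^2/2}$ for all $1$-Lipschitz $g:\mathbb R^r\to\mathbb R$ and all $\lambda>0$. * (C2) $\sup_x\mathrm{Tr}\,\Sigma(x)<\infty$. * ($\mathcal L_V$) there are $v^*>0$ and $V:\mathbb R^d\to[v^*,\infty)$ of class $\mathcal C^2$ with $\|D^2V\|_\infty<\infty$ (supremum of the Frobenius norm) and $V(x)\to\infty$ as $|x|\to\infty$, and constants $C_V,\alpha_V>0$, $\beta_V\ge0$, such that $|\nabla V|^2+|b|^2\le C_VV$ and $\mathcal AV\le-\alpha_VV+\beta_V$. * (U) the diffusion has a unique invariant probability measure $\nu$. * (S) $\gamma_k\le\min\big(\frac1{2\sqrt{C_V\bar c}},\frac{\alpha_V}{2C_V\|D^2V\|_\infty}\big)$ for all $k\ge1$, where $\bar c>0$ is such that $V(x)\le\bar c|x|^2$ and $|b(x)|\le\sqrt{C_V\bar c}\,|x|$ for all $|x|\ge K$, for some $K>0$. * (T$_\beta$) for some $\beta\in(0,1]$, the function $\varphi:\mathbb R^d\to\mathbb R$ satisfies: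 i) $\varphi\in\mathcal C^{3,\beta}$, i.e. $\varphi$ is $\mathcal C^3$ with bounded derivatives of orders $1,2,3$ and $\beta$-Hölder third derivatives; ii) $x\mapsto\langle b(x),\nabla\varphi(x)\rangle$ is Lipschitz continuous; iii) $|\varphi|\le C(1+\sqrt V)$ for some $C>0$. Suppose that $\nu(|\sigma^*\nabla\varphi|^2)>0$, and that there is $\vartheta$ satisfying (T$_\beta$), with the same $\beta$ (in particular $\vartheta\in\mathcal C^{3,\beta}$), such that $$\mathcal A\vartheta=|\sigma^*\nabla\varphi|^2-\nu(|\sigma^*\nabla\varphi|^2).$$ Suppose finally that $\gamma_n\asymp n^{-\theta}$ with $\theta\in(\frac1{2+\beta},1]$. Then for every sequence $(A_n)$ with $A_n/\sqrt{\Gamma_n}\to0$ (Gaussian deviations) there are non-negative sequences $(c_n)_{n\ge1}$ and $(C_n)_{n\ge1}$, respectively strictly increasing and strictly decreasing for $n$ large enough, with $\lim_nc_n=\lim_nC_n=1$, such that for all $n\ge1$ and all $0<a\le A_n$, $$\mathbb P\big[|\sqrt{\Gamma_n}\,\nu_n(\mathcal A\varphi)|\ge a\big]\le2\,C_n\exp\Big(-c_n\,\frac{a^2}{2\,\nu(|\sigma^*\nabla\varphi|^2)}\Big).$$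 -/

import Mathlib

open MeasureTheory ProbabilityTheory Filter Topology
open scoped NNReal ENNReal

namespace DecreasingStep

noncomputable section

/-- The `j`-th vector of the canonical basis of `ℝⁿ`. -/
abbrev basisVec {n : ℕ} (j : Fin n) : EuclideanSpace ℝ (Fin n) := EuclideanSpace.single j 1

/-- The second derivative `D²f(x)` as a bilinear form, evaluated at `(u, v)`. -/
def hess {d : ℕ} (f : EuclideanSpace ℝ (Fin d) → ℝ) (x u v : EuclideanSpace ℝ (Fin d)) : ℝ :=
  iteratedFDeriv ℝ 2 f x ![u, v]

/-- The Frobenius norm `‖D²f(x)‖` of the Hessian matrix. -/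
def hessNorm {d : ℕ} (f : EuclideanSpace ℝ (Fin d) → ℝ) (x : EuclideanSpace ℝ (Fin d)) : ℝ :=
  Real.sqrt (∑ i, ∑ j, hess f x (basisVec i) (basisVec j) ^ 2)

/-- `Tr (Σ(x)) = ‖σ(x)‖²`, where `Σ = σσ*` and `‖·‖` is the Frobenius norm: the sum of the squared
lengths of the columns `σ(x) eⱼ`. -/
def trSigma {d r : ℕ}
    (σ : EuclideanSpace ℝ (Fin d) → EuclideanSpace ℝ (Fin r) →L[ℝ] EuclideanSpace ℝ (Fin d))
    (x : EuclideanSpace ℝ (Fin d)) : ℝ :=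
  ∑ j, ‖σ x (basisVec j)‖ ^ 2

/-- The generator `𝒜f(x) = b(x) · ∇f(x) + ½ Tr (Σ(x) D²f(x))` of `dY = b(Y) dt + σ(Y) dW`.
Since `Σ = σσ*`, the trace is `Tr (σ* D²f σ)`, the sum over `j` of `D²f(x)(σ(x) eⱼ, σ(x) eⱼ)`. -/
def generator {d r : ℕ} (b : EuclideanSpace ℝ (Fin d) → EuclideanSpace ℝ (Fin d))
    (σ : EuclideanSpace ℝ (Fin d) → EuclideanSpace ℝ (Fin r) →L[ℝ] EuclideanSpace ℝ (Fin d))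
    (f : EuclideanSpace ℝ (Fin d) → ℝ) (x : EuclideanSpace ℝ (Fin d)) : ℝ :=
  inner ℝ (b x) (gradient f x)
    + (1 / 2) * ∑ j, hess f x (σ x (basisVec j)) (σ x (basisVec j))

/-- The carré du champ `|σ*∇f|²(x)`. -/
def carreDuChamp {d r : ℕ}
    (σ : EuclideanSpace ℝ (Fin d) → EuclideanSpace ℝ (Fin r) →L[ℝ] EuclideanSpace ℝ (Fin d))
    (f : EuclideanSpace ℝ (Fin d) → ℝ) (x : EuclideanSpace ℝ (Fin d)) : ℝ :=
  ‖(σ x).adjoint (gradient f x)‖ ^ 2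

/-- `Y` is, under `P`, a (weak) solution of `dY = b(Y) dt + σ(Y) dW`, in the sense of the
martingale problem: `Y` has continuous paths, is adapted to some filtration, and for every smooth
compactly supported `f` the process `f(Y_t) - ∫₀ᵗ 𝒜f(Y_s) ds` is a martingale. -/
structure IsDiffusion {d r : ℕ} (b : EuclideanSpace ℝ (Fin d) → EuclideanSpace ℝ (Fin d))
    (σ : EuclideanSpace ℝ (Fin d) → EuclideanSpace ℝ (Fin r) →L[ℝ] EuclideanSpace ℝ (Fin d))
    {Ω : Type*} [MeasurableSpace Ω] (P : Measure Ω)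
    (Y : ℝ≥0 → Ω → EuclideanSpace ℝ (Fin d)) : Prop where
  continuous_paths : ∀ ω, Continuous fun t => Y t ω
  martingale : ∃ ℱ : Filtration ℝ≥0 ‹MeasurableSpace Ω›, StronglyAdapted ℱ Y ∧
    ∀ f : EuclideanSpace ℝ (Fin d) → ℝ, ContDiff ℝ ((⊤ : ℕ∞) : WithTop ℕ∞) f → HasCompactSupport f →
      Martingale (fun (t : ℝ≥0) ω =>
        f (Y t ω) - ∫ s in (0 : ℝ)..t, generator b σ f (Y s.toNNReal ω)) ℱ P

/-- `ν` is an invariant probability measure of `dY = b(Y) dt + σ(Y) dW`: some solution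
has law `ν` at every time. -/
def IsInvariant {d r : ℕ} (b : EuclideanSpace ℝ (Fin d) → EuclideanSpace ℝ (Fin d))
    (σ : EuclideanSpace ℝ (Fin d) → EuclideanSpace ℝ (Fin r) →L[ℝ] EuclideanSpace ℝ (Fin d))
    (ν : Measure (EuclideanSpace ℝ (Fin d))) : Prop :=
  ∃ (Ω : Type) (_ : MeasurableSpace Ω) (P : Measure Ω)
    (Y : ℝ≥0 → Ω → EuclideanSpace ℝ (Fin d)),
    IsProbabilityMeasure P ∧ IsDiffusion b σ P Y ∧ ∀ t, P.map (Y t) = ν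

/-- Assumption (U): `ν` is the unique invariant probability measure. -/
def IsUniqueInvariant {d r : ℕ} (b : EuclideanSpace ℝ (Fin d) → EuclideanSpace ℝ (Fin d))
    (σ : EuclideanSpace ℝ (Fin d) → EuclideanSpace ℝ (Fin r) →L[ℝ] EuclideanSpace ℝ (Fin d))
    (ν : Measure (EuclideanSpace ℝ (Fin d))) : Prop :=
  IsInvariant b σ ν ∧ ∀ ν', IsInvariant b σ ν' → ν' = ν

/-- The Hölder space `𝒞^{k,β}`: `k` times continuously differentiable, with bounded derivatives of
orders `1, …, k` (the function itself may be unbounded) and `β`-Hölder `k`-th derivative. -/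
structure InHolder {d : ℕ} (k : ℕ) (β : ℝ) (f : EuclideanSpace ℝ (Fin d) → ℝ) : Prop where
  contDiff : ContDiff ℝ k f
  bounded : ∀ i : ℕ, 1 ≤ i → i ≤ k → ∃ K : ℝ, ∀ x, ‖iteratedFDeriv ℝ i f x‖ ≤ K
  holder : ∃ K : ℝ, ∀ x y, ‖iteratedFDeriv ℝ k f x - iteratedFDeriv ℝ k f y‖ ≤ K * ‖x - y‖ ^ β

/-- Assumption (T_β) on a function, relative to the drift `b` and the Lyapunov function `V`. -/
structure TestCondition {d : ℕ} (b : EuclideanSpace ℝ (Fin d) → EuclideanSpace ℝ (Fin d))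
    (V : EuclideanSpace ℝ (Fin d) → ℝ) (β : ℝ) (f : EuclideanSpace ℝ (Fin d) → ℝ) : Prop where
  smooth : InHolder 3 β f
  lipschitz : ∃ K : ℝ≥0, LipschitzWith K fun x => (inner ℝ (b x) (gradient f x) : ℝ)
  growth : ∃ K : ℝ, 0 < K ∧ ∀ x, |f x| ≤ K * (1 + Real.sqrt (V x))

/-- Assumption (GC) on the law `μ` of the innovations: moments matching those of the standard
Gaussian law up to order three, and Gaussian concentration. -/
structure InnovationLaw {r : ℕ} (μ : Measure (EuclideanSpace ℝ (Fin r))) : Prop where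
  isProbabilityMeasure : IsProbabilityMeasure μ
  mean : ∀ i, ∫ u, u i ∂μ = 0
  covariance : ∀ i j, ∫ u, u i * u j ∂μ = if i = j then 1 else 0
  third : ∀ i j k, ∫ u, u i * u j * u k ∂μ = 0
  concentration : ∀ g : EuclideanSpace ℝ (Fin r) → ℝ, LipschitzWith 1 g → ∀ l : ℝ, 0 < l →
    Integrable (fun u => Real.exp (l * g u)) μ ∧
      ∫ u, Real.exp (l * g u) ∂μ ≤ Real.exp (l * ∫ u, g u ∂μ + l ^ 2 / 2)

/-- Assumption (𝓛_V): `V` is a Lyapunov function with constants `C_V`, `α_V`, `β_V`. -/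
structure LyapunovCondition {d r : ℕ} (b : EuclideanSpace ℝ (Fin d) → EuclideanSpace ℝ (Fin d))
    (σ : EuclideanSpace ℝ (Fin d) → EuclideanSpace ℝ (Fin r) →L[ℝ] EuclideanSpace ℝ (Fin d))
    (V : EuclideanSpace ℝ (Fin d) → ℝ) (CV αV βV : ℝ) : Prop where
  lower : ∃ v : ℝ, 0 < v ∧ ∀ x, v ≤ V x
  contDiff : ContDiff ℝ 2 V
  hess_bounded : BddAbove (Set.range (hessNorm V))
  tendsto : Tendsto V (cocompact _) atTop
  CV_pos : 0 < CV
  growth : ∀ x, ‖gradient V x‖ ^ 2 + ‖b x‖ ^ 2 ≤ CV * V x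
  αV_pos : 0 < αV
  βV_nonneg : 0 ≤ βV
  drift : ∀ x, generator b σ V x ≤ -αV * V x + βV

/-- Assumption (S): the steps are small with respect to the coefficients and the Lyapunov function.
Here `c` is a constant with `V(x) ≤ c |x|²` and `|b(x)| ≤ √(C_V c) |x|` outside some ball. -/
def SmallSteps {d : ℕ} (b : EuclideanSpace ℝ (Fin d) → EuclideanSpace ℝ (Fin d))
    (V : EuclideanSpace ℝ (Fin d) → ℝ) (CV αV : ℝ) (γ : ℕ → ℝ) : Prop :=
  ∃ c K : ℝ, 0 < c ∧ 0 < K ∧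
    (∀ x, K ≤ ‖x‖ → |V x| ≤ c * ‖x‖ ^ 2 ∧ ‖b x‖ ≤ Real.sqrt (CV * c) * ‖x‖) ∧
    ∀ k, 1 ≤ k → γ k ≤ min (1 / (2 * Real.sqrt (CV * c))) (αV / (2 * CV * ⨆ x, hessNorm V x))

/-- Assumption (C1): `E[exp(λ|X₀|²)] < ∞` for all `λ` below some positive threshold. -/
def SubGaussianInit {d : ℕ} {Ω : Type*} [MeasurableSpace Ω] (P : Measure Ω)
    (X₀ : Ω → EuclideanSpace ℝ (Fin d)) : Prop :=
  ∃ l₀ : ℝ, 0 < l₀ ∧ ∀ l < l₀, Integrable (fun ω => Real.exp (l * ‖X₀ ω‖ ^ 2)) P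

/-- The Euler scheme `X_{n+1} = X_n + γ_{n+1} b(X_n) + √γ_{n+1} σ(X_n) U_{n+1}`.
The values `γ 0` and `U 0` are not used. -/
def euler {d r : ℕ} (b : EuclideanSpace ℝ (Fin d) → EuclideanSpace ℝ (Fin d))
    (σ : EuclideanSpace ℝ (Fin d) → EuclideanSpace ℝ (Fin r) →L[ℝ] EuclideanSpace ℝ (Fin d))
    (γ : ℕ → ℝ) {Ω : Type*} (X₀ : Ω → EuclideanSpace ℝ (Fin d))
    (U : ℕ → Ω → EuclideanSpace ℝ (Fin r)) : ℕ → Ω → EuclideanSpace ℝ (Fin d)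
  | 0 => X₀
  | n + 1 => fun ω =>
      euler b σ γ X₀ U n ω + γ (n + 1) • b (euler b σ γ X₀ U n ω)
        + Real.sqrt (γ (n + 1)) • σ (euler b σ γ X₀ U n ω) (U (n + 1) ω)

/-- `Γ_n = γ₁ + ⋯ + γ_n`. -/
def totalTime (γ : ℕ → ℝ) (n : ℕ) : ℝ := ∑ k ∈ Finset.Icc 1 n, γ k

/-- The empirical measure `ν_n = Γ_n⁻¹ ∑_{k=1}^n γ_k δ_{X_{k-1}}` of a trajectory `X`. -/
def empirical {d : ℕ} (γ : ℕ → ℝ) (X : ℕ → EuclideanSpace ℝ (Fin d)) (n : ℕ) :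
    Measure (EuclideanSpace ℝ (Fin d)) :=
  ENNReal.ofReal (totalTime γ n)⁻¹ •
    ∑ k ∈ Finset.Icc 1 n, ENNReal.ofReal (γ k) • Measure.dirac (X (k - 1))

end

end DecreasingStep

open DecreasingStep

/-!
Sharp Gaussian deviations for `√Γ_n ν_n(𝒜φ)` by Chernoff's bound. Write
`S_n = ∑_{k ≤ n} γ_k 𝒜φ(X_{k-1})`, `W = √V` and `v = ν(|σ*∇φ|²)`. For `0 < a ≤ A_n` the optimal
parameter `l = a / (v √Γ_n)` tends to zero, so that only `E exp(l S_n)` for small `l` matters, and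
it has to be compared with `exp(l² v Γ_n / 2)`, up to a factor `1 + o(1)` in front and in the
exponent.

The Poisson equation is used through the corrector `f = -φ - (l/2) ϑ` (`corrector`). A Taylor
expansion of one Euler step gives
`E_x exp(l (f(X₁) - f(x))) ≤ exp(l γ 𝒜f(x) + l² γ |σ*∇f(x)|² / 2 + error)`
(`InnovationLaw.exp_moment_euler_step`): the third moments of the innovations vanish, which leaves
an error of order `γ^{(3+β)/2}` in the mean, and the Lipschitz continuity of `⟨b, ∇φ⟩` bounds the
contribution of the unbounded drift by `γ² |b|` instead of `γ² |b|²`. Since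
`𝒜ϑ = |σ*∇φ|² - v`, the term of order `l²` in `l 𝒜f` turns the random variance `|σ*∇φ|²` into the
constant `v`. Hence `exp(l (f(X_n) - f(X_0)) + l S_n - l² v Γ_n / 2 - errors)` has expectation at
most one (`exists_lintegral_logFactor_le_one`, `lintegral_exp_sum_le_one`).

What is left, namely `l (f(X_n) - f(X_0))` and the errors `l γ_k² |b(X_{k-1})|`, is bounded by a
combination of the variables `W(X_k)`. These are sub-Gaussian uniformly in `k`: `W` is Lipschitz
because `|∇V|² ≤ C_V V`, so the concentration of the innovations applies to it, and the Lyapunov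
condition contracts its conditional mean (`LyapunovCondition.exp_sqrt_moment`). Convexity of the
exponential with weights `1 - ε` and `ε` removes this remainder
(`lintegral_exp_one_sub_mul_le`).

Finally, `γ_n ≍ n^{-θ}` with `θ > 1/(2+β)` means that `γ_n^{1+β} Γ_n → 0`, which makes the bias
`∑ γ_k^{(3+β)/2}` and `∑ γ_k²` negligible with respect to `√Γ_n` (`isLittleO_sum_sqrt_rpow`,
`isLittleO_two_add_sum_sq`). The resulting bound holds for every `ε` and all large `n`; a diagonal
extraction (`exists_strictAnti_of_eventually`) produces monotone sequences, and for the finitely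
many remaining `n` the bound `2 · exp 0` is trivial. The lower tail is the upper tail of `-φ`.
-/

namespace DecreasingStep

/-! ### Taylor expansions along a segment -/

section Taylor

variable {E : Type*} [NormedAddCommGroup E] [NormedSpace ℝ E]

lemma iteratedDeriv_comp_line {n : ℕ} {f : E → ℝ} (hf : ContDiff ℝ n f) (y h : E) (t : ℝ)
    {k : ℕ} (hk : k ≤ n) :
    iteratedDeriv k (fun s : ℝ => f (y + s • h)) t
      = iteratedFDeriv ℝ k f (y + t • h) (fun _ => h) := by
  have h1 : (fun s : ℝ => f (y + s • h))
      = (fun z => f (y + z)) ∘ (ContinuousLinearMap.toSpanSingleton ℝ h) := by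
    ext s; simp
  have h2 : ContDiff ℝ n (fun z => f (y + z)) := hf.comp (contDiff_const.add contDiff_id)
  rw [iteratedDeriv_eq_iteratedFDeriv, h1,
    ContinuousLinearMap.iteratedFDeriv_comp_right _ h2 _ (by exact_mod_cast hk)]
  simp [iteratedFDeriv_comp_add_left]

/-- Taylor's formula in a normed space, with the remainder in Lagrange form on the segment
`[y, y + h]`. -/
lemma exists_taylor_lagrange_segment {n : ℕ} {f : E → ℝ} (hf : ContDiff ℝ (n + 1 : ℕ) f)
    (y h : E) :
    ∃ t ∈ Set.Ioo (0 : ℝ) 1, f (y + h)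
      = (∑ k ∈ Finset.range (n + 1), ((k.factorial : ℝ)⁻¹ * iteratedFDeriv ℝ k f y fun _ => h))
        + iteratedFDeriv ℝ (n + 1) f (y + t • h) (fun _ => h) / ((n + 1).factorial : ℝ) := by
  have hg : ContDiff ℝ (n + 1 : ℕ) (fun s : ℝ => f (y + s • h)) := by fun_prop
  obtain ⟨t, ht, hE⟩ := taylor_mean_remainder_lagrange_iteratedDeriv (n := n)
    (zero_ne_one : (0 : ℝ) ≠ 1) (f := fun s : ℝ => f (y + s • h))
    (by exact_mod_cast hg.contDiffOn)
  rw [Set.uIoo_of_le zero_le_one] at ht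
  refine ⟨t, ht, ?_⟩
  rw [iteratedDeriv_comp_line hf y h t le_rfl] at hE
  have hs : taylorWithinEval (fun s : ℝ => f (y + s • h)) n (Set.uIcc 0 1) 0 1
      = ∑ k ∈ Finset.range (n + 1),
          ((k.factorial : ℝ)⁻¹ * iteratedFDeriv ℝ k f y fun _ => h) := by
    rw [taylor_within_apply]
    refine Finset.sum_congr rfl fun k hk => ?_
    have hk' : k ≤ n + 1 := (Finset.mem_range.1 hk).le
    rw [iteratedDerivWithin_eq_iteratedDeriv (uniqueDiffOn_uIcc zero_ne_one)
      ((hg.of_le (by exact_mod_cast hk')).contDiffAt) (by simp),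
      iteratedDeriv_comp_line hf y h 0 hk']
    simp
  rw [hs] at hE
  simp only [one_smul, sub_zero, one_pow, mul_one] at hE
  linarith

lemma abs_iteratedFDeriv_apply_const_le {k : ℕ} {f : E → ℝ} {M : ℝ} {x : E}
    (hM : ‖iteratedFDeriv ℝ k f x‖ ≤ M) (h : E) :
    |iteratedFDeriv ℝ k f x (fun _ => h)| ≤ M * ‖h‖ ^ k := by
  have := (iteratedFDeriv ℝ k f x).le_opNorm (fun _ => h)
  rw [Finset.prod_const, Finset.card_univ, Fintype.card_fin, Real.norm_eq_abs] at this
  exact this.trans (by gcongr)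

lemma taylor_order_zero {f : E → ℝ} (hf : ContDiff ℝ 1 f) {M : ℝ}
    (hM : ∀ x, ‖iteratedFDeriv ℝ 1 f x‖ ≤ M) (y h : E) :
    |f (y + h) - f y| ≤ M * ‖h‖ := by
  obtain ⟨t, -, ht⟩ := exists_taylor_lagrange_segment (n := 0) (by exact_mod_cast hf) y h
  have := abs_iteratedFDeriv_apply_const_le (hM (y + t • h)) h
  simp only [zero_add, Finset.sum_range_one, Nat.factorial_zero, Nat.cast_one, inv_one, one_mul,
    iteratedFDeriv_zero_apply, Nat.factorial_one, div_one, pow_one] at ht this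
  rw [ht]
  simpa using this

lemma taylor_order_one {f : E → ℝ} (hf : ContDiff ℝ 2 f) {M : ℝ}
    (hM : ∀ x, ‖iteratedFDeriv ℝ 2 f x‖ ≤ M) (y h : E) :
    |f (y + h) - f y - fderiv ℝ f y h| ≤ M / 2 * ‖h‖ ^ 2 := by
  obtain ⟨t, -, ht⟩ := exists_taylor_lagrange_segment (n := 1) (by exact_mod_cast hf) y h
  have := abs_iteratedFDeriv_apply_const_le (hM (y + t • h)) h
  simp only [Nat.reduceAdd, Finset.sum_range_succ, Finset.sum_range_zero, Nat.factorial,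
    Nat.cast_one, inv_one, one_mul, iteratedFDeriv_zero_apply, iteratedFDeriv_one_apply,
    Nat.succ_eq_add_one, zero_add, mul_one, Nat.cast_ofNat] at ht this
  rw [ht]
  ring_nf
  rw [abs_mul, abs_of_pos (by norm_num : (0 : ℝ) < 1 / 2)]
  linarith

/-- Third order Taylor expansion of a function whose third derivative is Hölder continuous. -/
lemma taylor_order_three {f : E → ℝ} (hf : ContDiff ℝ 3 f) {M β : ℝ} (hM0 : 0 ≤ M) (hβ : 0 ≤ β)
    (hM : ∀ x y, ‖iteratedFDeriv ℝ 3 f x - iteratedFDeriv ℝ 3 f y‖ ≤ M * ‖x - y‖ ^ β) (y h : E) :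
    |f (y + h) - f y - fderiv ℝ f y h - iteratedFDeriv ℝ 2 f y (fun _ => h) / 2
      - iteratedFDeriv ℝ 3 f y (fun _ => h) / 6| ≤ M / 6 * (‖h‖ ^ β * ‖h‖ ^ 3) := by
  obtain ⟨t, ht01, ht⟩ := exists_taylor_lagrange_segment (n := 2) (by exact_mod_cast hf) y h
  simp only [Nat.reduceAdd, Finset.sum_range_succ, Finset.sum_range_zero, Nat.factorial,
    Nat.cast_one, inv_one, one_mul, iteratedFDeriv_zero_apply, iteratedFDeriv_one_apply,
    Nat.succ_eq_add_one, zero_add, mul_one, Nat.cast_ofNat, Nat.reduceMul] at ht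
  have h1 : |(iteratedFDeriv ℝ 3 f (y + t • h) - iteratedFDeriv ℝ 3 f y) (fun _ => h)|
      ≤ M * ‖h‖ ^ β * ‖h‖ ^ 3 := by
    have := (iteratedFDeriv ℝ 3 f (y + t • h) - iteratedFDeriv ℝ 3 f y).le_opNorm (fun _ => h)
    rw [Finset.prod_const, Finset.card_univ, Fintype.card_fin, Real.norm_eq_abs] at this
    refine this.trans ?_
    gcongr
    refine (hM _ _).trans ?_
    gcongr
    rw [add_sub_cancel_left, norm_smul, Real.norm_eq_abs, abs_of_pos ht01.1]
    exact mul_le_of_le_one_left (norm_nonneg _) ht01.2.le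
  rw [sub_apply] at h1
  rw [ht]
  have : ∀ a b c d e : ℝ, a + b + 2⁻¹ * c + e / 6 - a - b - c / 2 - d / 6 = (e - d) / 6 := by
    intros; ring
  rw [this, abs_div, abs_of_pos (by norm_num : (0 : ℝ) < 6)]
  linarith

lemma norm_fderiv_sub_le {f : E → ℝ} (hf : ContDiff ℝ 2 f) {M : ℝ}
    (hM : ∀ x, ‖iteratedFDeriv ℝ 2 f x‖ ≤ M) (x y : E) :
    ‖fderiv ℝ f y - fderiv ℝ f x‖ ≤ M * ‖y - x‖ := by
  refine Convex.norm_image_sub_le_of_norm_fderiv_le (𝕜 := ℝ) (s := Set.univ) (fun z _ => ?_)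
    (fun z _ => ?_) convex_univ (Set.mem_univ _) (Set.mem_univ _)
  · exact (hf.fderiv_right (m := 1) (by norm_num)).differentiable (by norm_num) z
  · have h := hM z
    rwa [show 2 = 0 + 1 + 1 from rfl, ← norm_iteratedFDeriv_fderiv, ← norm_iteratedFDeriv_fderiv,
      norm_iteratedFDeriv_zero] at h

lemma norm_iteratedFDeriv_two_sub_le {f : E → ℝ} (hf : ContDiff ℝ 3 f) {M : ℝ}
    (hM : ∀ x, ‖iteratedFDeriv ℝ 3 f x‖ ≤ M) (x y : E) :
    ‖iteratedFDeriv ℝ 2 f y - iteratedFDeriv ℝ 2 f x‖ ≤ M * ‖y - x‖ := by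
  refine Convex.norm_image_sub_le_of_norm_fderiv_le (𝕜 := ℝ) (s := Set.univ) (fun z _ => ?_)
    (fun z _ => ?_) convex_univ (Set.mem_univ _) (Set.mem_univ _)
  · exact hf.differentiable_iteratedFDeriv (by norm_num) z
  · rw [norm_fderiv_iteratedFDeriv]; exact hM z

end Taylor

/-! ### Moments and concentration of the innovations -/

section Innovation

variable {r : ℕ} {μ : Measure (EuclideanSpace ℝ (Fin r))}

/-- Gaussian concentration for functions of arbitrary Lipschitz constant. -/
lemma InnovationLaw.concentration_of_lipschitz (hμ : InnovationLaw μ)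
    {g : EuclideanSpace ℝ (Fin r) → ℝ} {L : ℝ≥0} (hg : LipschitzWith L g) {l : ℝ} (hl : 0 ≤ l) :
    Integrable (fun u => Real.exp (l * g u)) μ ∧
      ∫ u, Real.exp (l * g u) ∂μ ≤ Real.exp (l * ∫ u, g u ∂μ + l ^ 2 * L ^ 2 / 2) := by
  have := hμ.isProbabilityMeasure
  rcases eq_or_lt_of_le (mul_nonneg hl L.2) with h0 | hpos
  · rcases mul_eq_zero.1 h0.symm with h | h
    · subst h; simp
    · have hL : L = 0 := NNReal.coe_eq_zero.1 h
      subst hL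
      have hc : ∀ u, g u = g 0 := fun u => by
        have := hg.dist_le_mul u 0
        simpa [dist_eq_zero] using this
      rw [show g = fun _ => g 0 from funext hc]
      simp
  · have hLpos : (0 : ℝ) < L := by
      rcases eq_or_lt_of_le L.2 with h | h
      · change (0 : ℝ) = L at h
        rw [NNReal.val_eq_coe, ← h] at hpos; simp at hpos
      · exact h
    have h1 : LipschitzWith 1 (fun u => (L : ℝ)⁻¹ * g u) := by
      refine LipschitzWith.of_dist_le_mul fun u v => ?_
      have h2 := hg.dist_le_mul u v
      rw [Real.dist_eq] at h2 ⊢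
      rw [← mul_sub, abs_mul, abs_of_pos (inv_pos.2 hLpos), inv_mul_le_iff₀ hLpos]
      simpa using h2
    obtain ⟨hi, hb⟩ := hμ.concentration _ h1 (l * L) hpos
    have h3 : ∀ u, l * L * ((L : ℝ)⁻¹ * g u) = l * g u := fun u => by field_simp
    simp only [h3] at hi hb
    refine ⟨hi, hb.trans_eq ?_⟩
    rw [integral_const_mul]
    congr 1
    field_simp

lemma InnovationLaw.integrable_exp_norm (hμ : InnovationLaw μ) {l : ℝ} (hl : 0 ≤ l) :
    Integrable (fun u => Real.exp (l * ‖u‖)) μ :=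
  (hμ.concentration_of_lipschitz (L := 1) lipschitzWith_one_norm hl).1

lemma InnovationLaw.integrable_of_le_exp (hμ : InnovationLaw μ)
    {g : EuclideanSpace ℝ (Fin r) → ℝ} (hg : Continuous g) {C l : ℝ} (hl : 0 ≤ l)
    (h : ∀ u, |g u| ≤ C * Real.exp (l * ‖u‖)) : Integrable g μ :=
  ((hμ.integrable_exp_norm hl).const_mul C).mono' hg.aestronglyMeasurable
    (Eventually.of_forall h)

lemma pow_le_factorial_mul_exp (n : ℕ) {x : ℝ} (hx : 0 ≤ x) :
    x ^ n ≤ n.factorial * Real.exp x := by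
  have := Real.pow_div_factorial_le_exp x hx n
  rwa [div_le_iff₀' (by positivity)] at this

lemma InnovationLaw.integrable_norm_pow (hμ : InnovationLaw μ) (n : ℕ) :
    Integrable (fun u => ‖u‖ ^ n) μ := by
  refine hμ.integrable_of_le_exp (by fun_prop) zero_le_one (C := n.factorial) fun u => ?_
  rw [abs_of_nonneg (by positivity), one_mul]
  exact pow_le_factorial_mul_exp n (norm_nonneg u)

lemma InnovationLaw.integrable_norm_pow_mul_exp (hμ : InnovationLaw μ) (n : ℕ) {l : ℝ}
    (hl : 0 ≤ l) : Integrable (fun u => ‖u‖ ^ n * Real.exp (l * ‖u‖)) μ := by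
  refine hμ.integrable_of_le_exp (by fun_prop) (add_nonneg hl zero_le_one) (C := n.factorial)
    fun u => ?_
  rw [abs_of_nonneg (by positivity), add_mul, one_mul, Real.exp_add]
  have := pow_le_factorial_mul_exp n (norm_nonneg u)
  have h2 := Real.exp_pos (l * ‖u‖)
  nlinarith

lemma InnovationLaw.integrable_rpow (hμ : InnovationLaw μ) (n : ℕ) {β : ℝ} (hβ : 0 ≤ β)
    (hβ1 : β ≤ 1) : Integrable (fun u => ‖u‖ ^ β * ‖u‖ ^ n) μ := by
  refine ((hμ.integrable_norm_pow n).add (hμ.integrable_norm_pow (n + 1))).mono'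
    ((continuous_norm.rpow_const fun _ => Or.inr hβ).mul
      (by fun_prop)).aestronglyMeasurable (Eventually.of_forall fun u => ?_)
  rw [Real.norm_eq_abs, abs_of_nonneg (by positivity)]
  have : ‖u‖ ^ β ≤ 1 + ‖u‖ := by
    rcases le_total ‖u‖ 1 with h | h
    · have := Real.rpow_le_one (norm_nonneg u) h hβ
      have := norm_nonneg u
      linarith
    · have := Real.rpow_le_rpow_of_exponent_le h hβ1
      rw [Real.rpow_one] at this
      linarith
  have h3 : 0 ≤ ‖u‖ ^ n := by positivity
  simp only [Pi.add_apply, pow_succ]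
  nlinarith

lemma InnovationLaw.integrable_multilinear (hμ : InnovationLaw μ) {k : ℕ}
    (B : ContinuousMultilinearMap ℝ (fun _ : Fin k => EuclideanSpace ℝ (Fin r)) ℝ) :
    Integrable (fun u => B fun _ => u) μ := by
  refine ((hμ.integrable_norm_pow k).const_mul ‖B‖).mono'
    (B.cont.comp (continuous_pi fun _ => continuous_id)).aestronglyMeasurable
    (Eventually.of_forall fun u => ?_)
  simpa using B.le_opNorm (fun _ => u)

lemma eq_sum_smul_basisVec {n : ℕ} (u : EuclideanSpace ℝ (Fin n)) :
    u = ∑ j, u j • (basisVec j : EuclideanSpace ℝ (Fin n)) := by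
  ext i
  simp [Finset.sum_apply, Pi.single_apply]

lemma multilinear_diag_eq_sum {k : ℕ}
    (B : ContinuousMultilinearMap ℝ (fun _ : Fin k => EuclideanSpace ℝ (Fin r)) ℝ)
    (u : EuclideanSpace ℝ (Fin r)) :
    (B fun _ => u) = ∑ s : Fin k → Fin r, (∏ i, u (s i)) * B fun i => basisVec (s i) := by
  conv_lhs => rw [eq_sum_smul_basisVec u]
  rw [B.map_sum]
  refine Finset.sum_congr rfl fun s _ => ?_
  rw [B.map_smul_univ]
  simp

lemma InnovationLaw.integrable_coord_prod (hμ : InnovationLaw μ) {k : ℕ} (s : Fin k → Fin r) :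
    Integrable (fun u => ∏ i, u (s i)) μ := by
  refine (hμ.integrable_norm_pow k).mono' (by fun_prop) (Eventually.of_forall fun u => ?_)
  rw [norm_prod]
  refine (Finset.prod_le_prod (fun _ _ => norm_nonneg _)
    fun i _ => PiLp.norm_apply_le u (s i)).trans_eq ?_
  simp

lemma InnovationLaw.integral_multilinear (hμ : InnovationLaw μ) {k : ℕ}
    (B : ContinuousMultilinearMap ℝ (fun _ : Fin k => EuclideanSpace ℝ (Fin r)) ℝ) :
    ∫ u, (B fun _ => u) ∂μ
      = ∑ s : Fin k → Fin r, (∫ u, ∏ i, u (s i) ∂μ) * B fun i => basisVec (s i) := by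
  simp_rw [multilinear_diag_eq_sum B]
  rw [integral_finsetSum _ fun s _ => (hμ.integrable_coord_prod s).mul_const _]
  simp_rw [integral_mul_const]

lemma InnovationLaw.integral_linear (hμ : InnovationLaw μ)
    (B : EuclideanSpace ℝ (Fin r) →L[ℝ] ℝ) : ∫ u, B u ∂μ = 0 := by
  have hi : ∀ i : Fin r, Integrable (fun u => u i * B (basisVec i)) μ := fun i => by
    have := (hμ.integrable_coord_prod (k := 1) fun _ => i).mul_const (B (basisVec i))
    simpa using this
  have h : ∀ u, B u = ∑ i, u i * B (basisVec i) := fun u => by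
    conv_lhs => rw [eq_sum_smul_basisVec u, map_sum]
    simp_rw [map_smul, smul_eq_mul]
  rw [integral_congr_ae (Eventually.of_forall h)]
  rw [integral_finsetSum _ fun i _ => hi i]
  simp_rw [integral_mul_const, hμ.mean]
  simp

lemma InnovationLaw.integral_bilinear (hμ : InnovationLaw μ)
    (B : ContinuousMultilinearMap ℝ (fun _ : Fin 2 => EuclideanSpace ℝ (Fin r)) ℝ) :
    ∫ u, (B fun _ => u) ∂μ = ∑ j, B ![basisVec j, basisVec j] := by
  rw [hμ.integral_multilinear]
  simp_rw [Fin.prod_univ_two, hμ.covariance]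
  rw [← (finTwoArrowEquiv (Fin r)).symm.sum_comp, Fintype.sum_prod_type]
  refine Finset.sum_congr rfl fun j _ => ?_
  simp only [finTwoArrowEquiv_symm_apply, Matrix.cons_val_zero, Matrix.cons_val_one, ite_mul,
    one_mul, zero_mul, Finset.sum_ite_eq, Finset.mem_univ, if_true]
  congr 1
  ext i : 1
  fin_cases i <;> rfl

lemma InnovationLaw.integral_trilinear (hμ : InnovationLaw μ)
    (B : ContinuousMultilinearMap ℝ (fun _ : Fin 3 => EuclideanSpace ℝ (Fin r)) ℝ) :
    ∫ u, (B fun _ => u) ∂μ = 0 := by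
  rw [hμ.integral_multilinear]
  simp_rw [Fin.prod_univ_three, hμ.third]
  simp

/-- The second moment of a linear form is its squared norm. -/
lemma InnovationLaw.integral_inner_sq (hμ : InnovationLaw μ) (w : EuclideanSpace ℝ (Fin r)) :
    ∫ u, (inner ℝ w u : ℝ) ^ 2 ∂μ = ‖w‖ ^ 2 := by
  have h : ∀ u, (inner ℝ w u : ℝ) ^ 2
      = ∑ i, ∑ j, (u i * u j) * (w i * w j) := fun u => by
    rw [PiLp.inner_apply, sq, Finset.sum_mul_sum]
    refine Finset.sum_congr rfl fun i _ => Finset.sum_congr rfl fun j _ => ?_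
    simp; ring
  have hi : ∀ i j : Fin r, Integrable (fun u => (u i * u j) * (w i * w j)) μ := fun i j => by
    have := (hμ.integrable_coord_prod (k := 2) ![i, j]).mul_const (w i * w j)
    simpa [Fin.prod_univ_two] using this
  simp_rw [h]
  rw [integral_finsetSum _ fun i _ => integrable_finsetSum _ fun j _ => hi i j]
  simp_rw [integral_finsetSum _ fun j _ => hi _ j, integral_mul_const, hμ.covariance]
  rw [EuclideanSpace.norm_sq_eq]
  simp [sq]

end Innovation

/-! ### Exponential moments of one step without drift -/

section OneStep

variable {d r : ℕ} {μ : Measure (EuclideanSpace ℝ (Fin r))}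

/-- Quantitative form of membership in `𝒞^{3,β}`: one constant `M` bounds the derivatives of orders
`1, 2, 3` and the `β`-Hölder seminorm of the third derivative. -/
structure HolderBound (β M : ℝ) (f : EuclideanSpace ℝ (Fin d) → ℝ) : Prop where
  contDiff : ContDiff ℝ 3 f
  bounded : ∀ i : ℕ, 1 ≤ i → i ≤ 3 → ∀ x, ‖iteratedFDeriv ℝ i f x‖ ≤ M
  holder : ∀ x y, ‖iteratedFDeriv ℝ 3 f x - iteratedFDeriv ℝ 3 f y‖ ≤ M * ‖x - y‖ ^ β

lemma InHolder.exists_holderBound {β : ℝ} {f : EuclideanSpace ℝ (Fin d) → ℝ}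
    (hf : InHolder 3 β f) : ∃ M, 0 ≤ M ∧ HolderBound β M f := by
  obtain ⟨K1, h1⟩ := hf.bounded 1 (by norm_num) (by norm_num)
  obtain ⟨K2, h2⟩ := hf.bounded 2 (by norm_num) (by norm_num)
  obtain ⟨K3, h3⟩ := hf.bounded 3 (by norm_num) (by norm_num)
  obtain ⟨K, h⟩ := hf.holder
  have e1 := le_abs_self K1
  have e2 := le_abs_self K2
  have e3 := le_abs_self K3
  have e4 := le_abs_self K
  have p1 := abs_nonneg K1
  have p2 := abs_nonneg K2
  have p3 := abs_nonneg K3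
  have p4 := abs_nonneg K
  refine ⟨|K1| + |K2| + |K3| + |K|, by positivity, by exact_mod_cast hf.contDiff, ?_, ?_⟩
  · intro i hi hi' x
    interval_cases i
    · linarith [h1 x]
    · linarith [h2 x]
    · linarith [h3 x]
  · intro x y
    refine (h x y).trans ?_
    gcongr
    linarith

lemma HolderBound.norm_fderiv_le {β M : ℝ} {f : EuclideanSpace ℝ (Fin d) → ℝ}
    (hf : HolderBound β M f) (x : EuclideanSpace ℝ (Fin d)) : ‖fderiv ℝ f x‖ ≤ M := by
  have := hf.bounded 1 (by norm_num) (by norm_num) x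
  rwa [show 1 = 0 + 1 from rfl, ← norm_iteratedFDeriv_fderiv, norm_iteratedFDeriv_zero] at this

lemma HolderBound.lincomb {β M N : ℝ} {f g : EuclideanSpace ℝ (Fin d) → ℝ}
    (hf : HolderBound β M f) (hg : HolderBound β N g)
    {a c : ℝ} (ha : |a| ≤ 1) (hc : |c| ≤ 1) :
    HolderBound β (M + N) (fun x => a * f x + c * g x) := by
  have key : ∀ i : ℕ, i ≤ 3 → ∀ x, iteratedFDeriv ℝ i (fun x => a * f x + c * g x) x
      = a • iteratedFDeriv ℝ i f x + c • iteratedFDeriv ℝ i g x := by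
    intro i hi x
    have h1 : ContDiff ℝ i f := hf.contDiff.of_le (by exact_mod_cast hi)
    have h2 : ContDiff ℝ i g := hg.contDiff.of_le (by exact_mod_cast hi)
    have : (fun x => a * f x + c * g x) = a • f + c • g := by
      ext; simp
    rw [this, iteratedFDeriv_add_apply (f := a • f) (g := c • g) (h1.const_smul a).contDiffAt
      (h2.const_smul c).contDiffAt,
      iteratedFDeriv_const_smul_apply h1.contDiffAt, iteratedFDeriv_const_smul_apply h2.contDiffAt]
  refine ⟨(contDiff_const.mul hf.contDiff).add (contDiff_const.mul hg.contDiff), ?_, ?_⟩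
  · intro i hi hi' x
    rw [key i hi']
    refine (norm_add_le _ _).trans ?_
    rw [norm_smul, norm_smul, Real.norm_eq_abs, Real.norm_eq_abs]
    have h1 := hf.bounded i hi hi' x
    have h2 := hg.bounded i hi hi' x
    have := mul_le_mul ha h1 (norm_nonneg _) zero_le_one
    have := mul_le_mul hc h2 (norm_nonneg _) zero_le_one
    linarith
  · intro x y
    rw [key 3 le_rfl, key 3 le_rfl, add_sub_add_comm, ← smul_sub, ← smul_sub]
    refine (norm_add_le _ _).trans ?_
    rw [norm_smul, norm_smul, Real.norm_eq_abs, Real.norm_eq_abs]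
    have := mul_le_mul ha (hf.holder x y) (norm_nonneg _) zero_le_one
    have := mul_le_mul hc (hg.holder x y) (norm_nonneg _) zero_le_one
    rw [add_mul]
    linarith

lemma exp_le_cubic (t : ℝ) :
    Real.exp t ≤ 1 + t + t ^ 2 / 2 + |t| ^ 3 * Real.exp |t| := by
  have h := Complex.norm_exp_sub_sum_le_norm_mul_exp (t : ℂ) 3
  have e : Complex.exp t - ∑ m ∈ Finset.range 3, (t : ℂ) ^ m / (m.factorial : ℂ)
      = ((Real.exp t - (1 + t + t ^ 2 / 2) : ℝ) : ℂ) := by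
    simp [Finset.sum_range_succ, Nat.factorial]
  rw [e, Complex.norm_real, Complex.norm_real, Real.norm_eq_abs, Real.norm_eq_abs] at h
  linarith [le_abs_self (Real.exp t - (1 + t + t ^ 2 / 2))]

lemma hess_eq_comp (f : EuclideanSpace ℝ (Fin d) → ℝ) (y : EuclideanSpace ℝ (Fin d))
    (T : EuclideanSpace ℝ (Fin r) →L[ℝ] EuclideanSpace ℝ (Fin d)) (j : Fin r) :
    ((iteratedFDeriv ℝ 2 f y).compContinuousLinearMap fun _ => T) ![basisVec j, basisVec j]
      = hess f y (T (basisVec j)) (T (basisVec j)) := by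
  rw [ContinuousMultilinearMap.compContinuousLinearMap_apply, hess]
  congr 1
  ext i : 1
  fin_cases i <;> rfl

lemma fderiv_comp_eq_inner_adjoint (f : EuclideanSpace ℝ (Fin d) → ℝ)
    (y : EuclideanSpace ℝ (Fin d))
    (T : EuclideanSpace ℝ (Fin r) →L[ℝ] EuclideanSpace ℝ (Fin d)) (u : EuclideanSpace ℝ (Fin r)) :
    fderiv ℝ f y (T u) = inner ℝ (T.adjoint (gradient f y)) u := by
  rw [ContinuousLinearMap.adjoint_inner_left, gradient, InnerProductSpace.toDual_symm_apply]

lemma inner_gradient_eq_fderiv (f : EuclideanSpace ℝ (Fin d) → ℝ)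
    (y v : EuclideanSpace ℝ (Fin d)) : (inner ℝ v (gradient f y) : ℝ) = fderiv ℝ f y v := by
  rw [real_inner_comm, gradient, InnerProductSpace.toDual_symm_apply]

/-- One Gaussian-like step without drift. The exponential moment of `f(y + qTU) - f(y)` is that of
a Gaussian variable, up to errors of the order of the Hölder Taylor remainder (in the mean) and of
`q³` (in the variance). The step size is `q²`. -/
lemma InnovationLaw.exp_moment_step (hμ : InnovationLaw μ) {β M s Q : ℝ} (hβ : 0 ≤ β)
    (hβ1 : β ≤ 1) (hM : 0 ≤ M) (hs : 0 ≤ s) (hQ : 0 ≤ Q) :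
    ∃ C, 0 ≤ C ∧ ∀ (f : EuclideanSpace ℝ (Fin d) → ℝ), HolderBound β M f →
      ∀ (T : EuclideanSpace ℝ (Fin r) →L[ℝ] EuclideanSpace ℝ (Fin d)), ‖T‖ ≤ s →
      ∀ q, 0 ≤ q → q ≤ Q → ∀ l, 0 ≤ l → l ≤ 1 → ∀ y,
      Integrable (fun u => Real.exp (l * (f (y + q • T u) - f y))) μ ∧
      ∫ u, Real.exp (l * (f (y + q • T u) - f y)) ∂μ
        ≤ Real.exp (l * (q ^ 2 / 2) * ∑ j, hess f y (T (basisVec j)) (T (basisVec j))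
            + l ^ 2 * (q ^ 2 / 2) * ‖T.adjoint (gradient f y)‖ ^ 2
            + C * (l * (q ^ β * q ^ 3) + l ^ 2 * q ^ 3)) := by
  have := hμ.isProbabilityMeasure
  set c1 := ∫ u, ‖u‖ ^ β * ‖u‖ ^ 3 ∂μ with hc1
  set c2 := ∫ u, ‖u‖ ^ 3 ∂μ with hc2
  set c3 := ∫ u, ‖u‖ ^ 3 * Real.exp (M * s * Q * ‖u‖) ∂μ with hc3
  have hc1' : 0 ≤ c1 := integral_nonneg fun u => by positivity
  have hc2' : 0 ≤ c2 := integral_nonneg fun u => by positivity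
  have hc3' : 0 ≤ c3 := integral_nonneg fun u => by positivity
  refine ⟨M / 6 * (s ^ β * s ^ 3) * c1 + (M ^ 2 * s ^ 3 / 2 * c2 + (M * s) ^ 3 * c3),
    by positivity, fun f hf T hT q hq hqQ l hl hl1 y => ?_⟩
  have hfc := hf.contDiff
  have hf2 : ContDiff ℝ 2 f := hfc.of_le (by norm_num)
  have hTu : ∀ u, ‖q • T u‖ ≤ q * (s * ‖u‖) := fun u => by
    rw [norm_smul, Real.norm_eq_abs, abs_of_nonneg hq]
    exact mul_le_mul_of_nonneg_left (T.le_of_opNorm_le hT u) hq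
  set h := fun u => f (y + q • T u) - f y with hh
  set ℓ := fun u => (inner ℝ (T.adjoint (gradient f y)) u : ℝ) with hℓ
  set B2 := (iteratedFDeriv ℝ 2 f y).compContinuousLinearMap fun _ => T with hB2
  set B3 := (iteratedFDeriv ℝ 3 f y).compContinuousLinearMap fun _ => T with hB3
  have b0 : ∀ u, |h u| ≤ M * s * q * ‖u‖ := fun u => by
    refine (taylor_order_zero (hfc.of_le (by norm_num)) (hf.bounded 1 (by norm_num)
      (by norm_num)) y (q • T u)).trans ?_
    have := mul_le_mul_of_nonneg_left (hTu u) hM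
    linarith
  have bℓ : ∀ u, |ℓ u| ≤ M * s * ‖u‖ := fun u => by
    simp only [hℓ]
    rw [← fderiv_comp_eq_inner_adjoint, ← Real.norm_eq_abs, mul_assoc]
    exact (ContinuousLinearMap.le_of_opNorm_le _ (hf.norm_fderiv_le y) _).trans
      (mul_le_mul_of_nonneg_left (T.le_of_opNorm_le hT u) hM)
  have b1 : ∀ u, |h u - q * ℓ u| ≤ M / 2 * s ^ 2 * q ^ 2 * ‖u‖ ^ 2 := fun u => by
    have h1 := taylor_order_one hf2 (hf.bounded 2 (by norm_num) (by norm_num)) y (q • T u)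
    rw [map_smul, fderiv_comp_eq_inner_adjoint, smul_eq_mul] at h1
    refine h1.trans ?_
    have h2 : ‖q • T u‖ ^ 2 ≤ (q * (s * ‖u‖)) ^ 2 := by gcongr; exact hTu u
    have := mul_le_mul_of_nonneg_left h2 (by positivity : 0 ≤ M / 2)
    calc _ ≤ _ := this
      _ = _ := by ring
  have b2 : ∀ u, h u ^ 2 ≤ q ^ 2 * ℓ u ^ 2 + M ^ 2 * s ^ 3 * q ^ 3 * ‖u‖ ^ 3 := fun u => by
    have h1 : |h u + q * ℓ u| ≤ 2 * (M * s * q * ‖u‖) := by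
      refine (abs_add_le _ _).trans ?_
      rw [abs_mul, abs_of_nonneg hq]
      have := mul_le_mul_of_nonneg_left (bℓ u) hq
      linarith [b0 u]
    have h2 := mul_le_mul (b1 u) h1 (abs_nonneg _) (by positivity)
    rw [← abs_mul] at h2
    have h3 := (le_abs_self _).trans h2
    linarith [h3]
  have b3 : ∀ u, h u ≤ q * ℓ u + q ^ 2 / 2 * B2 (fun _ => u) + q ^ 3 / 6 * B3 (fun _ => u)
      + M / 6 * (s ^ β * s ^ 3) * (q ^ β * q ^ 3) * (‖u‖ ^ β * ‖u‖ ^ 3) := fun u => by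
    have h1 := taylor_order_three hfc hM hβ hf.holder y (q • T u)
    have e2 : iteratedFDeriv ℝ 2 f y (fun _ => q • T u) = q ^ 2 * B2 (fun _ => u) := by
      have := (iteratedFDeriv ℝ 2 f y).map_smul_univ (fun _ => q) (fun _ => T u)
      simpa [hB2] using this
    have e3 : iteratedFDeriv ℝ 3 f y (fun _ => q • T u) = q ^ 3 * B3 (fun _ => u) := by
      have := (iteratedFDeriv ℝ 3 f y).map_smul_univ (fun _ => q) (fun _ => T u)
      simpa [hB3] using this
    rw [map_smul, fderiv_comp_eq_inner_adjoint, smul_eq_mul, e2, e3] at h1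
    have h2 : ‖q • T u‖ ^ β * ‖q • T u‖ ^ 3
        ≤ (q ^ β * (s ^ β * ‖u‖ ^ β)) * (q * (s * ‖u‖)) ^ 3 := by
      rw [← Real.mul_rpow hs (norm_nonneg _), ← Real.mul_rpow hq (by positivity)]
      have := hTu u
      gcongr
    have h3 := mul_le_mul_of_nonneg_left h2 (by positivity : 0 ≤ M / 6)
    have h4 := (le_abs_self _).trans (h1.trans h3)
    have h5 : M / 6 * ((q ^ β * (s ^ β * ‖u‖ ^ β)) * (q * (s * ‖u‖)) ^ 3)
      = M / 6 * (s ^ β * s ^ 3) * (q ^ β * q ^ 3) * (‖u‖ ^ β * ‖u‖ ^ 3) := by ring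
    simp only [hh, hℓ]
    linarith
  have b4 : ∀ u, |l * h u| ^ 3 * Real.exp |l * h u|
      ≤ l ^ 2 * q ^ 3 * (M * s) ^ 3 * (‖u‖ ^ 3 * Real.exp (M * s * Q * ‖u‖)) := fun u => by
    have h1 : |l * h u| ≤ l * (M * s * q * ‖u‖) := by
      rw [abs_mul, abs_of_nonneg hl]
      exact mul_le_mul_of_nonneg_left (b0 u) hl
    have h2 : l * (M * s * q * ‖u‖) ≤ M * s * Q * ‖u‖ := by
      refine (mul_le_of_le_one_left (by positivity) hl1).trans ?_
      gcongr
    have h3 : |l * h u| ^ 3 ≤ l ^ 2 * q ^ 3 * (M * s) ^ 3 * ‖u‖ ^ 3 := by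
      refine (pow_le_pow_left₀ (abs_nonneg _) h1 3).trans ?_
      have : l ^ 3 ≤ l ^ 2 := pow_le_pow_of_le_one hl hl1 (by norm_num)
      calc (l * (M * s * q * ‖u‖)) ^ 3 = l ^ 3 * (q ^ 3 * (M * s) ^ 3 * ‖u‖ ^ 3) := by ring
        _ ≤ l ^ 2 * (q ^ 3 * (M * s) ^ 3 * ‖u‖ ^ 3) := by gcongr
        _ = _ := by ring
    rw [← mul_assoc]
    gcongr
    exact h1.trans h2
  have hcont : Continuous h := by
    have := hfc.continuous
    fun_prop
  -- the pointwise majorant of `exp (l * h)`, term by term integrable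
  set G := fun u => 1 + (l * q) * ℓ u + (l * (q ^ 2 / 2)) * B2 (fun _ => u)
      + (l * (q ^ 3 / 6)) * B3 (fun _ => u)
      + (l * (M / 6 * (s ^ β * s ^ 3) * (q ^ β * q ^ 3))) * (‖u‖ ^ β * ‖u‖ ^ 3)
      + (l ^ 2 * (q ^ 2 / 2)) * ℓ u ^ 2
      + (l ^ 2 / 2 * (M ^ 2 * s ^ 3 * q ^ 3)) * ‖u‖ ^ 3
      + (l ^ 2 * q ^ 3 * (M * s) ^ 3) * (‖u‖ ^ 3 * Real.exp (M * s * Q * ‖u‖)) with hG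
  have bG : ∀ u, Real.exp (l * h u) ≤ G u := fun u => by
    have h1 := exp_le_cubic (l * h u)
    have h2 := mul_le_mul_of_nonneg_left (b3 u) hl
    have h3 := mul_le_mul_of_nonneg_left (b2 u) (by positivity : 0 ≤ l ^ 2 / 2)
    have h4 := b4 u
    simp only [hG]
    linarith
  have iℓ : Integrable ℓ μ := hμ.integrable_of_le_exp (by fun_prop) zero_le_one (C := M * s)
    fun u => by
      refine (bℓ u).trans ?_
      have := pow_le_factorial_mul_exp 1 (norm_nonneg u)
      gcongr
      simpa using this
  have iℓ2 : Integrable (fun u => ℓ u ^ 2) μ :=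
    ((hμ.integrable_norm_pow 2).const_mul ((M * s) ^ 2)).mono' (by fun_prop)
      (Eventually.of_forall fun u => by
        rw [Real.norm_eq_abs, abs_pow, ← mul_pow]
        exact pow_le_pow_left₀ (abs_nonneg _) (bℓ u) 2)
  have i1 := (hμ.integrable_rpow 3 hβ hβ1)
  have i2 := hμ.integrable_norm_pow 3
  have i3 := hμ.integrable_norm_pow_mul_exp 3 (by positivity : 0 ≤ M * s * Q)
  have iB2 := hμ.integrable_multilinear B2
  have iB3 := hμ.integrable_multilinear B3
  have j1 := (integrable_const (1 : ℝ)).add (iℓ.const_mul (l * q)) (μ := μ)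
  have j2 := j1.add (iB2.const_mul (l * (q ^ 2 / 2)))
  have j3 := j2.add (iB3.const_mul (l * (q ^ 3 / 6)))
  have j4 := j3.add (i1.const_mul (l * (M / 6 * (s ^ β * s ^ 3) * (q ^ β * q ^ 3))))
  have j5 := j4.add (iℓ2.const_mul (l ^ 2 * (q ^ 2 / 2)))
  have j6 := j5.add (i2.const_mul (l ^ 2 / 2 * (M ^ 2 * s ^ 3 * q ^ 3)))
  have iG := j6.add (i3.const_mul (l ^ 2 * q ^ 3 * (M * s) ^ 3))
  have iE : Integrable (fun u => Real.exp (l * h u)) μ := by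
    refine Integrable.mono' (g := G) iG (by fun_prop) (Eventually.of_forall fun u => ?_)
    rw [Real.norm_eq_abs, abs_of_pos (Real.exp_pos _)]
    exact bG u
  have hIG : ∫ u, G u ∂μ = 1 + (l * q) * ∫ u, ℓ u ∂μ + (l * (q ^ 2 / 2)) * ∫ u, B2 (fun _ => u) ∂μ
      + (l * (q ^ 3 / 6)) * ∫ u, B3 (fun _ => u) ∂μ
      + (l * (M / 6 * (s ^ β * s ^ 3) * (q ^ β * q ^ 3))) * c1
      + (l ^ 2 * (q ^ 2 / 2)) * ∫ u, ℓ u ^ 2 ∂μ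
      + (l ^ 2 / 2 * (M ^ 2 * s ^ 3 * q ^ 3)) * c2
      + (l ^ 2 * q ^ 3 * (M * s) ^ 3) * c3 := by
    have e1 := integral_add j6 (i3.const_mul (l ^ 2 * q ^ 3 * (M * s) ^ 3))
    have e2 := integral_add j5 (i2.const_mul (l ^ 2 / 2 * (M ^ 2 * s ^ 3 * q ^ 3)))
    have e3 := integral_add j4 (iℓ2.const_mul (l ^ 2 * (q ^ 2 / 2)))
    have e4 := integral_add j3
      (i1.const_mul (l * (M / 6 * (s ^ β * s ^ 3) * (q ^ β * q ^ 3))))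
    have e5 := integral_add j2 (iB3.const_mul (l * (q ^ 3 / 6)))
    have e6 := integral_add j1 (iB2.const_mul (l * (q ^ 2 / 2)))
    have e7 := integral_add (integrable_const (1 : ℝ)) (iℓ.const_mul (l * q)) (μ := μ)
    simp only [Pi.add_apply, integral_const_mul, integral_const, probReal_univ, smul_eq_mul,
      one_mul] at e1 e2 e3 e4 e5 e6 e7
    rw [hG, e1, e2, e3, e4, e5, e6, e7]
  refine ⟨iE, (integral_mono iE iG bG).trans ?_⟩
  have z1 : ∫ u, ℓ u ∂μ = 0 := hμ.integral_linear (innerSL ℝ (T.adjoint (gradient f y)))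
  have z2 := hμ.integral_bilinear B2
  simp_rw [hB2, hess_eq_comp] at z2
  rw [← hB2] at z2
  change ∫ u, G u ∂μ ≤ _
  rw [hIG, z1, z2, hμ.integral_trilinear B3, hμ.integral_inner_sq]
  refine le_trans ?_ (Real.add_one_le_exp _)
  have p1 : 0 ≤ l * (q ^ β * q ^ 3) := by positivity
  have p2 : 0 ≤ l ^ 2 * q ^ 3 := by positivity
  have p3 := mul_nonneg p2 (by positivity : 0 ≤ M / 6 * (s ^ β * s ^ 3) * c1)
  have p4 := mul_nonneg p1 (by positivity : 0 ≤ M ^ 2 * s ^ 3 / 2 * c2 + (M * s) ^ 3 * c3)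
  nlinarith [p3, p4]

end OneStep

/-! ### Exponential moments of one Euler step -/

section OneStepDrift

variable {d r : ℕ} {μ : Measure (EuclideanSpace ℝ (Fin r))}

lemma norm_basisVec {n : ℕ} (j : Fin n) : ‖(basisVec j : EuclideanSpace ℝ (Fin n))‖ = 1 := by
  simp [basisVec]

lemma abs_hess_sub_le {β M : ℝ} {f : EuclideanSpace ℝ (Fin d) → ℝ} (hf : HolderBound β M f)
    (x y w : EuclideanSpace ℝ (Fin d)) :
    |hess f y w w - hess f x w w| ≤ M * ‖y - x‖ * ‖w‖ ^ 2 := by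
  have h1 := norm_iteratedFDeriv_two_sub_le hf.contDiff
    (hf.bounded 3 (by norm_num) (by norm_num)) x y
  have h2 := (iteratedFDeriv ℝ 2 f y - iteratedFDeriv ℝ 2 f x).le_opNorm ![w, w]
  rw [sub_apply, Fin.prod_univ_two, Real.norm_eq_abs] at h2
  refine h2.trans ?_
  simp only [Matrix.cons_val_zero, Matrix.cons_val_one]
  rw [← sq]
  gcongr

/-- The drift part of one step. Without the condition `hv`, which reflects the Lipschitz continuity
of `⟨b, ∇f⟩`, the error would be quadratic in the drift `v`. -/
lemma abs_drift_expansion_le {f : EuclideanSpace ℝ (Fin d) → ℝ} (hf : ContDiff ℝ 1 f) {M : ℝ}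
    {x v : EuclideanSpace ℝ (Fin d)} (hM : 0 ≤ M)
    (hv : ∀ z, |fderiv ℝ f z v - fderiv ℝ f x v| ≤ M * ‖z - x‖) {g : ℝ} (hg : 0 ≤ g) :
    |f (x + g • v) - f x - g * fderiv ℝ f x v| ≤ M * (g ^ 2 * ‖v‖) := by
  obtain ⟨t, ht01, ht⟩ := exists_taylor_lagrange_segment (n := 0) (by exact_mod_cast hf) x (g • v)
  simp only [zero_add, Finset.sum_range_one, Nat.factorial_zero, Nat.cast_one, inv_one, one_mul,
    iteratedFDeriv_zero_apply, Nat.factorial_one, div_one] at ht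
  have e : ∀ z, iteratedFDeriv ℝ (0 + 1) f z (fun _ => g • v) = g * fderiv ℝ f z v := fun z => by
    change iteratedFDeriv ℝ 1 f z _ = _
    rw [iteratedFDeriv_one_apply, map_smul, smul_eq_mul]
  rw [ht, e, add_sub_cancel_left, ← mul_sub, abs_mul, abs_of_nonneg hg]
  have h1 := hv (x + t • g • v)
  rw [add_sub_cancel_left, norm_smul, norm_smul, Real.norm_eq_abs, Real.norm_eq_abs,
    abs_of_nonneg hg, abs_of_pos ht01.1] at h1
  have h2 : t * (g * ‖v‖) ≤ g * ‖v‖ := mul_le_of_le_one_left (by positivity) ht01.2.le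
  calc _ ≤ g * (M * (g * ‖v‖)) := by
        refine mul_le_mul_of_nonneg_left (h1.trans ?_) hg
        gcongr
    _ = _ := by ring

lemma sum_abs_le_card {n : ℕ} {a : Fin n → ℝ} {c : ℝ} (h : ∀ j, |a j| ≤ c) :
    |∑ j, a j| ≤ n * c := by
  refine (Finset.abs_sum_le_sum_abs _ _).trans ((Finset.sum_le_sum fun j _ => h j).trans ?_)
  simp

/-- One step of the Euler scheme from `x`, with step size `q²`, drift `v` and diffusion matrix `T`:
the exponential moment of the increment of `f` is that of a Gaussian variable with mean
`q² 𝒜f(x)` and variance `q² |T*∇f(x)|²`, up to lower order terms. -/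
lemma InnovationLaw.exp_moment_euler_step (hμ : InnovationLaw μ) {β M s Q : ℝ} (hβ : 0 ≤ β)
    (hβ1 : β ≤ 1) (hM : 0 ≤ M) (hs : 0 ≤ s) (hQ : 0 ≤ Q) :
    ∃ C, 0 ≤ C ∧ ∀ (f : EuclideanSpace ℝ (Fin d) → ℝ), HolderBound β M f →
      ∀ (T : EuclideanSpace ℝ (Fin r) →L[ℝ] EuclideanSpace ℝ (Fin d)), ‖T‖ ≤ s →
      ∀ q, 0 ≤ q → q ≤ Q → ∀ l, 0 ≤ l → l ≤ 1 → ∀ x v,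
      (∀ z, |fderiv ℝ f z v - fderiv ℝ f x v| ≤ M * ‖z - x‖) →
      Integrable (fun u => Real.exp (l * (f (x + q ^ 2 • v + q • T u) - f x))) μ ∧
      ∫ u, Real.exp (l * (f (x + q ^ 2 • v + q • T u) - f x)) ∂μ
        ≤ Real.exp (l * q ^ 2 * (inner ℝ v (gradient f x)
              + (1 / 2) * ∑ j, hess f x (T (basisVec j)) (T (basisVec j)))
            + l ^ 2 * (q ^ 2 / 2) * ‖T.adjoint (gradient f x)‖ ^ 2
            + C * (l * (q ^ β * q ^ 3) + l ^ 2 * q ^ 3 + l * q ^ 4 * ‖v‖)) := by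
  obtain ⟨C, hC, H⟩ := hμ.exp_moment_step (d := d) hβ hβ1 hM hs hQ
  refine ⟨C + (M + r * (M * s ^ 2) / 2 + s ^ 2 * M ^ 2), by positivity,
    fun f hf T hT q hq hqQ l hl hl1 x v hv => ?_⟩
  set y := x + q ^ 2 • v with hy
  obtain ⟨h1, h2⟩ := H f hf T hT q hq hqQ l hl hl1 y
  have hsplit : ∀ u, Real.exp (l * (f (y + q • T u) - f x))
      = Real.exp (l * (f y - f x)) * Real.exp (l * (f (y + q • T u) - f y)) := fun u => by
    rw [← Real.exp_add]; congr 1; ring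
  simp_rw [hsplit]
  refine ⟨h1.const_mul _, ?_⟩
  rw [integral_const_mul]
  refine (mul_le_mul_of_nonneg_left h2 (Real.exp_pos _).le).trans ?_
  rw [← Real.exp_add]
  refine Real.exp_le_exp.2 ?_
  have hyx : ‖y - x‖ = q ^ 2 * ‖v‖ := by
    rw [hy, add_sub_cancel_left, norm_smul, Real.norm_eq_abs, abs_of_nonneg (by positivity)]
  have e1 := (le_abs_self _).trans (abs_drift_expansion_le (hf.contDiff.of_le (by norm_num)) hM hv
    (sq_nonneg q))
  rw [← hy] at e1
  have e2 : |∑ j, (hess f y (T (basisVec j)) (T (basisVec j))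
      - hess f x (T (basisVec j)) (T (basisVec j)))| ≤ r * (M * (q ^ 2 * ‖v‖) * s ^ 2) := by
    refine sum_abs_le_card fun j => (abs_hess_sub_le hf x y _).trans ?_
    rw [hyx]
    have : ‖T (basisVec j)‖ ≤ s := by
      have := T.le_of_opNorm_le hT (basisVec j)
      rwa [norm_basisVec, mul_one] at this
    gcongr
  rw [Finset.sum_sub_distrib] at e2
  have e2' := (le_abs_self _).trans e2
  have hgr : ∀ z, ‖gradient f z‖ ≤ M := fun z => by
    rw [gradient, LinearIsometryEquiv.norm_map]
    exact hf.norm_fderiv_le z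
  have hadj : ∀ w, ‖T.adjoint w‖ ≤ s * ‖w‖ := fun w =>
    T.adjoint.le_of_opNorm_le ((LinearIsometryEquiv.norm_map _ T).trans_le hT) w
  have e3 : ‖T.adjoint (gradient f y)‖ ^ 2 ≤ ‖T.adjoint (gradient f x)‖ ^ 2
      + 2 * s ^ 2 * M ^ 2 * (q ^ 2 * ‖v‖) := by
    have a1 : ‖T.adjoint (gradient f y)‖ ≤ s * M :=
      (hadj _).trans (mul_le_mul_of_nonneg_left (hgr y) hs)
    have a2 : ‖T.adjoint (gradient f x)‖ ≤ s * M :=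
      (hadj _).trans (mul_le_mul_of_nonneg_left (hgr x) hs)
    have a3 : ‖T.adjoint (gradient f y)‖ - ‖T.adjoint (gradient f x)‖
        ≤ s * (M * (q ^ 2 * ‖v‖)) := by
      refine (norm_sub_norm_le _ _).trans ?_
      rw [← map_sub]
      refine (hadj _).trans (mul_le_mul_of_nonneg_left ?_ hs)
      rw [gradient, gradient, ← map_sub, LinearIsometryEquiv.norm_map, ← hyx]
      exact norm_fderiv_sub_le (hf.contDiff.of_le (by norm_num))
        (hf.bounded 2 (by norm_num) (by norm_num)) x y
    have n1 := norm_nonneg (T.adjoint (gradient f y))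
    have n2 := norm_nonneg (T.adjoint (gradient f x))
    have a4 := mul_le_mul_of_nonneg_right a3 (add_nonneg n1 n2)
    have a5 := mul_le_mul_of_nonneg_left (add_le_add a1 a2)
      (by positivity : 0 ≤ s * (M * (q ^ 2 * ‖v‖)))
    nlinarith
  rw [inner_gradient_eq_fderiv]
  have f1 := mul_le_mul_of_nonneg_left e1 hl
  have f2 := mul_le_mul_of_nonneg_left e2' (by positivity : 0 ≤ l * (q ^ 2 / 2))
  have f3 := mul_le_mul_of_nonneg_left e3 (by positivity : 0 ≤ l ^ 2 * (q ^ 2 / 2))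
  have hl2 : l ^ 2 ≤ l := by nlinarith
  have f4 := mul_le_mul_of_nonneg_right hl2
    (by positivity : 0 ≤ q ^ 2 / 2 * (2 * s ^ 2 * M ^ 2 * (q ^ 2 * ‖v‖)))
  have f5 : 0 ≤ (M + r * (M * s ^ 2) / 2 + s ^ 2 * M ^ 2) * (l * (q ^ β * q ^ 3) + l ^ 2 * q ^ 3) :=
    by positivity
  have f6 : 0 ≤ C * (l * q ^ 4 * ‖v‖) := by positivity
  linarith [f1, f2, f3, f4, f5, f6]

end OneStepDrift

/-! ### Contraction of `√V` along one step -/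

section Lyapunov

variable {d r : ℕ} {μ : Measure (EuclideanSpace ℝ (Fin r))}
  {b : EuclideanSpace ℝ (Fin d) → EuclideanSpace ℝ (Fin d)}
  {σ : EuclideanSpace ℝ (Fin d) → EuclideanSpace ℝ (Fin r) →L[ℝ] EuclideanSpace ℝ (Fin d)}
  {V : EuclideanSpace ℝ (Fin d) → ℝ} {CV αV βV : ℝ}

lemma opNorm_le_sqrt_sum (T : EuclideanSpace ℝ (Fin r) →L[ℝ] EuclideanSpace ℝ (Fin d)) :
    ‖T‖ ≤ Real.sqrt (∑ j, ‖T (basisVec j)‖ ^ 2) := by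
  refine T.opNorm_le_bound (Real.sqrt_nonneg _) fun u => ?_
  conv_lhs => rw [eq_sum_smul_basisVec u, map_sum]
  refine (norm_sum_le _ _).trans ?_
  simp_rw [map_smul, norm_smul]
  refine (Real.sum_mul_le_sqrt_mul_sqrt _ _ _).trans_eq ?_
  rw [mul_comm, EuclideanSpace.norm_eq u]

lemma hess_diag (f : EuclideanSpace ℝ (Fin d) → ℝ) (x h : EuclideanSpace ℝ (Fin d)) :
    iteratedFDeriv ℝ 2 f x (fun _ => h) = hess f x h h := by
  rw [hess]
  congr 1
  ext i : 1
  fin_cases i <;> rfl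

lemma abs_hess_le (f : EuclideanSpace ℝ (Fin d) → ℝ) (x h : EuclideanSpace ℝ (Fin d)) :
    |hess f x h h| ≤ hessNorm f x * ‖h‖ ^ 2 := by
  rw [← hess_diag, multilinear_diag_eq_sum, ← (finTwoArrowEquiv (Fin d)).symm.sum_comp]
  simp only [Fin.prod_univ_two, finTwoArrowEquiv_symm_apply, Matrix.cons_val_zero,
    Matrix.cons_val_one]
  refine (Finset.abs_sum_le_sum_abs _ _).trans ?_
  simp_rw [abs_mul]
  refine (Real.sum_mul_le_sqrt_mul_sqrt _ _ _).trans_eq ?_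
  rw [mul_comm, hessNorm]
  congr 1
  · rw [Fintype.sum_prod_type]
    congr 1
    refine Finset.sum_congr rfl fun i _ => Finset.sum_congr rfl fun j _ => ?_
    rw [sq_abs, hess]
    congr 2
    ext k : 1
    fin_cases k <;> rfl
  · rw [Fintype.sum_prod_type, EuclideanSpace.norm_sq_eq]
    have : ∑ i, ∑ j, (|h i| * |h j|) ^ 2 = (∑ i, ‖h i‖ ^ 2) ^ 2 := by
      rw [sq (∑ i, _), Finset.sum_mul_sum]
      refine Finset.sum_congr rfl fun i _ => Finset.sum_congr rfl fun j _ => ?_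
      simp only [Real.norm_eq_abs]; ring
    rw [this, Real.sqrt_sq (by positivity)]

lemma hessNorm_nonneg (f : EuclideanSpace ℝ (Fin d) → ℝ) (x : EuclideanSpace ℝ (Fin d)) :
    0 ≤ hessNorm f x := Real.sqrt_nonneg _

lemma LyapunovCondition.hessNorm_le (hV : LyapunovCondition b σ V CV αV βV)
    (x : EuclideanSpace ℝ (Fin d)) : hessNorm V x ≤ ⨆ x, hessNorm V x :=
  le_ciSup hV.hess_bounded x

lemma LyapunovCondition.V_pos (hV : LyapunovCondition b σ V CV αV βV)
    (x : EuclideanSpace ℝ (Fin d)) : 0 < V x := by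
  obtain ⟨v, hv, h⟩ := hV.lower
  exact hv.trans_le (h x)

lemma LyapunovCondition.norm_drift_le (hV : LyapunovCondition b σ V CV αV βV)
    (x : EuclideanSpace ℝ (Fin d)) : ‖b x‖ ≤ Real.sqrt CV * Real.sqrt (V x) := by
  rw [← Real.sqrt_mul hV.CV_pos.le]
  refine Real.le_sqrt_of_sq_le ?_
  nlinarith [hV.growth x, sq_nonneg ‖gradient V x‖]

/-- `√V` is Lipschitz continuous, because `|∇V|² ≤ C_V V`. -/
lemma LyapunovCondition.lipschitz_sqrt (hV : LyapunovCondition b σ V CV αV βV) :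
    LipschitzWith (Real.toNNReal (Real.sqrt CV)) fun x => Real.sqrt (V x) := by
  have hd : Differentiable ℝ V := hV.contDiff.differentiable (by norm_num)
  refine lipschitzWith_of_nnnorm_fderiv_le (𝕜 := ℝ)
    (fun x => (hd x).sqrt (hV.V_pos x).ne') fun x => ?_
  rw [← NNReal.coe_le_coe, coe_nnnorm, Real.coe_toNNReal _ (Real.sqrt_nonneg _),
    fderiv_sqrt (hd x) (hV.V_pos x).ne', norm_smul]
  have hs := Real.sqrt_pos.2 (hV.V_pos x)
  have hg : ‖fderiv ℝ V x‖ ≤ Real.sqrt CV * Real.sqrt (V x) := by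
    rw [← Real.sqrt_mul hV.CV_pos.le]
    refine Real.le_sqrt_of_sq_le ?_
    have h1 : ‖gradient V x‖ = ‖fderiv ℝ V x‖ := by rw [gradient, LinearIsometryEquiv.norm_map]
    rw [← h1]
    nlinarith [hV.growth x, sq_nonneg ‖b x‖]
  rw [Real.norm_eq_abs, abs_of_pos (by positivity), div_mul_eq_mul_div, one_mul,
    div_le_iff₀ (by positivity)]
  nlinarith [Real.sqrt_nonneg CV]

lemma LyapunovCondition.taylor_le (hV : LyapunovCondition b σ V CV αV βV)
    (x h : EuclideanSpace ℝ (Fin d)) :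
    V (x + h) ≤ V x + fderiv ℝ V x h + (⨆ x, hessNorm V x) / 2 * ‖h‖ ^ 2 := by
  obtain ⟨t, -, ht⟩ := exists_taylor_lagrange_segment (n := 1) (by exact_mod_cast hV.contDiff) x h
  simp only [Nat.reduceAdd, Finset.sum_range_succ, Finset.sum_range_zero, Nat.factorial,
    Nat.cast_one, inv_one, one_mul, iteratedFDeriv_zero_apply, iteratedFDeriv_one_apply,
    Nat.succ_eq_add_one, zero_add, mul_one, Nat.cast_ofNat, hess_diag] at ht
  have h1 := (le_abs_self _).trans (abs_hess_le V (x + t • h) h)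
  have h2 := mul_le_mul_of_nonneg_right (hV.hessNorm_le (x + t • h)) (sq_nonneg ‖h‖)
  rw [ht]
  linarith

lemma InnovationLaw.integrable_of_lipschitz (hμ : InnovationLaw μ)
    {F : EuclideanSpace ℝ (Fin r) → ℝ} {L : ℝ≥0} (hF : LipschitzWith L F) : Integrable F μ := by
  have := hμ.isProbabilityMeasure
  refine ((integrable_const |F 0|).add ((hμ.integrable_norm_pow 1).const_mul (L : ℝ))).mono'
    hF.continuous.aestronglyMeasurable (Eventually.of_forall fun u => ?_)
  have h1 := hF.dist_le_mul u 0
  rw [Real.dist_eq, dist_zero_right] at h1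
  have h2 := abs_add_le (F u - F 0) (F 0)
  rw [sub_add_cancel] at h2
  simp only [Real.norm_eq_abs, Pi.add_apply, pow_one]
  linarith

lemma InnovationLaw.integral_le_of_le_affine_add_sq (hμ : InnovationLaw μ)
    {F : EuclideanSpace ℝ (Fin r) → ℝ} (hF : Integrable F μ) {A B D : ℝ}
    {L : EuclideanSpace ℝ (Fin r) →L[ℝ] ℝ} (h : ∀ u, F u ≤ A + B * L u + D * ‖u‖ ^ 2) :
    ∫ u, F u ∂μ ≤ A + D * ∫ u, ‖u‖ ^ 2 ∂μ := by
  have := hμ.isProbabilityMeasure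
  have iL : Integrable (fun u => L u) μ := by
    refine ((hμ.integrable_norm_pow 1).const_mul ‖L‖).mono' (by fun_prop)
      (Eventually.of_forall fun u => ?_)
    rw [pow_one]; exact L.le_opNorm u
  have j1 := (integrable_const (μ := μ) A).add (iL.const_mul B)
  have j2 := (hμ.integrable_norm_pow 2).const_mul D
  refine (integral_mono hF (j1.add j2) h).trans_eq ?_
  have e1 := integral_add j1 j2
  have e2 := integral_add (integrable_const (μ := μ) A) (iL.const_mul B)
  simp only [Pi.add_apply, integral_const_mul, integral_const, probReal_univ, smul_eq_mul,
    one_mul] at e1 e2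
  rw [hμ.integral_linear L] at e2
  rw [e2] at e1
  refine Eq.trans e1 ?_
  rw [mul_zero, add_zero]

set_option maxHeartbeats 400000 in
/-- Contraction of the exponential moments of `√V` along one Euler step of size `g`. -/
lemma LyapunovCondition.exp_sqrt_step (hV : LyapunovCondition b σ V CV αV βV)
    (hμ : InnovationLaw μ) {s : ℝ} (hs : 0 ≤ s) (hσ : ∀ x, ‖σ x‖ ≤ s) {G : ℝ} (hG : 0 < G) :
    ∃ ρ C : ℝ, 0 < ρ ∧ 0 ≤ C ∧ ∀ g, 0 ≤ g → g ≤ G → 2 * CV * (⨆ x, hessNorm V x) * g ≤ αV →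
      ρ * g ≤ 1 ∧ ∀ x κ, 0 ≤ κ →
        Integrable (fun u => Real.exp (κ * Real.sqrt
          (V (x + g • b x + Real.sqrt g • σ x u)))) μ ∧
        ∫ u, Real.exp (κ * Real.sqrt (V (x + g • b x + Real.sqrt g • σ x u))) ∂μ
          ≤ Real.exp (κ * (1 - ρ * g) * Real.sqrt (V x) + C * (κ + κ ^ 2) * g) := by
  have := hμ.isProbabilityMeasure
  obtain ⟨v, hv, hVv⟩ := hV.lower
  set M := ⨆ x, hessNorm V x with hMdef
  have hM : 0 ≤ M := (hessNorm_nonneg V 0).trans (hV.hessNorm_le 0)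
  have hα := hV.αV_pos
  have hβ := hV.βV_nonneg
  have hCV := hV.CV_pos
  set m2 := ∫ u, ‖u‖ ^ 2 ∂μ with hm2
  have hm2' : 0 ≤ m2 := integral_nonneg fun u => by positivity
  set C0 := βV + r * (M * s ^ 2) / 2 + M * s ^ 2 * m2 / 2 with hC0
  have hC0' : 0 ≤ C0 := by positivity
  have hsv := Real.sqrt_pos.2 hv
  refine ⟨min (3 * αV / 8) (1 / G), C0 / (2 * Real.sqrt v) + CV * s ^ 2 / 2, by positivity,
    by positivity, fun g hg hgG hgS => ⟨?_, fun x κ hκ => ?_⟩⟩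
  · calc _ ≤ 1 / G * g := by gcongr; exact min_le_right _ _
      _ ≤ 1 / G * G := by gcongr
      _ = 1 := by field_simp
  set q := Real.sqrt g with hq
  have hq0 : 0 ≤ q := Real.sqrt_nonneg _
  have hq2 : q ^ 2 = g := Real.sq_sqrt hg
  set T := σ x with hT
  have hTs : ‖T‖ ≤ s := hσ x
  set w := Real.sqrt (V x) with hw
  have hw0 : 0 < w := Real.sqrt_pos.2 (hV.V_pos x)
  have hw2 : w ^ 2 = V x := Real.sq_sqrt (hV.V_pos x).le
  set F := fun u => Real.sqrt (V (x + g • b x + q • T u)) with hF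
  have hFlip : LipschitzWith (Real.toNNReal (Real.sqrt CV) * (q.toNNReal * s.toNNReal)) F := by
    refine hV.lipschitz_sqrt.comp (LipschitzWith.of_dist_le_mul fun u u' => ?_)
    rw [dist_add_left, dist_eq_norm, ← smul_sub, ← map_sub, norm_smul, Real.norm_eq_abs,
      abs_of_nonneg hq0, NNReal.coe_mul, Real.coe_toNNReal _ hq0, Real.coe_toNNReal _ hs, mul_assoc,
      dist_eq_norm]
    exact mul_le_mul_of_nonneg_left (T.le_of_opNorm_le hTs _) hq0
  obtain ⟨hI, hB⟩ := hμ.concentration_of_lipschitz hFlip hκ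
  refine ⟨hI, hB.trans (Real.exp_le_exp.2 ?_)⟩
  -- the mean of `√V` decreases: tangent line of the square root at `V x`
  set Lin : EuclideanSpace ℝ (Fin r) →L[ℝ] ℝ :=
    q • (fderiv ℝ V x).comp T + (M * g * q) • (innerSL ℝ (b x)).comp T with hLin
  have hpt : ∀ u, F u ≤ (w + (g * fderiv ℝ V x (b x) + M / 2 * (g ^ 2 * ‖b x‖ ^ 2)) / (2 * w))
      + 1 / (2 * w) * Lin u + M / 2 * (g * s ^ 2) / (2 * w) * ‖u‖ ^ 2 := fun u => by
    have h1 := hV.taylor_le x (g • b x + q • T u)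
    rw [← add_assoc, map_add, map_smul, map_smul, norm_add_sq_real, norm_smul, norm_smul,
      inner_smul_left, inner_smul_right, Real.norm_eq_abs, Real.norm_eq_abs, abs_of_nonneg hg,
      abs_of_nonneg hq0] at h1
    simp only [smul_eq_mul, conj_trivial] at h1
    have h2 : ‖T u‖ ^ 2 ≤ s ^ 2 * ‖u‖ ^ 2 := by
      rw [← mul_pow]; exact pow_le_pow_left₀ (norm_nonneg _) (T.le_of_opNorm_le hTs u) 2
    have h3 : F u ^ 2 = V (x + g • b x + q • T u) := Real.sq_sqrt (hV.V_pos _).le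
    have h4 : Lin u = q * fderiv ℝ V x (T u) + M * g * q * inner ℝ (b x) (T u) := by
      simp [hLin]
    have h5 : F u ≤ (F u ^ 2 + w ^ 2) / (2 * w) := by
      rw [le_div_iff₀ (by positivity)]
      nlinarith [sq_nonneg (F u - w)]
    refine h5.trans ?_
    have e : ∀ A B D : ℝ, (w + A / (2 * w)) + 1 / (2 * w) * B + D / (2 * w) * ‖u‖ ^ 2
        = (2 * w ^ 2 + A + B + D * ‖u‖ ^ 2) / (2 * w) := by
      intro A B D; field_simp
    rw [e]
    refine div_le_div_of_nonneg_right ?_ (by positivity)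
    rw [← hMdef] at h1
    rw [h3, h4, hw2]
    have h6 := mul_le_mul_of_nonneg_left h2 (by positivity : 0 ≤ M / 2 * q ^ 2)
    have h7 : M / 2 * q ^ 2 * (s ^ 2 * ‖u‖ ^ 2) = M / 2 * (g * s ^ 2) * ‖u‖ ^ 2 := by
      rw [hq2]; ring
    linarith
  have hmean := hμ.integral_le_of_le_affine_add_sq (hμ.integrable_of_lipschitz hFlip) hpt
  have hdrift : fderiv ℝ V x (b x) ≤ -αV * V x + βV + r * (M * s ^ 2) / 2 := by
    have h1 := hV.drift x
    rw [generator, inner_gradient_eq_fderiv] at h1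
    have h2 : |∑ j, hess V x (T (basisVec j)) (T (basisVec j))| ≤ r * (M * s ^ 2) := by
      refine sum_abs_le_card fun j => (abs_hess_le V x _).trans ?_
      have h3 : ‖T (basisVec j)‖ ≤ s := by
        have := T.le_of_opNorm_le hTs (basisVec j)
        rwa [norm_basisVec, mul_one] at this
      have h4 := hV.hessNorm_le x
      gcongr
    have := (abs_le.1 h2).1
    linarith
  have hb2 : ‖b x‖ ^ 2 ≤ CV * V x := by nlinarith [hV.growth x, sq_nonneg ‖gradient V x‖]
  have hnum : g * fderiv ℝ V x (b x) + M / 2 * (g ^ 2 * ‖b x‖ ^ 2) + M / 2 * (g * s ^ 2) * m2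
      ≤ g * (-(3 / 4) * αV * w ^ 2 + C0) := by
    have h1 := mul_le_mul_of_nonneg_left hdrift hg
    have h2 := mul_le_mul_of_nonneg_left hb2 (by positivity : 0 ≤ M / 2 * g ^ 2)
    have h3 := mul_le_mul_of_nonneg_right hgS (mul_nonneg hg (hV.V_pos x).le)
    rw [hw2, hC0]
    linarith
  have hmean2 : ∫ u, F u ∂μ ≤ (1 - 3 * αV / 8 * g) * w + C0 / (2 * Real.sqrt v) * g := by
    refine hmean.trans ?_
    have e : ∀ A D : ℝ, (w + A / (2 * w)) + D / (2 * w) * m2 = w + (A + D * m2) / (2 * w) := by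
      intro A D; ring
    rw [e]
    have h1 : (g * fderiv ℝ V x (b x) + M / 2 * (g ^ 2 * ‖b x‖ ^ 2) + M / 2 * (g * s ^ 2) * m2)
        / (2 * w) ≤ g * (-(3 / 4) * αV * w ^ 2 + C0) / (2 * w) := by gcongr
    have h2 : g * (-(3 / 4) * αV * w ^ 2 + C0) / (2 * w)
        = - (3 * αV / 8 * g) * w + C0 / (2 * w) * g := by field_simp; ring
    have h3 : C0 / (2 * w) * g ≤ C0 / (2 * Real.sqrt v) * g := by
      have := Real.sqrt_le_sqrt (hVv x)
      gcongr
    linarith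
  have hρ : min (3 * αV / 8) (1 / G) * g * w ≤ 3 * αV / 8 * g * w := by
    gcongr
    exact min_le_left _ _
  have hL2 : ((Real.toNNReal (Real.sqrt CV) * (q.toNNReal * s.toNNReal) : ℝ≥0) : ℝ) ^ 2
      = CV * s ^ 2 * g := by
    rw [NNReal.coe_mul, NNReal.coe_mul, Real.coe_toNNReal _ hq0, Real.coe_toNNReal _ hs,
      Real.coe_toNNReal _ (Real.sqrt_nonneg _), mul_pow, mul_pow, hq2, Real.sq_sqrt hCV.le]
    ring
  rw [hL2]
  have h1 := mul_le_mul_of_nonneg_left hmean2 hκ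
  have h2 := mul_le_mul_of_nonneg_left hρ hκ
  have h3 : 0 ≤ C0 / (2 * Real.sqrt v) * κ ^ 2 * g := by positivity
  have h4 : 0 ≤ CV * s ^ 2 / 2 * κ * g := by positivity
  linarith

end Lyapunov

/-! ### The Euler scheme as a random recursion -/

section Recursion

variable {Ω : Type*} [MeasurableSpace Ω] {P : Measure Ω} [IsProbabilityMeasure P]

lemma indepFun_prodMk_of_indepFun {α β γ : Type*} [MeasurableSpace α] [MeasurableSpace β]
    [MeasurableSpace γ] {f : Ω → α} {g : Ω → β} {h : Ω → γ} (hf : Measurable f)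
    (hg : Measurable g) (hh : Measurable h) (h1 : IndepFun f (fun ω => (g ω, h ω)) P)
    (h2 : IndepFun g h P) : IndepFun (fun ω => (f ω, g ω)) h P := by
  have hfg : IndepFun f g P := h1.comp measurable_id measurable_fst
  have := Measure.isProbabilityMeasure_map (μ := P) hf.aemeasurable
  have := Measure.isProbabilityMeasure_map (μ := P) hg.aemeasurable
  have := Measure.isProbabilityMeasure_map (μ := P) hh.aemeasurable
  rw [indepFun_iff_map_prod_eq_prod_map_map (by fun_prop) (by fun_prop)] at h1 h2 hfg ⊢
  rw [h2, ← Measure.prodAssoc_prod, ← hfg] at h1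
  refine (MeasurableEquiv.prodAssoc (α := α) (β := β) (γ := γ)).map_measurableEquiv_injective ?_
  rw [← h1, Measure.map_map (MeasurableEquiv.measurable _) (by fun_prop)]
  rfl

variable {D F S : Type*} [MeasurableSpace D] [MeasurableSpace F] [MeasurableSpace S]
  {X₀ : Ω → D} {U : ℕ → Ω → F}

/-- In a random recursion driven by independent innovations, the state at time `n` is independent
of the innovation at time `n + 1`. -/
lemma indepFun_of_recursion (hX₀ : Measurable X₀) (hU : ∀ k, 1 ≤ k → Measurable (U k))
    (hU_indep : iIndepFun (fun k : ℕ => U (k + 1)) P)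
    (hU_X₀ : IndepFun X₀ (fun ω (k : ℕ) => U (k + 1) ω) P)
    {Z : ℕ → Ω → S} {G : D → S} (hG : Measurable G) (hZ0 : ∀ ω, Z 0 ω = G (X₀ ω))
    {Φ : ℕ → S × F → S} (hΦ : ∀ n, Measurable (Φ n))
    (hZ : ∀ n ω, Z (n + 1) ω = Φ n (Z n ω, U (n + 1) ω)) (n : ℕ) :
    Measurable (Z n) ∧ IndepFun (Z n) (U (n + 1)) P := by
  have hU' : ∀ k, Measurable (U (k + 1)) := fun k => hU _ (by omega)
  have hrep : ∀ n, ∃ H : D × (Finset.range n → F) → S, Measurable H ∧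
      ∀ ω, Z n ω = H (X₀ ω, fun i => U (i + 1) ω) := by
    intro n
    induction n with
    | zero => exact ⟨fun p => G p.1, by fun_prop, hZ0⟩
    | succ n ih =>
      obtain ⟨H, hH, hHZ⟩ := ih
      refine ⟨fun p => Φ n (H (p.1, fun i => p.2 ⟨i, Finset.mem_range.2
        ((Finset.mem_range.1 i.2).trans n.lt_succ_self)⟩),
        p.2 ⟨n, Finset.self_mem_range_succ n⟩), ?_, fun ω => ?_⟩
      · refine (hΦ n).comp (Measurable.prodMk (hH.comp (measurable_fst.prodMk ?_)) ?_)
        · exact measurable_pi_lambda _ fun i => (measurable_pi_apply _).comp measurable_snd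
        · exact (measurable_pi_apply _).comp measurable_snd
      · rw [hZ, hHZ]
  obtain ⟨H, hH, hHZ⟩ := hrep n
  have e : Z n = fun ω => H (X₀ ω, fun i => U (i + 1) ω) := funext hHZ
  have hm : Measurable fun ω => (X₀ ω, fun i : Finset.range n => U (i + 1) ω) :=
    hX₀.prodMk (measurable_pi_lambda _ fun i => hU' i)
  have h2 : IndepFun (fun ω (i : Finset.range n) => U (i + 1) ω) (U (n + 1)) P := by
    have h := hU_indep.indepFun_finset (Finset.range n) {n} (by simp) hU'
    exact h.comp measurable_id (measurable_pi_apply (⟨n, Finset.mem_singleton_self n⟩ :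
      ({n} : Finset ℕ)))
  have h1 : IndepFun X₀ (fun ω => ((fun i : Finset.range n => U (i + 1) ω), U (n + 1) ω)) P := by
    have hmeas : Measurable fun v : ℕ → F => ((fun i : Finset.range n => v i), v n) :=
      (measurable_pi_lambda _ fun i => measurable_pi_apply _).prodMk (measurable_pi_apply n)
    exact hU_X₀.comp measurable_id hmeas
  have hm' : Measurable fun ω (i : Finset.range n) => U (i + 1) ω :=
    measurable_pi_lambda _ fun i => hU' i
  have h3 := indepFun_prodMk_of_indepFun hX₀ hm' (hU' n) h1 h2
  rw [e]
  exact ⟨hH.comp hm, h3.comp hH measurable_id⟩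

lemma lintegral_of_indepFun {Z : Ω → S} {Y : Ω → F} (hZ : Measurable Z) (hY : Measurable Y)
    (h : IndepFun Z Y P) {μ : Measure F} (hμ : P.map Y = μ) {f : S × F → ℝ≥0∞}
    (hf : Measurable f) :
    ∫⁻ ω, f (Z ω, Y ω) ∂P = ∫⁻ ω, ∫⁻ u, f (Z ω, u) ∂μ ∂P := by
  have := Measure.isProbabilityMeasure_map (μ := P) hY.aemeasurable
  have := Measure.isProbabilityMeasure_map (μ := P) hZ.aemeasurable
  subst hμ
  rw [← lintegral_map (f := f) (g := fun ω => (Z ω, Y ω)) hf (hZ.prodMk hY),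
    (indepFun_iff_map_prod_eq_prod_map_map hZ.aemeasurable hY.aemeasurable).1 h,
    lintegral_prod _ hf.aemeasurable, lintegral_map hf.lintegral_prod_right' hZ]

end Recursion

section Euler

variable {d r : ℕ} {μ : Measure (EuclideanSpace ℝ (Fin r))}
  {b : EuclideanSpace ℝ (Fin d) → EuclideanSpace ℝ (Fin d)}
  {σ : EuclideanSpace ℝ (Fin d) → EuclideanSpace ℝ (Fin r) →L[ℝ] EuclideanSpace ℝ (Fin d)}
  {γ : ℕ → ℝ} {Ω : Type*} [MeasurableSpace Ω] {P : Measure Ω} [IsProbabilityMeasure P]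
  {X₀ : Ω → EuclideanSpace ℝ (Fin d)} {U : ℕ → Ω → EuclideanSpace ℝ (Fin r)}

/-- The one-step map of the Euler scheme with step size `g`. -/
noncomputable def eulerStep (b : EuclideanSpace ℝ (Fin d) → EuclideanSpace ℝ (Fin d))
    (σ : EuclideanSpace ℝ (Fin d) → EuclideanSpace ℝ (Fin r) →L[ℝ] EuclideanSpace ℝ (Fin d))
    (g : ℝ) (x : EuclideanSpace ℝ (Fin d)) (u : EuclideanSpace ℝ (Fin r)) :
    EuclideanSpace ℝ (Fin d) := x + g • b x + Real.sqrt g • σ x u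

lemma continuous_eulerStep (hb : Continuous b) (hσ : Continuous σ) (g : ℝ) :
    Continuous fun p : EuclideanSpace ℝ (Fin d) × EuclideanSpace ℝ (Fin r) =>
      eulerStep b σ g p.1 p.2 := by
  unfold eulerStep
  fun_prop

lemma euler_succ {Ω : Type*} {X₀ : Ω → EuclideanSpace ℝ (Fin d)}
    {U : ℕ → Ω → EuclideanSpace ℝ (Fin r)} (n : ℕ) (ω : Ω) : euler b σ γ X₀ U (n + 1) ω
    = eulerStep b σ (γ (n + 1)) (euler b σ γ X₀ U n ω) (U (n + 1) ω) := rfl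

lemma measurable_euler_and_indepFun (hb : Continuous b) (hσ : Continuous σ) (hX₀ : Measurable X₀)
    (hU : ∀ k, 1 ≤ k → Measurable (U k)) (hU_indep : iIndepFun (fun k : ℕ => U (k + 1)) P)
    (hU_X₀ : IndepFun X₀ (fun ω (k : ℕ) => U (k + 1) ω) P) (n : ℕ) :
    Measurable (euler b σ γ X₀ U n) ∧ IndepFun (euler b σ γ X₀ U n) (U (n + 1)) P :=
  indepFun_of_recursion (Z := euler b σ γ X₀ U) hX₀ hU hU_indep hU_X₀ (G := id) measurable_id
    (fun _ => rfl) (Φ := fun n p => eulerStep b σ (γ (n + 1)) p.1 p.2)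
    (fun _ => (continuous_eulerStep hb hσ _).measurable) (fun _ _ => rfl) n

/-- If each factor `exp (ℓ_k(x, X_{k+1}))` has conditional expectation at most one, then so has the
product along the scheme. -/
lemma lintegral_exp_sum_le_one (hb : Continuous b) (hσ : Continuous σ) (hX₀ : Measurable X₀)
    (hU : ∀ k, 1 ≤ k → Measurable (U k)) (hU_law : ∀ k, 1 ≤ k → P.map (U k) = μ)
    (hU_indep : iIndepFun (fun k : ℕ => U (k + 1)) P)
    (hU_X₀ : IndepFun X₀ (fun ω (k : ℕ) => U (k + 1) ω) P)
    {ℓ : ℕ → EuclideanSpace ℝ (Fin d) → EuclideanSpace ℝ (Fin d) → ℝ}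
    (hℓ : ∀ n, Measurable fun p : EuclideanSpace ℝ (Fin d) × EuclideanSpace ℝ (Fin d) =>
      ℓ n p.1 p.2)
    (h : ∀ n x, ∫⁻ u, ENNReal.ofReal (Real.exp (ℓ n x (eulerStep b σ (γ (n + 1)) x u))) ∂μ ≤ 1)
    (n : ℕ) :
    ∫⁻ ω, ENNReal.ofReal (Real.exp (∑ k ∈ Finset.range n,
      ℓ k (euler b σ γ X₀ U k ω) (euler b σ γ X₀ U (k + 1) ω))) ∂P ≤ 1 := by
  set X := euler b σ γ X₀ U with hX
  set Z : ℕ → Ω → EuclideanSpace ℝ (Fin d) × ℝ := fun n ω =>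
    (X n ω, ∑ k ∈ Finset.range n, ℓ k (X k ω) (X (k + 1) ω)) with hZ
  have hstep : ∀ n, Measurable fun p : EuclideanSpace ℝ (Fin d) × EuclideanSpace ℝ (Fin r) =>
      eulerStep b σ (γ (n + 1)) p.1 p.2 := fun n => (continuous_eulerStep hb hσ _).measurable
  have hinc : ∀ n, Measurable fun p : (EuclideanSpace ℝ (Fin d) × ℝ) × EuclideanSpace ℝ (Fin r) =>
      p.1.2 + ℓ n p.1.1 (eulerStep b σ (γ (n + 1)) p.1.1 p.2) := fun n =>
    (measurable_snd.comp measurable_fst).add ((hℓ n).comp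
      ((measurable_fst.comp measurable_fst).prodMk ((hstep n).comp
        ((measurable_fst.comp measurable_fst).prodMk measurable_snd))))
  have hind := indepFun_of_recursion (Z := Z) hX₀ hU hU_indep hU_X₀ (G := fun x => (x, 0))
    (by fun_prop) (fun ω => by simp [hZ, hX, euler])
    (Φ := fun n p => (eulerStep b σ (γ (n + 1)) p.1.1 p.2,
      p.1.2 + ℓ n p.1.1 (eulerStep b σ (γ (n + 1)) p.1.1 p.2)))
    (fun n => ((hstep n).comp ((measurable_fst.comp measurable_fst).prodMk measurable_snd)).prodMk
      (hinc n))
    (fun n ω => by simp only [hZ, Finset.sum_range_succ]; rfl)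
  induction n with
  | zero => simp
  | succ n ih =>
    obtain ⟨hm, hi⟩ := hind n
    have e : ∀ ω, ENNReal.ofReal (Real.exp (∑ k ∈ Finset.range (n + 1), ℓ k (X k ω) (X (k + 1) ω)))
        = (fun p : (EuclideanSpace ℝ (Fin d) × ℝ) × EuclideanSpace ℝ (Fin r) =>
          ENNReal.ofReal (Real.exp (p.1.2 + ℓ n p.1.1 (eulerStep b σ (γ (n + 1)) p.1.1 p.2))))
          (Z n ω, U (n + 1) ω) := fun ω => by
      simp only [hZ, Finset.sum_range_succ]; rfl
    simp_rw [e]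
    rw [lintegral_of_indepFun hm (hU _ (by omega)) hi (hU_law _ (by omega))
      ((hinc n).exp.ennreal_ofReal)]
    refine le_trans (lintegral_mono fun ω => ?_) ih
    simp_rw [Real.exp_add, ENNReal.ofReal_mul (Real.exp_pos _).le]
    rw [lintegral_const_mul' _ _ ENNReal.ofReal_ne_top]
    exact mul_le_of_le_one_right' (h n _)

variable {V : EuclideanSpace ℝ (Fin d) → ℝ} {CV αV βV : ℝ}

/-- Sub-Gaussian tails of `√V` along the scheme, uniformly in time. -/
lemma LyapunovCondition.exp_sqrt_moment (hV : LyapunovCondition b σ V CV αV βV)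
    (hb : Continuous b) (hσc : Continuous σ) (hμ : InnovationLaw μ)
    {s : ℝ} (hs : 0 ≤ s) (hσ : ∀ x, ‖σ x‖ ≤ s) {G : ℝ} (hG : 0 < G)
    (hγ : ∀ k, 1 ≤ k → 0 ≤ γ k ∧ γ k ≤ G ∧ 2 * CV * (⨆ x, hessNorm V x) * γ k ≤ αV)
    (hX₀ : Measurable X₀) (hC1 : SubGaussianInit P X₀)
    (hU : ∀ k, 1 ≤ k → Measurable (U k)) (hU_law : ∀ k, 1 ≤ k → P.map (U k) = μ)
    (hU_indep : iIndepFun (fun k : ℕ => U (k + 1)) P)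
    (hU_X₀ : IndepFun X₀ (fun ω (k : ℕ) => U (k + 1) ω) P) :
    ∃ C, 0 ≤ C ∧ ∀ n κ, 0 ≤ κ →
      ∫⁻ ω, ENNReal.ofReal (Real.exp (κ * Real.sqrt (V (euler b σ γ X₀ U n ω)))) ∂P
        ≤ ENNReal.ofReal (Real.exp (C * (1 + κ ^ 2))) := by
  obtain ⟨ρ, C, hρ, hC, H⟩ := hV.exp_sqrt_step hμ hs hσ hG
  obtain ⟨l0, hl0, hl⟩ := hC1
  have hint := hl (l0 / 2) (by linarith)
  set I := ∫ ω, Real.exp (l0 / 2 * ‖X₀ ω‖ ^ 2) ∂P with hI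
  have hI1 : 1 ≤ I := by
    have h1 : ∫ _ω, (1 : ℝ) ∂P ≤ I := integral_mono (integrable_const 1) hint fun ω =>
      Real.one_le_exp (by positivity)
    simpa using h1
  have hlogI : 0 ≤ Real.log I := Real.log_nonneg hI1
  set W0 := Real.sqrt (V 0) with hW0
  have hW0n : 0 ≤ W0 := Real.sqrt_nonneg _
  have hCV := hV.CV_pos
  set B := W0 + CV / (2 * l0) + C / ρ with hB
  have hBn : 0 ≤ B := by positivity
  have main : ∀ n κ, 0 ≤ κ →
      ∫⁻ ω, ENNReal.ofReal (Real.exp (κ * Real.sqrt (V (euler b σ γ X₀ U n ω)))) ∂P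
        ≤ ENNReal.ofReal (Real.exp (Real.log I + B * (κ + κ ^ 2))) := by
    intro n
    induction n with
    | zero =>
      intro κ hκ
      have hpt : ∀ ω, ENNReal.ofReal (Real.exp (κ * Real.sqrt (V (euler b σ γ X₀ U 0 ω))))
          ≤ ENNReal.ofReal (Real.exp (B * (κ + κ ^ 2)))
            * ENNReal.ofReal (Real.exp (l0 / 2 * ‖X₀ ω‖ ^ 2)) := fun ω => by
        rw [← ENNReal.ofReal_mul (Real.exp_pos _).le, ← Real.exp_add]
        refine ENNReal.ofReal_le_ofReal (Real.exp_le_exp.2 ?_)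
        change κ * Real.sqrt (V (X₀ ω)) ≤ _
        have h1 := hV.lipschitz_sqrt.dist_le_mul (X₀ ω) 0
        rw [Real.dist_eq, dist_zero_right, Real.coe_toNNReal _ (Real.sqrt_nonneg _)] at h1
        have h2 : Real.sqrt (V (X₀ ω)) ≤ W0 + Real.sqrt CV * ‖X₀ ω‖ := by
          have := (le_abs_self _).trans h1
          linarith
        have h3 : κ * (Real.sqrt CV * ‖X₀ ω‖)
            ≤ CV / (2 * l0) * κ ^ 2 + l0 / 2 * ‖X₀ ω‖ ^ 2 := by
          have h4 : 0 ≤ (κ * Real.sqrt CV - l0 * ‖X₀ ω‖) ^ 2 / (2 * l0) := by positivity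
          have h5 : (κ * Real.sqrt CV - l0 * ‖X₀ ω‖) ^ 2 / (2 * l0)
              = CV / (2 * l0) * κ ^ 2 + l0 / 2 * ‖X₀ ω‖ ^ 2 - κ * (Real.sqrt CV * ‖X₀ ω‖) := by
            have : Real.sqrt CV ^ 2 = CV := Real.sq_sqrt hCV.le
            have : CV / (2 * l0) * κ ^ 2 = Real.sqrt CV ^ 2 * κ ^ 2 / (2 * l0) := by
              rw [this]; ring
            rw [this]
            field_simp
            ring
          linarith
        have h6 := mul_le_mul_of_nonneg_left h2 hκ
        have p1 : 0 ≤ W0 * κ ^ 2 := by positivity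
        have p2 : 0 ≤ CV / (2 * l0) * κ := by positivity
        have p3 : 0 ≤ C / ρ * (κ + κ ^ 2) := by positivity
        rw [hB]
        linarith
      refine (lintegral_mono hpt).trans ?_
      rw [lintegral_const_mul' _ _ ENNReal.ofReal_ne_top,
        ← ofReal_integral_eq_lintegral_ofReal hint (ae_of_all _ fun ω => (Real.exp_pos _).le),
        ← hI, ← ENNReal.ofReal_mul (Real.exp_pos _).le, Real.exp_add,
        Real.exp_log (by linarith), mul_comm]
    | succ n ih =>
      intro κ hκ
      obtain ⟨hm, hi⟩ := measurable_euler_and_indepFun (γ := γ) hb hσc hX₀ hU hU_indep hU_X₀ n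
      obtain ⟨hg0, hgG, hgS⟩ := hγ (n + 1) (by omega)
      obtain ⟨hρg, hstep⟩ := H _ hg0 hgG hgS
      have hmeas : Measurable fun p : EuclideanSpace ℝ (Fin d) × EuclideanSpace ℝ (Fin r) =>
          ENNReal.ofReal (Real.exp (κ * Real.sqrt (V (eulerStep b σ (γ (n + 1)) p.1 p.2)))) := by
        have h1 := hV.contDiff.continuous.comp (continuous_eulerStep hb hσc (γ (n + 1)))
        have h2 := (continuous_const (y := κ)).mul h1.sqrt
        exact h2.measurable.exp.ennreal_ofReal
      simp_rw [euler_succ]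
      rw [lintegral_of_indepFun hm (hU _ (by omega)) hi (hU_law _ (by omega)) hmeas]
      have hpt : ∀ ω, ∫⁻ u, ENNReal.ofReal (Real.exp (κ * Real.sqrt
            (V (eulerStep b σ (γ (n + 1)) (euler b σ γ X₀ U n ω) u)))) ∂μ
          ≤ ENNReal.ofReal (Real.exp (C * (κ + κ ^ 2) * γ (n + 1)))
            * ENNReal.ofReal (Real.exp (κ * (1 - ρ * γ (n + 1))
              * Real.sqrt (V (euler b σ γ X₀ U n ω)))) := fun ω => by
        obtain ⟨h1, h2⟩ := hstep (euler b σ γ X₀ U n ω) κ hκ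
        rw [← ENNReal.ofReal_mul (Real.exp_pos _).le, ← Real.exp_add]
        change ∫⁻ u, ENNReal.ofReal (Real.exp (κ * Real.sqrt (V (_ + _ • b _ + _ • σ _ u)))) ∂μ ≤ _
        rw [← ofReal_integral_eq_lintegral_ofReal h1 (ae_of_all _ fun ω => (Real.exp_pos _).le)]
        refine ENNReal.ofReal_le_ofReal (h2.trans_eq ?_)
        rw [add_comm]
      refine (lintegral_mono hpt).trans ?_
      rw [lintegral_const_mul' _ _ ENNReal.ofReal_ne_top]
      have h1ρ : 0 ≤ 1 - ρ * γ (n + 1) := by linarith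
      refine (mul_le_mul_right (ih _ (mul_nonneg hκ h1ρ)) _).trans ?_
      rw [← ENNReal.ofReal_mul (Real.exp_pos _).le, ← Real.exp_add]
      refine ENNReal.ofReal_le_ofReal (Real.exp_le_exp.2 ?_)
      have h3 : (κ * (1 - ρ * γ (n + 1))) ^ 2 ≤ (1 - ρ * γ (n + 1)) * κ ^ 2 := by
        rw [mul_pow, mul_comm]
        have : (1 - ρ * γ (n + 1)) ^ 2 ≤ 1 - ρ * γ (n + 1) := by nlinarith [mul_nonneg hρ.le hg0]
        gcongr
      have h4 := mul_le_mul_of_nonneg_left h3 hBn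
      have h5 : C ≤ B * ρ := by
        have : C / ρ * ρ = C := by field_simp
        have h6 : 0 ≤ (W0 + CV / (2 * l0)) * ρ := by positivity
        rw [hB]; linarith
      have h7 := mul_le_mul_of_nonneg_right h5
        (mul_nonneg (by positivity : 0 ≤ κ + κ ^ 2) hg0)
      linarith
  refine ⟨Real.log I + 2 * B, by positivity, fun n κ hκ => (main n κ hκ).trans ?_⟩
  refine ENNReal.ofReal_le_ofReal (Real.exp_le_exp.2 ?_)
  have h1 : κ ≤ 1 + κ ^ 2 := by nlinarith [sq_nonneg (κ - 1)]
  have h2 := mul_le_mul_of_nonneg_left h1 hBn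
  have h3 : 0 ≤ Real.log I * κ ^ 2 := by positivity
  linarith

end Euler

/-! ### The corrected test function and the one-step supermartingale bound -/

section Supermartingale

variable {d r : ℕ} {μ : Measure (EuclideanSpace ℝ (Fin r))}
  {b : EuclideanSpace ℝ (Fin d) → EuclideanSpace ℝ (Fin d)}
  {σ : EuclideanSpace ℝ (Fin d) → EuclideanSpace ℝ (Fin r) →L[ℝ] EuclideanSpace ℝ (Fin d)}
  {V : EuclideanSpace ℝ (Fin d) → ℝ} {CV αV βV : ℝ}

lemma gradient_lincomb {f g : EuclideanSpace ℝ (Fin d) → ℝ} (hf : ContDiff ℝ 3 f)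
    (hg : ContDiff ℝ 3 g) (a c : ℝ) (x : EuclideanSpace ℝ (Fin d)) :
    gradient (fun x => a * f x + c * g x) x = a • gradient f x + c • gradient g x := by
  have h1 : DifferentiableAt ℝ f x := hf.differentiable (by norm_num) x
  have h2 : DifferentiableAt ℝ g x := hg.differentiable (by norm_num) x
  have h3 : fderiv ℝ (fun x => a * f x + c * g x) x = a • fderiv ℝ f x + c • fderiv ℝ g x :=
    ((h1.hasFDerivAt.const_mul a).add (h2.hasFDerivAt.const_mul c)).fderiv
  rw [gradient, h3, map_add, map_smulₛₗ, map_smulₛₗ]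
  simp [gradient]

lemma hess_lincomb {f g : EuclideanSpace ℝ (Fin d) → ℝ} (hf : ContDiff ℝ 3 f)
    (hg : ContDiff ℝ 3 g) (a c : ℝ) (x w : EuclideanSpace ℝ (Fin d)) :
    hess (fun x => a * f x + c * g x) x w w = a * hess f x w w + c * hess g x w w := by
  have h1 : ContDiff ℝ (2 : ℕ) f := hf.of_le (by norm_num)
  have h2 : ContDiff ℝ (2 : ℕ) g := hg.of_le (by norm_num)
  have e : (fun x => a * f x + c * g x) = a • f + c • g := by
    ext; simp
  rw [hess, e, iteratedFDeriv_add_apply (f := a • f) (g := c • g) (h1.const_smul a).contDiffAt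
    (h2.const_smul c).contDiffAt,
    iteratedFDeriv_const_smul_apply h1.contDiffAt, iteratedFDeriv_const_smul_apply h2.contDiffAt]
  rfl

lemma generator_lincomb {f g : EuclideanSpace ℝ (Fin d) → ℝ} (hf : ContDiff ℝ 3 f)
    (hg : ContDiff ℝ 3 g) (a c : ℝ) (x : EuclideanSpace ℝ (Fin d)) :
    generator b σ (fun x => a * f x + c * g x) x
      = a * generator b σ f x + c * generator b σ g x := by
  simp only [generator, gradient_lincomb hf hg, hess_lincomb hf hg, inner_add_right,
    inner_smul_right, Finset.sum_add_distrib, ← Finset.mul_sum]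
  ring

lemma continuous_generator {f : EuclideanSpace ℝ (Fin d) → ℝ} (hf : ContDiff ℝ 3 f)
    (hb : Continuous b) (hσ : Continuous σ) : Continuous (generator b σ f) := by
  have h1 : Continuous fun x => fderiv ℝ f x := hf.continuous_fderiv (by norm_num)
  have h2 : Continuous fun x => iteratedFDeriv ℝ 2 f x :=
    hf.continuous_iteratedFDeriv (by norm_num)
  have e : generator b σ f = fun x => fderiv ℝ f x (b x)
      + (1 / 2) * ∑ j, iteratedFDeriv ℝ 2 f x fun _ => σ x (basisVec j) := by
    ext x
    simp only [generator, inner_gradient_eq_fderiv, hess_diag]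
  rw [e]
  refine (h1.clm_apply hb).add (continuous_const.mul (continuous_finsetSum _ fun j _ => ?_))
  have h3 : Continuous fun x => ((iteratedFDeriv ℝ 2 f x,
      (fun _ => σ x (basisVec j))) : (ContinuousMultilinearMap ℝ
        (fun _ : Fin 2 => EuclideanSpace ℝ (Fin d)) ℝ) × (Fin 2 → EuclideanSpace ℝ (Fin d))) :=
    h2.prodMk (continuous_pi fun _ => hσ.clm_apply continuous_const)
  exact continuous_eval.comp h3

/-- The constants attached to a test function: a bound on its derivatives and Hölder seminorm, the
Lipschitz continuity of `z ↦ ⟨b x, ∇f z⟩` at `z = x` uniformly in `x`, and the growth bound. -/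
lemma TestCondition.exists_bound {β : ℝ} {f : EuclideanSpace ℝ (Fin d) → ℝ}
    (hf : TestCondition b V β f) (hb : ∃ K : ℝ≥0, LipschitzWith K b) :
    ∃ M, 0 ≤ M ∧ HolderBound β M f ∧
      (∀ x z, |fderiv ℝ f z (b x) - fderiv ℝ f x (b x)| ≤ M * ‖z - x‖) ∧
      ∀ x, |f x| ≤ M * (1 + Real.sqrt (V x)) := by
  obtain ⟨M, hM, h1⟩ := hf.smooth.exists_holderBound
  obtain ⟨K, hK⟩ := hf.lipschitz
  obtain ⟨Kb, hKb⟩ := hb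
  obtain ⟨L, hL, h2⟩ := hf.growth
  set N := M + (K + M * Kb) + L with hN
  have hMN : M ≤ N := by
    have : 0 ≤ (K : ℝ) + M * Kb := by positivity
    linarith
  refine ⟨N, by positivity, ⟨h1.contDiff, fun i hi hi' x => (h1.bounded i hi hi' x).trans hMN,
    fun x y => (h1.holder x y).trans (by gcongr)⟩, fun x z => ?_, fun x => (h2 x).trans ?_⟩
  · have a1 := hK.dist_le_mul z x
    rw [Real.dist_eq, dist_eq_norm, inner_gradient_eq_fderiv, inner_gradient_eq_fderiv] at a1
    have a2 : |fderiv ℝ f z (b z - b x)| ≤ M * (Kb * ‖z - x‖) := by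
      have a3 := hKb.dist_le_mul z x
      rw [dist_eq_norm, dist_eq_norm] at a3
      exact (ContinuousLinearMap.le_of_opNorm_le _ (h1.norm_fderiv_le z) _).trans
        (mul_le_mul_of_nonneg_left a3 hM)
    have a4 : fderiv ℝ f z (b x) - fderiv ℝ f x (b x)
        = (fderiv ℝ f z (b z) - fderiv ℝ f x (b x)) - fderiv ℝ f z (b z - b x) := by
      rw [map_sub]; ring
    rw [a4]
    refine (abs_sub _ _).trans ?_
    have : 0 ≤ (M + L) * ‖z - x‖ := by positivity
    rw [hN]
    linarith
  · have : 0 ≤ M + (K + M * Kb) := by positivity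
    gcongr
    linarith

/-- The corrector `-φ - (l/2) ϑ`. Its increments along the scheme compensate `l 𝒜φ` and turn the
carré du champ of `φ` into its mean, thanks to the Poisson equation for `ϑ`. -/
noncomputable def corrector (φ ϑ : EuclideanSpace ℝ (Fin d) → ℝ) (l : ℝ)
    (x : EuclideanSpace ℝ (Fin d)) : ℝ := (-1) * φ x + (-(l / 2)) * ϑ x

/-- Logarithm of the factor contributed by a step of size `g` from `x` to `x'` to the exponential
supermartingale with parameter `l`. Here `v` is the asymptotic variance and `C` the constant in
front of the error terms. -/
noncomputable def logFactor (b : EuclideanSpace ℝ (Fin d) → EuclideanSpace ℝ (Fin d))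
    (σ : EuclideanSpace ℝ (Fin d) → EuclideanSpace ℝ (Fin r) →L[ℝ] EuclideanSpace ℝ (Fin d))
    (V φ ϑ : EuclideanSpace ℝ (Fin d) → ℝ) (β v C l g : ℝ) (x x' : EuclideanSpace ℝ (Fin d)) : ℝ :=
  l * (corrector φ ϑ l x' - corrector φ ϑ l x) + l * g * generator b σ φ x - l ^ 2 * g * v / 2
    - C * (l * (Real.sqrt g ^ β * Real.sqrt g ^ 3) + l ^ 2 * Real.sqrt g ^ 3 + l ^ 3 * g
      + l * (g ^ 2 * Real.sqrt (V x)))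

lemma norm_add_smul_sq_le {w z : EuclideanSpace ℝ (Fin r)} {R t : ℝ} (hw : ‖w‖ ≤ R) (hz : ‖z‖ ≤ R)
    (ht : 0 ≤ t) (ht1 : t ≤ 1) : ‖w + t • z‖ ^ 2 ≤ ‖w‖ ^ 2 + 3 * R ^ 2 * t := by
  have h1 : ‖w + t • z‖ ≤ ‖w‖ + t * ‖z‖ := by
    refine (norm_add_le _ _).trans_eq ?_
    rw [norm_smul, Real.norm_eq_abs, abs_of_nonneg ht]
  have hR : 0 ≤ R := (norm_nonneg _).trans hw
  have n1 := norm_nonneg w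
  have n2 := norm_nonneg z
  have h2 : ‖w + t • z‖ ^ 2 ≤ (‖w‖ + t * ‖z‖) ^ 2 := by gcongr
  have h3 : ‖w‖ * ‖z‖ ≤ R ^ 2 := by rw [sq]; exact mul_le_mul hw hz n2 hR
  have h4 : ‖z‖ ^ 2 ≤ R ^ 2 := by gcongr
  have h5 : t ^ 2 * ‖z‖ ^ 2 ≤ t * R ^ 2 := by
    have : t ^ 2 ≤ t := by nlinarith
    exact mul_le_mul this h4 (by positivity) ht
  have h6 := mul_le_mul_of_nonneg_left h3 (by positivity : 0 ≤ 2 * t)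
  nlinarith

/-- One step of the exponential supermartingale. -/
lemma exists_lintegral_logFactor_le_one (hμ : InnovationLaw μ)
    (hV : LyapunovCondition b σ V CV αV βV)
    (hb : ∃ K : ℝ≥0, LipschitzWith K b) {β : ℝ} (hβ : 0 ≤ β) (hβ1 : β ≤ 1)
    {s : ℝ} (hs : 0 ≤ s) (hσ : ∀ x, ‖σ x‖ ≤ s) {G : ℝ}
    {φ ϑ : EuclideanSpace ℝ (Fin d) → ℝ} (hφ : TestCondition b V β φ) (hϑ : TestCondition b V β ϑ)
    {v : ℝ} (hPoisson : ∀ x, generator b σ ϑ x = carreDuChamp σ φ x - v) :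
    ∃ C, 0 ≤ C ∧ (∀ l, 0 ≤ l → l ≤ 1 → ∀ x, |corrector φ ϑ l x| ≤ C * (1 + Real.sqrt (V x))) ∧
      ∀ l, 0 ≤ l → l ≤ 1 → ∀ g, 0 ≤ g → g ≤ G → ∀ x,
      ∫⁻ u, ENNReal.ofReal (Real.exp (logFactor b σ V φ ϑ β v C l g x (eulerStep b σ g x u))) ∂μ
        ≤ 1 := by
  obtain ⟨M1, hM1, hb1, hd1, hg1⟩ := hφ.exists_bound hb
  obtain ⟨M2, hM2, hb2, hd2, hg2⟩ := hϑ.exists_bound hb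
  set M := M1 + M2 with hMdef
  have hM : 0 ≤ M := by positivity
  obtain ⟨C, hC, H⟩ := hμ.exp_moment_euler_step (d := d) hβ hβ1 hM hs (Real.sqrt_nonneg G)
  set C' := M + C * (1 + Real.sqrt CV) + (s * M) ^ 2 with hC'
  have hcoef : ∀ l : ℝ, 0 ≤ l → l ≤ 1 → |(-1 : ℝ)| ≤ 1 ∧ |(-(l / 2))| ≤ 1 := fun l hl hl1 => by
    refine ⟨by simp, ?_⟩
    rw [abs_neg, abs_of_nonneg (by positivity)]; linarith
  have hlin : ∀ {a1 a2 A1 A2 l : ℝ}, 0 ≤ l → l ≤ 1 → |a1| ≤ A1 → |a2| ≤ A2 →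
      |(-1) * a1 + (-(l / 2)) * a2| ≤ A1 + A2 := fun {a1 a2 A1 A2 l} hl hl1 h1 h2 => by
    obtain ⟨c1, c2⟩ := hcoef l hl hl1
    refine (abs_add_le _ _).trans ?_
    rw [abs_mul, abs_mul]
    have := mul_le_mul c1 h1 (abs_nonneg _) zero_le_one
    have := mul_le_mul c2 h2 (abs_nonneg _) zero_le_one
    linarith
  refine ⟨C', by positivity, fun l hl hl1 x => ?_, fun l hl hl1 g hg hgG x => ?_⟩
  · refine (hlin hl hl1 (hg1 x) (hg2 x)).trans ?_
    rw [← add_mul]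
    have : 0 ≤ C * (1 + Real.sqrt CV) + (s * M) ^ 2 := by positivity
    gcongr
    linarith
  obtain ⟨c1, c2⟩ := hcoef l hl hl1
  have hf : HolderBound β M (corrector φ ϑ l) := hb1.lincomb hb2 c1 c2
  set q := Real.sqrt g with hq
  have hq0 : 0 ≤ q := Real.sqrt_nonneg _
  have hq2 : q ^ 2 = g := Real.sq_sqrt hg
  have hfd : ∀ z w, fderiv ℝ (corrector φ ϑ l) z w
      = (-1) * fderiv ℝ φ z w + (-(l / 2)) * fderiv ℝ ϑ z w := fun z w => by
    rw [← inner_gradient_eq_fderiv, ← inner_gradient_eq_fderiv, ← inner_gradient_eq_fderiv]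
    unfold corrector
    rw [gradient_lincomb hb1.contDiff hb2.contDiff, inner_add_right, inner_smul_right,
      inner_smul_right]
  have hdr : ∀ z, |fderiv ℝ (corrector φ ϑ l) z (b x) - fderiv ℝ (corrector φ ϑ l) x (b x)|
      ≤ M * ‖z - x‖ := fun z => by
    rw [hfd, hfd, hMdef, add_mul]
    refine le_trans (le_of_eq ?_) (hlin hl hl1 (hd1 x z) (hd2 x z))
    congr 1; ring
  obtain ⟨hI, hB⟩ := H _ hf (σ x) (hσ x) q hq0 (Real.sqrt_le_sqrt hgG) l hl hl1 x (b x) hdr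
  rw [hq2] at hI hB
  set E := -(l * g * generator b σ φ x) + l ^ 2 * g * v / 2
    + C' * (l * (q ^ β * q ^ 3) + l ^ 2 * q ^ 3 + l ^ 3 * g + l * (g ^ 2 * Real.sqrt (V x))) with hE
  have hsplit : ∀ u, ENNReal.ofReal (Real.exp
        (logFactor b σ V φ ϑ β v C' l g x (eulerStep b σ g x u)))
      = ENNReal.ofReal (Real.exp (-E)) * ENNReal.ofReal (Real.exp
        (l * (corrector φ ϑ l (x + g • b x + q • σ x u) - corrector φ ϑ l x))) := fun u => by
    rw [← ENNReal.ofReal_mul (Real.exp_pos _).le, ← Real.exp_add]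
    congr 2
    rw [logFactor, eulerStep, hE]
    ring
  simp_rw [hsplit]
  rw [lintegral_const_mul' _ _ ENNReal.ofReal_ne_top,
    ← ofReal_integral_eq_lintegral_ofReal hI (ae_of_all _ fun ω => (Real.exp_pos _).le),
    ← ENNReal.ofReal_mul (Real.exp_pos _).le]
  refine ENNReal.ofReal_le_one.2 ?_
  refine (mul_le_mul_of_nonneg_left hB (Real.exp_pos _).le).trans ?_
  rw [← Real.exp_add]
  refine Real.exp_le_one_iff.2 ?_
  -- the exponent is nonpositive: the Poisson equation cancels the carré du champ of `φ`
  have hgen : inner ℝ (b x) (gradient (corrector φ ϑ l) x)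
      + (1 / 2) * ∑ j, hess (corrector φ ϑ l) x (σ x (basisVec j)) (σ x (basisVec j))
      = -generator b σ φ x - l / 2 * (carreDuChamp σ φ x - v) := by
    have h1 := generator_lincomb (b := b) (σ := σ) hb1.contDiff hb2.contDiff (-1) (-(l / 2)) x
    rw [hPoisson x] at h1
    refine Eq.trans h1 ?_
    ring
  have hcc : ‖(σ x).adjoint (gradient (corrector φ ϑ l) x)‖ ^ 2
      ≤ carreDuChamp σ φ x + 3 * (s * M) ^ 2 * (l / 2) := by
    have h1 : ∀ (f : EuclideanSpace ℝ (Fin d) → ℝ), ‖fderiv ℝ f x‖ ≤ M →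
        ‖(σ x).adjoint (gradient f x)‖ ≤ s * M := fun f hf => by
      refine (ContinuousLinearMap.le_of_opNorm_le _
        ((LinearIsometryEquiv.norm_map _ (σ x)).trans_le (hσ x)) _).trans ?_
      refine mul_le_mul_of_nonneg_left ?_ hs
      rwa [gradient, LinearIsometryEquiv.norm_map]
    have h2 := norm_add_smul_sq_le (t := l / 2)
      (h1 φ ((hb1.norm_fderiv_le x).trans (by linarith)))
      (h1 ϑ ((hb2.norm_fderiv_le x).trans (by linarith))) (by positivity) (by linarith)
    have h3 : (σ x).adjoint (gradient (corrector φ ϑ l) x)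
        = -((σ x).adjoint (gradient φ x) + (l / 2) • (σ x).adjoint (gradient ϑ x)) := by
      unfold corrector
      rw [gradient_lincomb hb1.contDiff hb2.contDiff, map_add, map_smul, map_smul]
      simp only [neg_smul, one_smul, neg_add]
    rw [h3, norm_neg]
    exact h2
  rw [hgen, hE]
  have hq4 : q ^ 4 = g ^ 2 := by rw [← hq2]; ring
  rw [hq4]
  have f1 := mul_le_mul_of_nonneg_left hcc (by positivity : 0 ≤ l ^ 2 * (g / 2))
  have f2 := mul_le_mul_of_nonneg_left (hV.norm_drift_le x) (by positivity : 0 ≤ C * (l * g ^ 2))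
  have p1 : 0 ≤ (M + C * Real.sqrt CV + (s * M) ^ 2) * (l * (q ^ β * q ^ 3) + l ^ 2 * q ^ 3) := by
    positivity
  have p2 : 0 ≤ (M + C + (s * M) ^ 2) * (l * (g ^ 2 * Real.sqrt (V x))) := by positivity
  have p3 : 0 ≤ (M + C * (1 + Real.sqrt CV)) * (l ^ 3 * g) := by positivity
  have p4 : 0 ≤ (s * M) ^ 2 * (l ^ 3 * g) := by positivity
  rw [hC']
  linarith [f1, f2, p1, p2, p3, p4]

end Supermartingale

/-! ### Exponential moments of the empirical sums -/

section ExpMoments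

variable {Ω : Type*} [MeasurableSpace Ω] {P : Measure Ω}

/-- Convexity of the exponential, in place of Hölder's inequality: removes an exponentially small
perturbation `Y` from an exponential moment, at the price of a factor `1 - ε` in the exponent. -/
lemma lintegral_exp_one_sub_mul_le {S Y : Ω → ℝ} (hY : Measurable Y) {ε G D : ℝ} (hε : 0 < ε)
    (hε1 : ε < 1) (hY0 : ∀ ω, 0 ≤ Y ω) (hD : 0 ≤ D)
    (h1 : ∫⁻ ω, ENNReal.ofReal (Real.exp (S ω - G - Y ω)) ∂P ≤ 1)
    (h2 : ∫⁻ ω, ENNReal.ofReal (Real.exp (ε⁻¹ * Y ω)) ∂P ≤ ENNReal.ofReal D) :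
    ∫⁻ ω, ENNReal.ofReal (Real.exp ((1 - ε) * S ω)) ∂P
      ≤ ENNReal.ofReal (Real.exp ((1 - ε) * G) * (1 + ε * D)) := by
  have h1ε : 0 ≤ 1 - ε := by linarith
  have hpt : ∀ ω, ENNReal.ofReal (Real.exp ((1 - ε) * S ω))
      ≤ ENNReal.ofReal (Real.exp ((1 - ε) * G)) *
        (ENNReal.ofReal (1 - ε) * ENNReal.ofReal (Real.exp (S ω - G - Y ω))
          + ENNReal.ofReal ε * ENNReal.ofReal (Real.exp (ε⁻¹ * Y ω))) := fun ω => by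
    rw [← ENNReal.ofReal_mul h1ε, ← ENNReal.ofReal_mul hε.le,
      ← ENNReal.ofReal_add (by positivity) (by positivity), ← ENNReal.ofReal_mul (by positivity)]
    refine ENNReal.ofReal_le_ofReal ?_
    have hc := convexOn_exp.2 (Set.mem_univ (S ω - G - Y ω)) (Set.mem_univ (ε⁻¹ * Y ω)) h1ε hε.le
      (by ring)
    simp only [smul_eq_mul] at hc
    calc Real.exp ((1 - ε) * S ω) ≤ Real.exp ((1 - ε) * G)
          * Real.exp ((1 - ε) * (S ω - G - Y ω) + ε * (ε⁻¹ * Y ω)) := by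
          rw [← Real.exp_add]
          refine Real.exp_le_exp.2 ?_
          rw [mul_inv_cancel_left₀ hε.ne']
          nlinarith [mul_nonneg hε.le (hY0 ω)]
      _ ≤ _ := by gcongr
  refine (lintegral_mono hpt).trans ?_
  rw [lintegral_const_mul' _ _ ENNReal.ofReal_ne_top,
    lintegral_add_right _ (((hY.const_mul _).exp.ennreal_ofReal).const_mul _),
    lintegral_const_mul' _ _ ENNReal.ofReal_ne_top, lintegral_const_mul' _ _ ENNReal.ofReal_ne_top,
    ENNReal.ofReal_mul (Real.exp_pos _).le]
  refine mul_le_mul_right ?_ _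
  have e : ENNReal.ofReal (1 + ε * D) = 1 + ENNReal.ofReal ε * ENNReal.ofReal D := by
    rw [ENNReal.ofReal_add zero_le_one (by positivity), ENNReal.ofReal_mul hε.le,
      ENNReal.ofReal_one]
  rw [e]
  refine add_le_add ?_ (mul_le_mul_right h2 _)
  calc _ ≤ ENNReal.ofReal (1 - ε) * 1 := mul_le_mul_right h1 _
    _ ≤ 1 := by
      rw [mul_one]
      exact ENNReal.ofReal_le_one.2 (by linarith)

variable [IsProbabilityMeasure P]

/-- Jensen's inequality for the exponential moment of a weighted sum of sub-Gaussian variables. -/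
lemma lintegral_exp_weighted_sum_le {W : ℕ → Ω → ℝ} (hW : ∀ k, Measurable (W k)) {C : ℝ}
    (hC : 0 ≤ C)
    (h : ∀ n κ, 0 ≤ κ → ∫⁻ ω, ENNReal.ofReal (Real.exp (κ * W n ω)) ∂P
      ≤ ENNReal.ofReal (Real.exp (C * (1 + κ ^ 2))))
    (I : Finset ℕ) {w : ℕ → ℝ} (hw : ∀ k ∈ I, 0 ≤ w k) {t : ℝ} (ht : 0 ≤ t) :
    ∫⁻ ω, ENNReal.ofReal (Real.exp (t * ∑ k ∈ I, w k * (1 + W k ω))) ∂P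
      ≤ ENNReal.ofReal (Real.exp ((C + 1) * (1 + (t * ∑ k ∈ I, w k) ^ 2))) := by
  obtain ⟨m, hm⟩ : ∃ m, m = ∑ k ∈ I, w k := ⟨_, rfl⟩
  rw [← hm]
  have hm0 : 0 ≤ m := hm ▸ Finset.sum_nonneg hw
  rcases hm0.eq_or_lt with h0 | hpos
  · have hz : ∀ k ∈ I, w k = 0 := (Finset.sum_eq_zero_iff_of_nonneg hw).1 (hm ▸ h0.symm)
    have : ∀ ω, ∑ k ∈ I, w k * (1 + W k ω) = 0 := fun ω =>
      Finset.sum_eq_zero fun k hk => by rw [hz k hk, zero_mul]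
    simp only [this, mul_zero, Real.exp_zero, ENNReal.ofReal_one, lintegral_const, measure_univ]
    rw [one_mul, ENNReal.one_le_ofReal]
    exact Real.one_le_exp (by positivity)
  have hpt : ∀ ω, ENNReal.ofReal (Real.exp (t * ∑ k ∈ I, w k * (1 + W k ω)))
      ≤ ∑ k ∈ I, ENNReal.ofReal (w k / m * Real.exp (t * m))
          * ENNReal.ofReal (Real.exp (t * m * W k ω)) := fun ω => by
    have hw1 : ∑ k ∈ I, w k / m = 1 := by rw [← Finset.sum_div, ← hm]; exact div_self hpos.ne'
    have hj := convexOn_exp.map_sum_le (p := fun k => t * m * (1 + W k ω))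
      (fun k hk => div_nonneg (hw k hk) hm0) hw1 (fun _ _ => Set.mem_univ _)
    simp only [smul_eq_mul] at hj
    have e1 : ∑ k ∈ I, w k / m * (t * m * (1 + W k ω)) = t * ∑ k ∈ I, w k * (1 + W k ω) := by
      rw [Finset.mul_sum]
      exact Finset.sum_congr rfl fun k _ => by field_simp
    rw [e1] at hj
    refine (ENNReal.ofReal_le_ofReal hj).trans_eq ?_
    rw [ENNReal.ofReal_sum_of_nonneg fun k hk =>
      mul_nonneg (div_nonneg (hw k hk) hm0) (Real.exp_pos _).le]
    refine Finset.sum_congr rfl fun k hk => ?_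
    rw [← ENNReal.ofReal_mul (mul_nonneg (div_nonneg (hw k hk) hm0) (Real.exp_pos _).le),
      mul_assoc (w k / m), ← Real.exp_add]
    congr 3
    ring
  refine (lintegral_mono hpt).trans ?_
  rw [lintegral_finsetSum _ fun k _ => ((hW k).const_mul _).exp.ennreal_ofReal.const_mul _]
  simp_rw [lintegral_const_mul' _ _ ENNReal.ofReal_ne_top]
  calc _ ≤ ∑ k ∈ I, ENNReal.ofReal (w k / m * Real.exp (t * m))
          * ENNReal.ofReal (Real.exp (C * (1 + (t * m) ^ 2))) :=
        Finset.sum_le_sum fun k _ => mul_le_mul_right (h k _ (by positivity)) _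
    _ = ENNReal.ofReal (Real.exp (t * m + C * (1 + (t * m) ^ 2))) := by
        rw [← Finset.sum_mul, ← ENNReal.ofReal_sum_of_nonneg fun k hk =>
          mul_nonneg (div_nonneg (hw k hk) hm0) (Real.exp_pos _).le, ← Finset.sum_mul,
          ← Finset.sum_div, ← hm, div_self hpos.ne', one_mul,
          ← ENNReal.ofReal_mul (Real.exp_pos _).le, ← Real.exp_add]
    _ ≤ _ := by
        refine ENNReal.ofReal_le_ofReal (Real.exp_le_exp.2 ?_)
        nlinarith [sq_nonneg (t * m - 1)]

variable {d r : ℕ} {μ : Measure (EuclideanSpace ℝ (Fin r))}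
  {b : EuclideanSpace ℝ (Fin d) → EuclideanSpace ℝ (Fin d)}
  {σ : EuclideanSpace ℝ (Fin d) → EuclideanSpace ℝ (Fin r) →L[ℝ] EuclideanSpace ℝ (Fin d)}
  {γ : ℕ → ℝ}
  {X₀ : Ω → EuclideanSpace ℝ (Fin d)} {U : ℕ → Ω → EuclideanSpace ℝ (Fin r)}
  {V : EuclideanSpace ℝ (Fin d) → ℝ} {CV αV βV : ℝ}

/-- Exponential moments of `Γ_n ν_n(𝒜φ)`: Gaussian with variance `v Γ_n`, up to the bias
`∑ γ^{(3+β)/2}`, corrections of higher order in `l`, and the loss `ε` in the exponent. -/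
lemma exists_exp_moment_generator_sum_le (hμ : InnovationLaw μ)
    (hV : LyapunovCondition b σ V CV αV βV)
    (hb : ∃ K : ℝ≥0, LipschitzWith K b) (hσc : Continuous σ) {β : ℝ} (hβ : 0 ≤ β) (hβ1 : β ≤ 1)
    {s : ℝ} (hs : 0 ≤ s) (hσ : ∀ x, ‖σ x‖ ≤ s) {G : ℝ} (hG : 0 < G)
    (hγ : ∀ k, 1 ≤ k → 0 ≤ γ k ∧ γ k ≤ G ∧ 2 * CV * (⨆ x, hessNorm V x) * γ k ≤ αV)
    (hX₀ : Measurable X₀) (hC1 : SubGaussianInit P X₀)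
    (hU : ∀ k, 1 ≤ k → Measurable (U k)) (hU_law : ∀ k, 1 ≤ k → P.map (U k) = μ)
    (hU_indep : iIndepFun (fun k : ℕ => U (k + 1)) P)
    (hU_X₀ : IndepFun X₀ (fun ω (k : ℕ) => U (k + 1) ω) P)
    {φ ϑ : EuclideanSpace ℝ (Fin d) → ℝ} (hφ : TestCondition b V β φ) (hϑ : TestCondition b V β ϑ)
    {v : ℝ} (hPoisson : ∀ x, generator b σ ϑ x = carreDuChamp σ φ x - v) :
    ∃ C, 0 ≤ C ∧ ∀ ε, 0 < ε → ε < 1 → ∀ l, 0 ≤ l → l ≤ 1 → ∀ n,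
      ∫⁻ ω, ENNReal.ofReal (Real.exp ((1 - ε) * (l * ∑ k ∈ Finset.range n,
          γ (k + 1) * generator b σ φ (euler b σ γ X₀ U k ω)))) ∂P
        ≤ ENNReal.ofReal (Real.exp ((1 - ε) * (l ^ 2 * v / 2 * ∑ k ∈ Finset.range n, γ (k + 1)
            + C * (l * ∑ k ∈ Finset.range n, Real.sqrt (γ (k + 1)) ^ β * Real.sqrt (γ (k + 1)) ^ 3
              + l ^ 2 * ∑ k ∈ Finset.range n, Real.sqrt (γ (k + 1)) ^ 3
              + l ^ 3 * ∑ k ∈ Finset.range n, γ (k + 1))))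
          * (1 + ε * Real.exp (C * (1 + (l / ε
              * (2 + ∑ k ∈ Finset.range (n + 1), γ (k + 1) ^ 2)) ^ 2)))) := by
  have hbc : Continuous b := hb.choose_spec.continuous
  obtain ⟨C1, hC1', hcorr, hone⟩ := exists_lintegral_logFactor_le_one (σ := σ) hμ hV hb hβ hβ1 hs
    hσ (G := G) hφ hϑ hPoisson
  obtain ⟨C2, hC2, hmom⟩ := hV.exp_sqrt_moment hbc hσc hμ hs hσ hG hγ hX₀ hC1 hU hU_law hU_indep
    hU_X₀
  set X := euler b σ γ X₀ U with hX
  have hXm : ∀ k, Measurable (X k) := fun k =>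
    (measurable_euler_and_indepFun hbc hσc hX₀ hU hU_indep hU_X₀ k).1
  have hφc : ContDiff ℝ 3 φ := by exact_mod_cast hφ.smooth.contDiff
  have hϑc : ContDiff ℝ 3 ϑ := by exact_mod_cast hϑ.smooth.contDiff
  have hVc := hV.contDiff.continuous
  have hWm : ∀ k, Measurable fun ω => Real.sqrt (V (X k ω)) := fun k =>
    hVc.sqrt.measurable.comp (hXm k)
  refine ⟨C1 + (C2 + 1) * (1 + C1 ^ 2), by positivity, fun ε hε hε1 l hl hl1 n => ?_⟩
  -- all values of `√V` in the remainder, those at times `0` and `n` included, as one weighted sum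
  set w : ℕ → ℝ := fun k => γ (k + 1) ^ 2 + ((if k = 0 then 1 else 0) + if k = n then 1 else 0)
    with hw
  have hw0 : ∀ k, 0 ≤ w k := fun k => by simp only [hw]; positivity
  set Y : Ω → ℝ := fun ω => ∑ k ∈ Finset.range (n + 1), w k * (1 + Real.sqrt (V (X k ω))) with hY
  have hYm : Measurable Y := by
    refine Finset.measurable_sum _ fun k _ => ?_
    exact (measurable_const.add (hWm k)).const_mul _
  have hwsum : ∑ k ∈ Finset.range (n + 1), w k
      = 2 + ∑ k ∈ Finset.range (n + 1), γ (k + 1) ^ 2 := by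
    simp only [hw, Finset.sum_add_distrib, Finset.sum_ite_eq', Finset.mem_range]
    rw [if_pos (by omega), if_pos (by omega)]
    ring
  have hYlow : ∀ ω, (1 + Real.sqrt (V (X 0 ω))) + (1 + Real.sqrt (V (X n ω)))
      + ∑ k ∈ Finset.range n, γ (k + 1) ^ 2 * Real.sqrt (V (X k ω)) ≤ Y ω := fun ω => by
    have e : Y ω = ∑ k ∈ Finset.range (n + 1), γ (k + 1) ^ 2 * (1 + Real.sqrt (V (X k ω)))
        + ((1 + Real.sqrt (V (X 0 ω))) + (1 + Real.sqrt (V (X n ω)))) := by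
      simp only [hY, hw, add_mul, Finset.sum_add_distrib, ite_mul, zero_mul, Finset.sum_ite_eq',
        Finset.mem_range]
      rw [if_pos (by omega), if_pos (by omega)]
      ring
    rw [e, Finset.sum_range_succ]
    have h1 : ∑ k ∈ Finset.range n, γ (k + 1) ^ 2 * Real.sqrt (V (X k ω))
        ≤ ∑ k ∈ Finset.range n, γ (k + 1) ^ 2 * (1 + Real.sqrt (V (X k ω))) := by
      gcongr
      linarith
    have h2 : 0 ≤ γ (n + 1) ^ 2 * (1 + Real.sqrt (V (X n ω))) := by positivity
    linarith
  have hY0 : ∀ ω, 0 ≤ Y ω := fun ω => Finset.sum_nonneg fun k _ =>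
    mul_nonneg (hw0 k) (by positivity)
  set Γ := ∑ k ∈ Finset.range n, γ (k + 1) with hΓ
  have hΓ0 : 0 ≤ Γ := Finset.sum_nonneg fun k _ => (hγ _ (by omega)).1
  set R := ∑ k ∈ Finset.range n, Real.sqrt (γ (k + 1)) ^ β * Real.sqrt (γ (k + 1)) ^ 3 with hR
  have hR0 : 0 ≤ R := Finset.sum_nonneg fun k _ => by positivity
  set Q := ∑ k ∈ Finset.range n, Real.sqrt (γ (k + 1)) ^ 3 with hQ
  have hQ0 : 0 ≤ Q := Finset.sum_nonneg fun k _ => by positivity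
  set m := 2 + ∑ k ∈ Finset.range (n + 1), γ (k + 1) ^ 2 with hm
  set S : Ω → ℝ := fun ω => ∑ k ∈ Finset.range n, γ (k + 1) * generator b σ φ (X k ω) with hS
  have hA := lintegral_exp_sum_le_one (γ := γ) (μ := μ) hbc hσc hX₀ hU hU_law hU_indep hU_X₀
    (ℓ := fun k => logFactor b σ V φ ϑ β v C1 l (γ (k + 1)))
    (fun k => by
      have h1 := continuous_generator hφc hbc hσc
      have h2 := hφc.continuous
      have h3 := hϑc.continuous
      have h4 := hVc.sqrt
      unfold logFactor corrector
      exact Continuous.measurable (by fun_prop))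
    (fun k x => hone l hl hl1 _ (hγ _ (by omega)).1 (hγ _ (by omega)).2.1 x) n
  rw [← hX] at hA
  have hsum : ∀ ω, l * S ω - (l ^ 2 * v / 2 * Γ + C1 * (l * R + l ^ 2 * Q + l ^ 3 * Γ))
      - l * C1 * Y ω ≤ ∑ k ∈ Finset.range n,
        logFactor b σ V φ ϑ β v C1 l (γ (k + 1)) (X k ω) (X (k + 1) ω) := fun ω => by
    have e : ∑ k ∈ Finset.range n,
        logFactor b σ V φ ϑ β v C1 l (γ (k + 1)) (X k ω) (X (k + 1) ω)
        = l * (corrector φ ϑ l (X n ω) - corrector φ ϑ l (X 0 ω)) + l * S ω - l ^ 2 * v / 2 * Γ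
          - C1 * (l * R + l ^ 2 * Q + l ^ 3 * Γ
            + l * ∑ k ∈ Finset.range n, γ (k + 1) ^ 2 * Real.sqrt (V (X k ω))) := by
      rw [← Finset.sum_range_sub (fun k => corrector φ ϑ l (X k ω)) n, hS, hΓ, hR, hQ]
      simp only [Finset.mul_sum, ← Finset.sum_add_distrib, ← Finset.sum_sub_distrib]
      refine Finset.sum_congr rfl fun k _ => ?_
      rw [logFactor]
      ring
    rw [e]
    have h1 := (abs_le.1 (hcorr l hl hl1 (X n ω))).1
    have h2 := (abs_le.1 (hcorr l hl hl1 (X 0 ω))).2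
    have h3 := mul_le_mul_of_nonneg_left (hYlow ω) (mul_nonneg hl hC1')
    have h4 := mul_le_mul_of_nonneg_left h1 hl
    have h5 := mul_le_mul_of_nonneg_left h2 hl
    linarith
  have hB : ∫⁻ ω, ENNReal.ofReal (Real.exp (l * S ω
      - (l ^ 2 * v / 2 * Γ + C1 * (l * R + l ^ 2 * Q + l ^ 3 * Γ)) - l * C1 * Y ω)) ∂P ≤ 1 :=
    (lintegral_mono fun ω => ENNReal.ofReal_le_ofReal (Real.exp_le_exp.2 (hsum ω))).trans hA
  have hD := lintegral_exp_weighted_sum_le hWm hC2 hmom (Finset.range (n + 1)) (w := w)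
    (fun k _ => hw0 k) (t := ε⁻¹ * (l * C1)) (by positivity)
  rw [hwsum] at hD
  have hfin := lintegral_exp_one_sub_mul_le (hYm.const_mul (l * C1)) hε hε1
    (fun ω => mul_nonneg (mul_nonneg hl hC1') (hY0 ω)) (Real.exp_pos _).le hB (by
      simp_rw [← mul_assoc] at hD ⊢
      exact hD)
  refine hfin.trans (ENNReal.ofReal_le_ofReal ?_)
  have h1ε : 0 ≤ 1 - ε := by linarith
  have hCle : C1 ≤ C1 + (C2 + 1) * (1 + C1 ^ 2) := by
    have : 0 ≤ (C2 + 1) * (1 + C1 ^ 2) := by positivity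
    linarith
  have hexp : (C2 + 1) * (1 + (ε⁻¹ * l * C1 * m) ^ 2)
      ≤ (C1 + (C2 + 1) * (1 + C1 ^ 2)) * (1 + (l / ε * m) ^ 2) := by
    have e : (ε⁻¹ * l * C1 * m) ^ 2 = C1 ^ 2 * (l / ε * m) ^ 2 := by
      rw [div_eq_inv_mul]; ring
    rw [e]
    have p2 : 0 ≤ C1 * (1 + (l / ε * m) ^ 2) := by positivity
    have p3 : 0 ≤ (C2 + 1) * (l / ε * m) ^ 2 := by positivity
    have p4 : 0 ≤ (C2 + 1) * C1 ^ 2 := by positivity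
    linarith
  have h2 := Real.exp_le_exp.2 hexp
  gcongr

end ExpMoments

/-! ### Asymptotics of sums of steps -/

section Steps

open Asymptotics

lemma sum_range_rpow_neg_le {p : ℝ} (hp0 : 0 ≤ p) (hp : p < 1) (n : ℕ) :
    ∑ k ∈ Finset.range n, ((k : ℝ) + 1) ^ (-p) ≤ (n : ℝ) ^ (1 - p) / (1 - p) := by
  have h1p : 0 < 1 - p := by linarith
  induction n with
  | zero => simp [Real.zero_rpow h1p.ne']
  | succ n ih =>
    rw [Finset.sum_range_succ]
    have hn : (0 : ℝ) < (n : ℝ) + 1 := by positivity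
    -- Bernoulli's inequality for the exponent `1 - p`
    have hb := rpow_one_add_le_one_add_mul_self (s := -(1 / ((n : ℝ) + 1))) (p := 1 - p)
      (by rw [neg_le_neg_iff, div_le_one hn]; linarith [n.cast_nonneg (α := ℝ)]) h1p.le
      (by linarith)
    have e1 : 1 + -(1 / ((n : ℝ) + 1)) = n / (n + 1) := by field_simp; ring
    rw [e1, Real.div_rpow (by positivity) hn.le, div_le_iff₀ (by positivity)] at hb
    have e2 : ((n : ℝ) + 1) ^ (1 - p) = ((n : ℝ) + 1) ^ (-p) * ((n : ℝ) + 1) := by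
      rw [sub_eq_neg_add, Real.rpow_add hn, Real.rpow_one]
    have e3 : (1 + (1 - p) * -(1 / ((n : ℝ) + 1))) * ((n : ℝ) + 1) ^ (1 - p)
        = ((n : ℝ) + 1) ^ (1 - p) - (1 - p) * ((n : ℝ) + 1) ^ (-p) := by
      rw [e2]; field_simp; ring
    rw [e3] at hb
    rw [le_div_iff₀ h1p] at ih ⊢
    push_cast
    linarith

variable {g : ℕ → ℝ}

lemma tendsto_zero_of_isBigO_rpow {θ : ℝ} (hθ : 0 < θ)
    (hO : g =O[atTop] fun k : ℕ => ((k : ℝ) + 1) ^ (-θ)) : Tendsto g atTop (𝓝 0) := by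
  refine hO.trans_tendsto ?_
  exact (tendsto_rpow_neg_atTop hθ).comp
    (tendsto_atTop_add_const_right _ _ tendsto_natCast_atTop_atTop)

lemma tendsto_sum_atTop_of_isBigO (hg : ∀ k, 0 < g k) {θ : ℝ} (hθ : θ ≤ 1)
    (hO : (fun k : ℕ => ((k : ℝ) + 1) ^ (-θ)) =O[atTop] g) :
    Tendsto (fun n => ∑ k ∈ Finset.range n, g k) atTop atTop := by
  rw [← not_summable_iff_tendsto_nat_atTop_of_nonneg fun k => (hg k).le]
  intro hs
  have h1 : Summable fun k : ℕ => ((k : ℝ) + 1) ^ (-θ) := summable_of_isBigO_nat hs hO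
  have h2 : Summable fun k : ℕ => 1 / ((k : ℝ) + 1) := by
    refine Summable.of_nonneg_of_le (fun k => by positivity) (fun k => ?_) h1
    rw [one_div, ← Real.rpow_neg_one]
    exact Real.rpow_le_rpow_of_exponent_le (by linarith [k.cast_nonneg (α := ℝ)]) (by linarith)
  have h3 := (summable_nat_add_iff (f := fun k : ℕ => 1 / (k : ℝ)) 1).1 (by simpa using h2)
  exact Real.not_summable_one_div_natCast h3

/-- The condition `θ > 1 / (2 + β)` enters here: it says that `γ_n^{1+β} Γ_n → 0`. -/
lemma tendsto_rpow_mul_sum_zero (hg : ∀ k, 0 < g k) {β θ : ℝ} (hβ : 0 < β)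
    (hθ : 1 / (2 + β) < θ) (hθ1 : θ ≤ 1)
    (hO : g =O[atTop] fun k : ℕ => ((k : ℝ) + 1) ^ (-θ)) :
    Tendsto (fun n => g n ^ (1 + β) * ∑ k ∈ Finset.range (n + 1), g k) atTop (𝓝 0) := by
  -- lowering the exponent slightly avoids a logarithm when `θ = 1`
  obtain ⟨p, hp1, hp2⟩ := exists_between hθ
  have hp0 : 0 < p := lt_trans (by positivity) hp1
  have hp11 : p < 1 := by linarith
  have hO' : g =O[atTop] fun k : ℕ => ((k : ℝ) + 1) ^ (-p) := by
    refine hO.trans (IsBigO.of_bound 1 (Eventually.of_forall fun k => ?_))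
    rw [one_mul, Real.norm_eq_abs, Real.norm_eq_abs, abs_of_pos (by positivity),
      abs_of_pos (by positivity)]
    exact Real.rpow_le_rpow_of_exponent_le (by linarith [k.cast_nonneg (α := ℝ)]) (by linarith)
  obtain ⟨K, hK, hb⟩ := bound_of_isBigO_nat_atTop hO'
  have hb' : ∀ k, g k ≤ K * ((k : ℝ) + 1) ^ (-p) := fun k => by
    have hk : (0 : ℝ) < ((k : ℝ) + 1) ^ (-p) := by positivity
    have := hb hk.ne'
    rwa [Real.norm_eq_abs, Real.norm_eq_abs, abs_of_pos (hg k), abs_of_pos hk] at this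
  have hlim : Tendsto (fun n : ℕ => K ^ (1 + β) * (K / (1 - p))
      * ((n : ℝ) + 1) ^ (-(p * (2 + β) - 1))) atTop (𝓝 0) := by
    have h1 : 0 < p * (2 + β) - 1 := by
      rw [div_lt_iff₀ (by positivity)] at hp1
      linarith
    have := ((tendsto_rpow_neg_atTop h1).comp (tendsto_atTop_add_const_right atTop (1 : ℝ)
      tendsto_natCast_atTop_atTop)).const_mul (K ^ (1 + β) * (K / (1 - p)))
    simpa using this
  refine squeeze_zero (fun n => ?_) (fun n => ?_) hlim
  · exact mul_nonneg (Real.rpow_nonneg (hg n).le _) (Finset.sum_nonneg fun k _ => (hg k).le)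
  · have hn : (0 : ℝ) < (n : ℝ) + 1 := by positivity
    have h1 : g n ^ (1 + β) ≤ K ^ (1 + β) * ((n : ℝ) + 1) ^ (-p * (1 + β)) := by
      rw [Real.rpow_mul hn.le, ← Real.mul_rpow hK.le (by positivity)]
      exact Real.rpow_le_rpow (hg n).le (hb' n) (by positivity)
    have h2 : ∑ k ∈ Finset.range (n + 1), g k ≤ K / (1 - p) * ((n : ℝ) + 1) ^ (1 - p) := by
      refine (Finset.sum_le_sum fun k _ => hb' k).trans ?_
      rw [← Finset.mul_sum]
      have := mul_le_mul_of_nonneg_left (sum_range_rpow_neg_le hp0.le hp11 (n + 1)) hK.le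
      push_cast at this
      refine this.trans_eq ?_
      ring
    have h3 := mul_le_mul h1 h2 (Finset.sum_nonneg fun k _ => (hg k).le) (by positivity)
    refine h3.trans_eq ?_
    have e : ((n : ℝ) + 1) ^ (-(p * (2 + β) - 1))
        = ((n : ℝ) + 1) ^ (-p * (1 + β)) * ((n : ℝ) + 1) ^ (1 - p) := by
      rw [← Real.rpow_add hn]; congr 1; ring
    rw [e]
    ring

lemma isLittleO_sum_sqrt_pow_three (hg : ∀ k, 0 < g k) (h0 : Tendsto g atTop (𝓝 0))
    (hinf : Tendsto (fun n => ∑ k ∈ Finset.range n, g k) atTop atTop) :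
    (fun n => ∑ k ∈ Finset.range n, Real.sqrt (g k) ^ 3)
      =o[atTop] fun n => ∑ k ∈ Finset.range n, g k := by
  refine IsLittleO.sum_range ?_ (fun k => (hg k).le) hinf
  have h1 : Tendsto (fun k => Real.sqrt (g k)) atTop (𝓝 0) := by
    simpa [Function.comp_def] using (Real.continuous_sqrt.tendsto 0).comp h0
  have h2 : (fun k => Real.sqrt (g k)) =o[atTop] fun _ => (1 : ℝ) :=
    (isLittleO_one_iff ℝ).2 h1
  have h3 := (isBigO_refl g atTop).mul_isLittleO h2
  simp only [mul_one] at h3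
  refine h3.congr_left fun k => ?_
  calc g k * Real.sqrt (g k) = Real.sqrt (g k) ^ 2 * Real.sqrt (g k) := by
        rw [Real.sq_sqrt (hg k).le]
    _ = _ := by ring

/-- The bias `∑ γ_k^{(3+β)/2}` is negligible with respect to `√Γ_n`. Comparison with the
increments of `√Γ_n`, which are at least `γ_n / (2 √Γ_n)`. -/
lemma isLittleO_sum_sqrt_rpow (hg : ∀ k, 0 < g k) {β : ℝ}
    (h : Tendsto (fun n => g n ^ (1 + β) * ∑ k ∈ Finset.range (n + 1), g k) atTop (𝓝 0))
    (hinf : Tendsto (fun n => ∑ k ∈ Finset.range n, g k) atTop atTop) :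
    (fun n => ∑ k ∈ Finset.range n, Real.sqrt (g k) ^ β * Real.sqrt (g k) ^ 3)
      =o[atTop] fun n => Real.sqrt (∑ k ∈ Finset.range n, g k) := by
  set Γ : ℕ → ℝ := fun n => ∑ k ∈ Finset.range n, g k with hΓ
  have hΓ0 : ∀ n, 0 ≤ Γ n := fun n => Finset.sum_nonneg fun k _ => (hg k).le
  have hΓs : ∀ n, Γ (n + 1) = Γ n + g n := fun n => Finset.sum_range_succ _ _
  set u : ℕ → ℝ := fun n => Real.sqrt (Γ (n + 1)) - Real.sqrt (Γ n) with hu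
  have hu0 : ∀ n, 0 ≤ u n := fun n =>
    sub_nonneg.2 (Real.sqrt_le_sqrt (by rw [hΓs]; linarith [hg n]))
  have husum : ∀ n, ∑ k ∈ Finset.range n, u k = Real.sqrt (Γ n) := fun n => by
    rw [hu, Finset.sum_range_sub (fun k => Real.sqrt (Γ k))]
    simp [hΓ]
  have hulow : ∀ n, g n ≤ 2 * Real.sqrt (Γ (n + 1)) * u n := fun n => by
    have h1 := Real.sq_sqrt (hΓ0 n)
    have h2 := Real.sq_sqrt (hΓ0 (n + 1))
    have h3 : g n = Real.sqrt (Γ (n + 1)) ^ 2 - Real.sqrt (Γ n) ^ 2 := by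
      rw [h1, h2, hΓs]; ring
    have h4 := mul_nonneg (hu0 n) (hu0 n)
    simp only [hu] at h4 ⊢
    nlinarith
  have hmain : (fun k => Real.sqrt (g k) ^ β * Real.sqrt (g k) ^ 3) =o[atTop] u := by
    have hs : Tendsto (fun n => 2 * Real.sqrt (g n ^ (1 + β) * Γ (n + 1))) atTop (𝓝 0) := by
      have := ((Real.continuous_sqrt.tendsto 0).comp h).const_mul 2
      simpa [Function.comp_def] using this
    refine IsBigO.trans_isLittleO (g := fun n => 2 * Real.sqrt (g n ^ (1 + β) * Γ (n + 1)) * u n)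
      (IsBigO.of_bound 1 (Eventually.of_forall fun n => ?_)) ?_
    · rw [one_mul, Real.norm_eq_abs, Real.norm_eq_abs, abs_of_nonneg (by positivity),
        abs_of_nonneg (mul_nonneg (by positivity) (hu0 n))]
      have e1 : Real.sqrt (g n ^ (1 + β) * Γ (n + 1))
          = Real.sqrt (g n) ^ β * Real.sqrt (g n) * Real.sqrt (Γ (n + 1)) := by
        rw [Real.sqrt_mul (Real.rpow_nonneg (hg n).le _), add_comm, Real.rpow_add (hg n),
          Real.rpow_one, Real.sqrt_mul (Real.rpow_nonneg (hg n).le _), Real.sqrt_eq_rpow,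
          Real.sqrt_eq_rpow, ← Real.rpow_mul (hg n).le, ← Real.rpow_mul (hg n).le, mul_comm β]
      rw [e1]
      have h2 := mul_le_mul_of_nonneg_left (hulow n)
        (by positivity : 0 ≤ Real.sqrt (g n) ^ β * Real.sqrt (g n))
      calc Real.sqrt (g n) ^ β * Real.sqrt (g n) ^ 3
          = Real.sqrt (g n) ^ β * Real.sqrt (g n) * (Real.sqrt (g n) ^ 2) := by ring
        _ = Real.sqrt (g n) ^ β * Real.sqrt (g n) * g n := by rw [Real.sq_sqrt (hg n).le]
        _ ≤ _ := h2
        _ = _ := by ring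
    · have := ((isLittleO_one_iff ℝ).2 hs).mul_isBigO (isBigO_refl u atTop)
      simpa only [one_mul] using this
  have hlim : Tendsto (fun n => ∑ k ∈ Finset.range n, u k) atTop atTop := by
    simp_rw [husum]
    exact Real.tendsto_sqrt_atTop.comp hinf
  have := hmain.sum_range hu0 hlim
  simp_rw [husum] at this
  exact this

lemma isLittleO_two_add_sum_sq (hg : ∀ k, 0 < g k) {β : ℝ} (hβ1 : β ≤ 1)
    (h0 : Tendsto g atTop (𝓝 0))
    (h : Tendsto (fun n => g n ^ (1 + β) * ∑ k ∈ Finset.range (n + 1), g k) atTop (𝓝 0))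
    (hinf : Tendsto (fun n => ∑ k ∈ Finset.range n, g k) atTop atTop) :
    (fun n => 2 + ∑ k ∈ Finset.range (n + 1), g k ^ 2)
      =o[atTop] fun n => Real.sqrt (∑ k ∈ Finset.range n, g k) := by
  have hs := Real.tendsto_sqrt_atTop.comp hinf
  have hbdd : ∀ f : ℕ → ℝ, f =O[atTop] (fun _ => (1 : ℝ)) →
      f =o[atTop] fun n => Real.sqrt (∑ k ∈ Finset.range n, g k) := fun f hf =>
    hf.trans_isLittleO ((isLittleO_const_left.2 (Or.inr (tendsto_norm_atTop_atTop.comp hs))))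
  have hR := isLittleO_sum_sqrt_rpow hg h hinf
  have h1 : ∀ᶠ k in atTop, g k ≤ 1 := h0.eventually_le_const one_pos
  obtain ⟨N, hN⟩ := eventually_atTop.1 h1
  have hterm : ∀ k, N ≤ k → g k ^ 2 ≤ Real.sqrt (g k) ^ β * Real.sqrt (g k) ^ 3 := fun k hk => by
    have hs0 := Real.sqrt_pos.2 (hg k)
    have hs1 : Real.sqrt (g k) ≤ 1 := Real.sqrt_le_one.2 (hN k hk)
    have h2 : Real.sqrt (g k) ≤ Real.sqrt (g k) ^ β := by
      simpa using Real.rpow_le_rpow_of_exponent_ge hs0 hs1 hβ1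
    calc g k ^ 2 = (Real.sqrt (g k) ^ 2) ^ 2 := by rw [Real.sq_sqrt (hg k).le]
      _ = Real.sqrt (g k) * Real.sqrt (g k) ^ 3 := by ring
      _ ≤ _ := by gcongr
  have hsq : (fun n => ∑ k ∈ Finset.range n, g k ^ 2)
      =o[atTop] fun n => Real.sqrt (∑ k ∈ Finset.range n, g k) := by
    have hD : ∀ n, N ≤ n → ∑ k ∈ Finset.range n, g k ^ 2 ≤ ∑ k ∈ Finset.range N, g k ^ 2
        + ∑ k ∈ Finset.range n, Real.sqrt (g k) ^ β * Real.sqrt (g k) ^ 3 := fun n hn => by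
      have e1 := Finset.sum_range_add_sum_Ico (fun k => g k ^ 2) hn
      have e2 := Finset.sum_range_add_sum_Ico
        (fun k => Real.sqrt (g k) ^ β * Real.sqrt (g k) ^ 3) hn
      have h3 : ∑ k ∈ Finset.Ico N n, g k ^ 2
          ≤ ∑ k ∈ Finset.Ico N n, Real.sqrt (g k) ^ β * Real.sqrt (g k) ^ 3 :=
        Finset.sum_le_sum fun k hk => hterm k (Finset.mem_Ico.1 hk).1
      have h4 : 0 ≤ ∑ k ∈ Finset.range N, Real.sqrt (g k) ^ β * Real.sqrt (g k) ^ 3 :=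
        Finset.sum_nonneg fun k _ => by positivity
      linarith
    refine IsBigO.trans_isLittleO ?_ ((hbdd (fun _ => ∑ k ∈ Finset.range N, g k ^ 2)
      (isBigO_const_const _ one_ne_zero _)).add hR)
    refine IsBigO.of_bound 1 ((eventually_ge_atTop N).mono fun n hn => ?_)
    rw [one_mul, Real.norm_eq_abs, abs_of_nonneg (Finset.sum_nonneg fun k _ => sq_nonneg _)]
    exact (hD n hn).trans (le_abs_self _)
  have hg2 : (fun n => 2 + g n ^ 2) =O[atTop] fun _ => (1 : ℝ) :=
    (tendsto_const_nhds.add (h0.pow 2)).isBigO_one ℝ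
  refine ((hbdd _ hg2).add hsq).congr_left fun n => ?_
  rw [Finset.sum_range_succ]
  ring

end Steps

/-! ### Absorption of the error terms -/

section Assembly

/-- Deterministic part of the estimate of exponential moments: the error terms are absorbed in
arbitrarily small relative perturbations, for `n` large and `l` small. Here `Γ` is the total time,
`R` the bias, `Q` and `m` the other error sums. -/
lemma exists_uniform_exponent_bound {Γ R Q m : ℕ → ℝ} {v C δ : ℝ} (hC : 0 ≤ C)
    (hδ : 0 < δ) (hΓ : ∀ n, 0 ≤ Γ n)
    (hm0 : ∀ n, 0 ≤ m n) (hR : R =o[atTop] fun n => Real.sqrt (Γ n)) (hQ : Q =o[atTop] Γ)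
    (hm : m =o[atTop] fun n => Real.sqrt (Γ n)) :
    ∃ ε, 0 < ε ∧ ε < 1 ∧ ∃ η, 0 < η ∧ ∀ᶠ n in atTop, ∀ l, 0 ≤ l → l ≤ η →
      Real.exp ((1 - ε) * (l ^ 2 * v / 2 * Γ n + C * (l * R n + l ^ 2 * Q n + l ^ 3 * Γ n)))
          * (1 + ε * Real.exp (C * (1 + (l / ε * m n) ^ 2)))
        ≤ (1 + δ) * Real.exp (((1 - ε) * l) ^ 2 * Γ n * (v / 2 + δ)) := by
  -- `ε` makes the loss in the exponent and the constant factor small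
  have hε : ∀ᶠ ε in 𝓝[>] (0 : ℝ), ε * Real.exp C < δ / 2 ∧ v * ε < δ / 2 ∧ ε < 1 / 2 := by
    have t1 : Tendsto (fun ε : ℝ => ε * Real.exp C) (𝓝[>] 0) (𝓝 0) := by
      have : Continuous fun ε : ℝ => ε * Real.exp C := by fun_prop
      simpa using (this.tendsto 0).mono_left nhdsWithin_le_nhds
    have t2 : Tendsto (fun ε : ℝ => v * ε) (𝓝[>] 0) (𝓝 0) := by
      have : Continuous fun ε : ℝ => v * ε := by fun_prop
      simpa using (this.tendsto 0).mono_left nhdsWithin_le_nhds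
    have t3 : Tendsto (fun ε : ℝ => ε) (𝓝[>] 0) (𝓝 0) := tendsto_id.mono_left nhdsWithin_le_nhds
    exact (t1.eventually_lt_const (by positivity)).and
      ((t2.eventually_lt_const (by positivity)).and (t3.eventually_lt_const (by norm_num)))
  obtain ⟨ε, ⟨hε1, hε2, hε3⟩, hε0 : 0 < ε⟩ := (hε.and self_mem_nhdsWithin).exists
  -- then `η` makes the remaining error terms small
  have hη : ∀ᶠ η in 𝓝[>] (0 : ℝ), Real.exp (3 * C * η) * (1 + δ / 2) < 1 + δ
      ∧ 4 * (3 * C * η + C * (η / ε) ^ 2) < δ / 2 := by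
    have t1 : Tendsto (fun η : ℝ => Real.exp (3 * C * η) * (1 + δ / 2)) (𝓝[>] 0)
        (𝓝 (1 + δ / 2)) := by
      have : Continuous fun η : ℝ => Real.exp (3 * C * η) * (1 + δ / 2) := by fun_prop
      simpa using (this.tendsto 0).mono_left nhdsWithin_le_nhds
    have t2 : Tendsto (fun η : ℝ => 4 * (3 * C * η + C * (η / ε) ^ 2)) (𝓝[>] 0) (𝓝 0) := by
      have : Continuous fun η : ℝ => 4 * (3 * C * η + C * (η / ε) ^ 2) := by fun_prop
      simpa using (this.tendsto 0).mono_left nhdsWithin_le_nhds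
    exact (t1.eventually_lt_const (by linarith)).and (t2.eventually_lt_const (by positivity))
  obtain ⟨η, ⟨hη1, hη2⟩, hη0 : 0 < η⟩ := (hη.and self_mem_nhdsWithin).exists
  refine ⟨ε, hε0, by linarith, η, hη0, ?_⟩
  filter_upwards [hR.bound hη0, hQ.bound hη0, hm.bound hη0] with n bR bQ bm l hl hlη
  rw [Real.norm_eq_abs, Real.norm_eq_abs, abs_of_nonneg (Real.sqrt_nonneg _)] at bR bm
  rw [Real.norm_eq_abs, Real.norm_eq_abs, abs_of_nonneg (hΓ n)] at bQ
  have bR' := (le_abs_self _).trans bR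
  have bQ' := (le_abs_self _).trans bQ
  have bm' := (le_abs_self _).trans bm
  obtain ⟨s, hs⟩ : ∃ s, s = Real.sqrt (Γ n) := ⟨_, rfl⟩
  have hs0 : 0 ≤ s := hs ▸ Real.sqrt_nonneg _
  have hs2 : s ^ 2 = Γ n := by rw [hs]; exact Real.sq_sqrt (hΓ n)
  rw [← hs] at bR' bm'
  rw [← hs2] at bQ' ⊢
  set x := l ^ 2 * s ^ 2 with hx
  have hx0 : 0 ≤ x := by positivity
  have e1 : l * R n ≤ η * (1 + x) := by
    have h1 := mul_le_mul_of_nonneg_left bR' hl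
    have h2 : l * s ≤ 1 + x := by nlinarith [sq_nonneg (l * s - 1), sq_nonneg (l * s)]
    have h3 := mul_le_mul_of_nonneg_left h2 hη0.le
    linarith
  have e2 : l ^ 2 * Q n ≤ η * x := by
    have h1 := mul_le_mul_of_nonneg_left bQ' (sq_nonneg l)
    linarith
  have e3 : l ^ 3 * s ^ 2 ≤ η * x := by
    have h1 := mul_le_mul_of_nonneg_right hlη hx0
    linarith
  have e4 : (l / ε * m n) ^ 2 ≤ (η / ε) ^ 2 * x := by
    have h1 : l / ε * m n ≤ l / ε * (η * s) := by gcongr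
    have h2 : 0 ≤ l / ε * m n := mul_nonneg (by positivity) (hm0 n)
    calc _ ≤ (l / ε * (η * s)) ^ 2 := by gcongr
      _ = _ := by rw [hx]; ring
  have f1 : C * (l * R n + l ^ 2 * Q n + l ^ 3 * s ^ 2) ≤ 3 * C * η * (1 + x) := by
    have h1 := mul_le_mul_of_nonneg_left (add_le_add (add_le_add e1 e2) e3) hC
    have h2 : 0 ≤ C * η := by positivity
    linarith
  have f2 : C * (1 + (l / ε * m n) ^ 2) ≤ C + C * (η / ε) ^ 2 * x := by
    have := mul_le_mul_of_nonneg_left e4 hC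
    linarith
  have f3 : 1 + ε * Real.exp (C * (1 + (l / ε * m n) ^ 2))
      ≤ (1 + δ / 2) * Real.exp (C * (η / ε) ^ 2 * x) := by
    have h1 : Real.exp (C * (1 + (l / ε * m n) ^ 2))
        ≤ Real.exp C * Real.exp (C * (η / ε) ^ 2 * x) := by
      rw [← Real.exp_add]; exact Real.exp_le_exp.2 f2
    have h2 : 1 ≤ Real.exp (C * (η / ε) ^ 2 * x) := Real.one_le_exp (by positivity)
    have h3 := mul_le_mul_of_nonneg_left h1 hε0.le
    have h4 := mul_le_mul_of_nonneg_right hε1.le (by positivity :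
      0 ≤ Real.exp (C * (η / ε) ^ 2 * x))
    linarith
  have f4 : (1 - ε) * (l ^ 2 * v / 2 * s ^ 2 + C * (l * R n + l ^ 2 * Q n + l ^ 3 * s ^ 2))
      ≤ (1 - ε) * (v / 2) * x + 3 * C * η * (1 + x) := by
    have h1 := mul_le_mul_of_nonneg_left f1 (by linarith : 0 ≤ 1 - ε)
    have h2 : 0 ≤ ε * (3 * C * η * (1 + x)) := by positivity
    rw [hx] at *
    linarith
  calc _ ≤ Real.exp ((1 - ε) * (v / 2) * x + 3 * C * η * (1 + x))
        * ((1 + δ / 2) * Real.exp (C * (η / ε) ^ 2 * x)) := by gcongr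
    _ = (Real.exp (3 * C * η) * (1 + δ / 2))
        * Real.exp ((1 - ε) * (v / 2) * x + 3 * C * η * x + C * (η / ε) ^ 2 * x) := by
        have h1 : (1 - ε) * (v / 2) * x + 3 * C * η * (1 + x)
            = 3 * C * η + ((1 - ε) * (v / 2) * x + 3 * C * η * x) := by ring
        rw [h1, Real.exp_add (3 * C * η), Real.exp_add _ (C * (η / ε) ^ 2 * x)]
        ring
    _ ≤ (1 + δ) * Real.exp (((1 - ε) * l) ^ 2 * s ^ 2 * (v / 2 + δ)) := by
        have h1 : (1 - ε) * (v / 2) * x + 3 * C * η * x + C * (η / ε) ^ 2 * x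
            ≤ ((1 - ε) * l) ^ 2 * s ^ 2 * (v / 2 + δ) := by
          have e : ((1 - ε) * l) ^ 2 * s ^ 2 * (v / 2 + δ) = (1 - ε) ^ 2 * (v / 2 + δ) * x := by
            rw [hx]; ring
          rw [e, ← add_mul, ← add_mul]
          refine mul_le_mul_of_nonneg_right ?_ hx0
          have h2 := mul_le_mul_of_nonneg_left hε2.le (by linarith : 0 ≤ 1 - ε)
          have h3 : 0 ≤ (1 - ε) * δ * (1 / 2 - ε) :=
            mul_nonneg (mul_nonneg (by linarith) hδ.le) (by linarith)
          have h4 : 0 ≤ δ * (1 / 2 - ε) := mul_nonneg hδ.le (by linarith)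
          linarith
        gcongr

/-- Diagonal extraction of a strictly decreasing rate. -/
lemma exists_strictAnti_of_eventually {p : ℕ → ℝ → Prop}
    (hmono : ∀ n e e', 0 < e → e ≤ e' → p n e → p n e') (h : ∀ e, 0 < e → ∀ᶠ n in atTop, p n e) :
    ∃ e : ℕ → ℝ, StrictAnti e ∧ (∀ n, 0 < e n) ∧ Tendsto e atTop (𝓝 0) ∧
      ∀ᶠ n in atTop, p n (e n) := by
  have h' : ∀ k : ℕ, ∃ N, ∀ n, N ≤ n → p n (1 / ((k : ℝ) + 1)) := fun k =>
    eventually_atTop.1 (h _ (by positivity))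
  choose N hN using h'
  set K : ℕ → ℕ := fun n => Nat.findGreatest (fun k => N k ≤ n) n with hK
  have hKmono : Monotone K := fun n n' hnn =>
    Nat.findGreatest_mono (fun k hk => le_trans hk hnn) hnn
  have hKtop : Tendsto K atTop atTop := by
    refine tendsto_atTop.2 fun k => ?_
    filter_upwards [eventually_ge_atTop (max k (N k))] with n hn
    exact Nat.le_findGreatest ((le_max_left _ _).trans hn) ((le_max_right _ _).trans hn)
  refine ⟨fun n => 1 / ((K n : ℝ) + 1) + 1 / ((n : ℝ) + 1), ?_, fun n => by positivity, ?_, ?_⟩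
  · intro n n' hnn
    have h1 : (K n : ℝ) ≤ K n' := by exact_mod_cast hKmono hnn.le
    have h2 : (n : ℝ) < n' := by exact_mod_cast hnn
    have h3 : 1 / ((K n' : ℝ) + 1) ≤ 1 / ((K n : ℝ) + 1) := by gcongr
    have h4 : 1 / ((n' : ℝ) + 1) < 1 / ((n : ℝ) + 1) := by gcongr
    simp only
    linarith
  · have := (tendsto_one_div_add_atTop_nhds_zero_nat.comp hKtop).add
      (tendsto_one_div_add_atTop_nhds_zero_nat (𝕜 := ℝ))
    simpa [Function.comp_def] using this
  · filter_upwards [eventually_ge_atTop (N 0)] with n hn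
    have h1 : N (K n) ≤ n := Nat.findGreatest_spec (P := fun k => N k ≤ n) (Nat.zero_le n) hn
    refine hmono n _ _ (by positivity) ?_ (hN (K n) n h1)
    have : 0 < 1 / ((n : ℝ) + 1) := by positivity
    linarith

end Assembly

/-! ### Deviation inequalities -/

section Deviation

variable {d r : ℕ} {b : EuclideanSpace ℝ (Fin d) → EuclideanSpace ℝ (Fin d)}
  {σ : EuclideanSpace ℝ (Fin d) → EuclideanSpace ℝ (Fin r) →L[ℝ] EuclideanSpace ℝ (Fin d)}
  {V : EuclideanSpace ℝ (Fin d) → ℝ}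

lemma carreDuChamp_neg (f : EuclideanSpace ℝ (Fin d) → ℝ) (x : EuclideanSpace ℝ (Fin d)) :
    carreDuChamp σ (-f) x = carreDuChamp σ f x := by
  have h : gradient (-f) x = -gradient f x := by rw [gradient, fderiv_neg, map_neg, gradient]
  rw [carreDuChamp, carreDuChamp, h, map_neg, norm_neg]

lemma generator_neg (f : EuclideanSpace ℝ (Fin d) → ℝ) (x : EuclideanSpace ℝ (Fin d)) :
    generator b σ (-f) x = -generator b σ f x := by
  have h : gradient (-f) x = -gradient f x := by rw [gradient, fderiv_neg, map_neg, gradient]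
  have h2 : ∀ w, hess (-f) x w w = -hess f x w w := fun w => by
    rw [hess, hess, iteratedFDeriv_neg_apply]; rfl
  simp only [generator, h, h2, inner_neg_right, Finset.sum_neg_distrib]
  ring

lemma TestCondition.neg {β : ℝ} {f : EuclideanSpace ℝ (Fin d) → ℝ} (hf : TestCondition b V β f) :
    TestCondition b V β (-f) := by
  have h : ∀ x, gradient (-f) x = -gradient f x := fun x => by
    rw [gradient, fderiv_neg, map_neg, gradient]
  refine ⟨⟨hf.smooth.contDiff.neg, fun i hi hi' => ?_, ?_⟩, ?_, ?_⟩
  · obtain ⟨K, hK⟩ := hf.smooth.bounded i hi hi'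
    exact ⟨K, fun x => by rw [iteratedFDeriv_neg_apply, norm_neg]; exact hK x⟩
  · obtain ⟨K, hK⟩ := hf.smooth.holder
    refine ⟨K, fun x y => ?_⟩
    rw [iteratedFDeriv_neg_apply, iteratedFDeriv_neg_apply, neg_sub_neg, norm_sub_rev]
    exact hK x y
  · obtain ⟨K, hK⟩ := hf.lipschitz
    refine ⟨K, ?_⟩
    simp only [h, inner_neg_right]
    exact hK.neg
  · obtain ⟨K, hK, hK'⟩ := hf.growth
    exact ⟨K, hK, fun x => by rw [Pi.neg_apply, abs_neg]; exact hK' x⟩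

lemma totalTime_eq_sum_range (γ : ℕ → ℝ) (n : ℕ) :
    totalTime γ n = ∑ k ∈ Finset.range n, γ (k + 1) := by
  rw [totalTime, Finset.range_eq_Ico, Finset.sum_Ico_add' (fun k => γ k) 0 n 1]
  rfl

lemma integral_empirical {γ : ℕ → ℝ} (hγ : ∀ k, 1 ≤ k → 0 < γ k)
    (X : ℕ → EuclideanSpace ℝ (Fin d)) (n : ℕ) (f : EuclideanSpace ℝ (Fin d) → ℝ) :
    ∫ x, f x ∂(empirical γ X n)
      = (totalTime γ n)⁻¹ * ∑ k ∈ Finset.range n, γ (k + 1) * f (X k) := by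
  have h0 : 0 ≤ totalTime γ n := Finset.sum_nonneg fun k hk => (hγ k (Finset.mem_Icc.1 hk).1).le
  rw [empirical, integral_smul_measure, integral_finsetSum_measure, ENNReal.toReal_ofReal
    (inv_nonneg.2 h0), smul_eq_mul, Finset.range_eq_Ico]
  · have e := Finset.sum_Ico_add' (fun k => γ k * f (X (k - 1))) 0 n 1
    simp only [Nat.add_sub_cancel] at e
    rw [e]
    congr 1
    refine Finset.sum_congr rfl fun k hk => ?_
    rw [integral_smul_measure, integral_dirac, smul_eq_mul,
      ENNReal.toReal_ofReal (hγ k (Finset.mem_Icc.1 hk).1).le]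
  · intro k _
    exact (integrable_dirac (by simp)).smul_measure ENNReal.ofReal_ne_top

/-- Chernoff's bound, for a variable whose exponential moments are those of a Gaussian variable of
variance `Γ v`, up to `δ`. The optimal parameter is `l = a / (v √Γ)`. -/
lemma measureReal_tail_le_of_exp_moment {Ω : Type*} [MeasurableSpace Ω] {P : Measure Ω}
    {S : Ω → ℝ} (hS : Measurable S) {Γ v δ e a : ℝ} (hΓ : 0 < Γ)
    (hv : 0 < v) (he : 0 < e) (hδe : δ ≤ e) (hδv : 2 * δ ≤ v * e) (ha : 0 < a)
    (h : ∫⁻ ω, ENNReal.ofReal (Real.exp (a / (v * Real.sqrt Γ) * S ω)) ∂P ≤ ENNReal.ofReal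
      ((1 + δ) * Real.exp ((a / (v * Real.sqrt Γ)) ^ 2 * Γ * (v / 2 + δ)))) :
    P.real {ω | a * Real.sqrt Γ ≤ S ω} ≤ (1 + e) * Real.exp (-((1 - e) * (a ^ 2 / (2 * v)))) := by
  set l := a / (v * Real.sqrt Γ) with hl
  have hs := Real.sqrt_pos.2 hΓ
  have hl0 : 0 < l := by positivity
  have hle : P {ω | a * Real.sqrt Γ ≤ S ω} ≤ ∫⁻ ω,
      ENNReal.ofReal (Real.exp (-(l * (a * Real.sqrt Γ))))
        * ENNReal.ofReal (Real.exp (l * S ω)) ∂P := by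
    refine meas_le_lintegral₀
      (((hS.const_mul l).exp.ennreal_ofReal).const_mul _).aemeasurable fun ω hω => ?_
    rw [← ENNReal.ofReal_mul (Real.exp_pos _).le, ← Real.exp_add, ENNReal.one_le_ofReal]
    refine Real.one_le_exp ?_
    have := mul_le_mul_of_nonneg_left (Set.mem_ofPred.1 hω) hl0.le
    linarith
  rw [lintegral_const_mul' _ _ ENNReal.ofReal_ne_top] at hle
  have h2 := hle.trans (mul_le_mul_right h _)
  rw [← ENNReal.ofReal_mul (Real.exp_pos _).le] at h2
  have h3 : Real.exp (-(l * (a * Real.sqrt Γ))) * ((1 + δ) * Real.exp (l ^ 2 * Γ * (v / 2 + δ)))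
      ≤ (1 + e) * Real.exp (-((1 - e) * (a ^ 2 / (2 * v)))) := by
    rw [mul_left_comm, ← Real.exp_add]
    have e1 : l * (a * Real.sqrt Γ) = a ^ 2 / v := by
      rw [hl]; field_simp
    have e2 : l ^ 2 * Γ = a ^ 2 / v ^ 2 := by
      rw [hl, div_pow, mul_pow, Real.sq_sqrt hΓ.le]; field_simp
    have e3 : -(a ^ 2 / v) + a ^ 2 / v ^ 2 * (v / 2 + δ) ≤ -((1 - e) * (a ^ 2 / (2 * v))) := by
      have e4 : -((1 - e) * (a ^ 2 / (2 * v))) - (-(a ^ 2 / v) + a ^ 2 / v ^ 2 * (v / 2 + δ))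
          = a ^ 2 / (2 * v ^ 2) * (v * e - 2 * δ) := by field_simp; ring
      have e5 : 0 ≤ a ^ 2 / (2 * v ^ 2) * (v * e - 2 * δ) :=
        mul_nonneg (by positivity) (by linarith)
      linarith
    rw [e1, e2]
    gcongr
  exact ENNReal.toReal_le_of_le_ofReal (by positivity)
    (h2.trans (ENNReal.ofReal_le_ofReal h3))

variable {μ : Measure (EuclideanSpace ℝ (Fin r))} {γ : ℕ → ℝ}
  {Ω : Type*} [MeasurableSpace Ω] {P : Measure Ω} [IsProbabilityMeasure P]
  {X₀ : Ω → EuclideanSpace ℝ (Fin d)} {U : ℕ → Ω → EuclideanSpace ℝ (Fin r)} {CV αV βV : ℝ}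

/-- One-sided Gaussian deviations with asymptotically sharp constants. -/
lemma eventually_upper_tail_le (hμ : InnovationLaw μ) (hV : LyapunovCondition b σ V CV αV βV)
    (hb : ∃ K : ℝ≥0, LipschitzWith K b) (hσc : Continuous σ) {β : ℝ} (hβ : β ∈ Set.Ioc (0 : ℝ) 1)
    {s : ℝ} (hs : 0 ≤ s) (hσ : ∀ x, ‖σ x‖ ≤ s) (hγ_pos : ∀ k, 1 ≤ k → 0 < γ k) {G : ℝ}
    (hG : 0 < G)
    (hγ : ∀ k, 1 ≤ k → γ k ≤ G ∧ 2 * CV * (⨆ x, hessNorm V x) * γ k ≤ αV)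
    {θ : ℝ} (hγθ : γ =Θ[atTop] fun n : ℕ => (n : ℝ) ^ (-θ)) (hθ : θ ∈ Set.Ioc (1 / (2 + β)) 1)
    (hX₀ : Measurable X₀) (hC1 : SubGaussianInit P X₀)
    (hU : ∀ k, 1 ≤ k → Measurable (U k)) (hU_law : ∀ k, 1 ≤ k → P.map (U k) = μ)
    (hU_indep : iIndepFun (fun k : ℕ => U (k + 1)) P)
    (hU_X₀ : IndepFun X₀ (fun ω (k : ℕ) => U (k + 1) ω) P)
    {φ ϑ : EuclideanSpace ℝ (Fin d) → ℝ} (hφ : TestCondition b V β φ) (hϑ : TestCondition b V β ϑ)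
    {v : ℝ} (hv : 0 < v) (hPoisson : ∀ x, generator b σ ϑ x = carreDuChamp σ φ x - v)
    {A : ℕ → ℝ} (hA : Tendsto (fun n => A n / Real.sqrt (totalTime γ n)) atTop (𝓝 0))
    {e : ℝ} (he : 0 < e) :
    ∀ᶠ n in atTop, ∀ a, 0 < a → a ≤ A n →
      P.real {ω | a * Real.sqrt (totalTime γ n) ≤ ∑ k ∈ Finset.range n,
          γ (k + 1) * generator b σ φ (euler b σ γ X₀ U k ω)}
        ≤ (1 + e) * Real.exp (-((1 - e) * (a ^ 2 / (2 * v)))) := by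
  obtain ⟨C, hC, hmom⟩ := exists_exp_moment_generator_sum_le hμ hV hb hσc hβ.1.le hβ.2 hs hσ hG
    (fun k hk => ⟨(hγ_pos k hk).le, hγ k hk⟩) hX₀ hC1 hU hU_law hU_indep hU_X₀ hφ hϑ hPoisson
  -- the four sums of steps
  have hg : ∀ k, 0 < γ (k + 1) := fun k => hγ_pos _ (by omega)
  have hθ0 : 0 < θ := lt_trans (by have := hβ.1; positivity) hθ.1
  have hshift : (fun k : ℕ => γ (k + 1)) =Θ[atTop] fun k : ℕ => ((k : ℝ) + 1) ^ (-θ) := by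
    have h1 := hγθ.1.comp_tendsto (tendsto_add_atTop_nat 1)
    have h2 := hγθ.2.comp_tendsto (tendsto_add_atTop_nat 1)
    simp only [Function.comp_def, Nat.cast_add, Nat.cast_one] at h1 h2
    exact ⟨h1, h2⟩
  have h0 := tendsto_zero_of_isBigO_rpow hθ0 hshift.1
  have hinf := tendsto_sum_atTop_of_isBigO hg hθ.2 hshift.2
  have hrat := tendsto_rpow_mul_sum_zero hg hβ.1 hθ.1 hθ.2 hshift.1
  have hR := isLittleO_sum_sqrt_rpow hg hrat hinf
  have hQ := isLittleO_sum_sqrt_pow_three hg h0 hinf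
  have hm := isLittleO_two_add_sum_sq hg hβ.2 h0 hrat hinf
  obtain ⟨δ, hδ0, hδe, hδv⟩ : ∃ δ, 0 < δ ∧ δ ≤ e ∧ 2 * δ ≤ v * e := by
    refine ⟨min e (v * e / 2), by positivity, min_le_left _ _, ?_⟩
    linarith [min_le_right e (v * e / 2)]
  obtain ⟨ε, hε0, hε1, η, hη0, hev⟩ := exists_uniform_exponent_bound (v := v) hC hδ0
    (fun n => Finset.sum_nonneg fun k _ => (hg k).le)
    (fun n => add_nonneg zero_le_two (Finset.sum_nonneg fun k _ => sq_nonneg _)) hR hQ hm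
  have h1ε : 0 < 1 - ε := by linarith
  set η' := (1 - ε) * min η 1 with hη'
  have hη'0 : 0 < η' := by positivity
  have hXm : ∀ k, Measurable (euler b σ γ X₀ U k) := fun k =>
    (measurable_euler_and_indepFun hb.choose_spec.continuous hσc hX₀ hU hU_indep hU_X₀ k).1
  have hφc : ContDiff ℝ 3 φ := by exact_mod_cast hφ.smooth.contDiff
  have hSm : ∀ n, Measurable fun ω => ∑ k ∈ Finset.range n,
      γ (k + 1) * generator b σ φ (euler b σ γ X₀ U k ω) := fun n =>
    Finset.measurable_sum _ fun k _ => ((continuous_generator hφc hb.choose_spec.continuous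
      hσc).measurable.comp (hXm k)).const_mul _
  filter_upwards [hev, hA.eventually_lt_const (show 0 < v * η' by positivity),
    hinf.eventually_gt_atTop 0] with n hn hAn hΓ a ha haA
  rw [totalTime_eq_sum_range] at hAn ⊢
  refine measureReal_tail_le_of_exp_moment (hSm n) hΓ hv he hδe hδv ha ?_
  set Γ := ∑ k ∈ Finset.range n, γ (k + 1) with hΓdef
  have hsΓ := Real.sqrt_pos.2 hΓ
  set l := a / (v * Real.sqrt Γ) with hl
  have hl0 : 0 < l := by positivity
  have hlη : l ≤ η' := by
    rw [hl, div_le_iff₀ (by positivity)]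
    rw [div_lt_iff₀ hsΓ] at hAn
    linarith
  have hl1 : l / (1 - ε) ≤ min η 1 := by
    rw [div_le_iff₀ h1ε, mul_comm]; exact hlη
  have hl' : (1 - ε) * (l / (1 - ε)) = l := by field_simp
  have hfin := (hmom ε hε0 hε1 (l / (1 - ε)) (by positivity) (hl1.trans (min_le_right _ _)) n).trans
    (ENNReal.ofReal_le_ofReal (hn (l / (1 - ε)) (by positivity) (hl1.trans (min_le_left _ _))))
  simp_rw [← mul_assoc, hl'] at hfin
  simp_rw [mul_assoc] at hfin ⊢
  exact hfin

end Deviation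

end DecreasingStep

theorem theorem3p1 {d r : ℕ}
    -- coefficients of the diffusion
    (b : EuclideanSpace ℝ (Fin d) → EuclideanSpace ℝ (Fin d))
    (σ : EuclideanSpace ℝ (Fin d) → EuclideanSpace ℝ (Fin r) →L[ℝ] EuclideanSpace ℝ (Fin d))
    (hb : ∃ K : ℝ≥0, LipschitzWith K b) (hσ : ∃ K : ℝ≥0, LipschitzWith K σ)
    -- (C2), (𝓛_V) and (U)
    (hC2 : ∃ κ : ℝ, 0 < κ ∧ ∀ x, trSigma σ x ≤ κ)
    (V : EuclideanSpace ℝ (Fin d) → ℝ) (CV αV βV : ℝ)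
    (hV : LyapunovCondition b σ V CV αV βV)
    (ν : Measure (EuclideanSpace ℝ (Fin d))) (hν : IsUniqueInvariant b σ ν)
    -- the steps: (S) and `γ_n ≍ n^{-θ}`
    (γ : ℕ → ℝ) (hγ_pos : ∀ k, 1 ≤ k → 0 < γ k) (hS : SmallSteps b V CV αV γ)
    (θ : ℝ) (hγ : γ =Θ[atTop] fun n : ℕ => (n : ℝ) ^ (-θ))
    -- the initial condition and the innovations: (C1) and (GC)
    {Ω : Type*} [MeasurableSpace Ω] (P : Measure Ω) [IsProbabilityMeasure P]
    (X₀ : Ω → EuclideanSpace ℝ (Fin d)) (hX₀ : Measurable X₀) (hC1 : SubGaussianInit P X₀)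
    (μ : Measure (EuclideanSpace ℝ (Fin r))) (hμ : InnovationLaw μ)
    (U : ℕ → Ω → EuclideanSpace ℝ (Fin r)) (hU : ∀ k, 1 ≤ k → Measurable (U k))
    (hU_law : ∀ k, 1 ≤ k → P.map (U k) = μ)
    (hU_indep : iIndepFun (fun k : ℕ => U (k + 1)) P)
    (hU_X₀ : IndepFun X₀ (fun ω (k : ℕ) => U (k + 1) ω) P)
    -- the test function and the Poisson equation with carré du champ source
    (β : ℝ) (hβ : β ∈ Set.Ioc (0 : ℝ) 1)
    (φ : EuclideanSpace ℝ (Fin d) → ℝ) (hφ : TestCondition b V β φ)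
    (ϑ : EuclideanSpace ℝ (Fin d) → ℝ) (hϑ : TestCondition b V β ϑ)
    (hPoisson : ∀ x, generator b σ ϑ x = carreDuChamp σ φ x - ∫ y, carreDuChamp σ φ y ∂ν)
    (hvar : 0 < ∫ y, carreDuChamp σ φ y ∂ν)
    (hθ : θ ∈ Set.Ioc (1 / (2 + β)) 1)
    -- Gaussian deviation regime: `0 < a ≤ A_n`, where `A_n = o(√Γ_n)`
    (A : ℕ → ℝ) (hA : Tendsto (fun n => A n / Real.sqrt (totalTime γ n)) atTop (𝓝 0)) :
    ∃ c C : ℕ → ℝ,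
      (∀ n, 1 ≤ n → 0 ≤ c n ∧ 0 ≤ C n) ∧
      (∃ N, StrictMonoOn c (Set.Ici N) ∧ StrictAntiOn C (Set.Ici N)) ∧
      Tendsto c atTop (𝓝 1) ∧ Tendsto C atTop (𝓝 1) ∧
      ∀ n, 1 ≤ n → ∀ a, 0 < a → a ≤ A n →
        P.real {ω | a ≤ |Real.sqrt (totalTime γ n) *
            ∫ x, generator b σ φ x ∂(empirical γ (fun k => euler b σ γ X₀ U k ω) n)|}
          ≤ 2 * C n *
            Real.exp (-(c n * (a ^ 2 / (2 * ∫ y, carreDuChamp σ φ y ∂ν)))) := by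
  set v := ∫ y, carreDuChamp σ φ y ∂ν with hvdef
  obtain ⟨κ, hκ, htr⟩ := hC2
  have hσc : Continuous σ := hσ.choose_spec.continuous
  have hσb : ∀ x, ‖σ x‖ ≤ Real.sqrt κ := fun x =>
    (opNorm_le_sqrt_sum (σ x)).trans (Real.sqrt_le_sqrt (htr x))
  obtain ⟨c, K, hc, -, -, hstep⟩ := hS
  have hCV := hV.CV_pos
  have hM : 0 ≤ ⨆ x, hessNorm V x := (hessNorm_nonneg V 0).trans (hV.hessNorm_le 0)
  have hγS : ∀ k, 1 ≤ k → γ k ≤ 1 / (2 * Real.sqrt (CV * c)) ∧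
      2 * CV * (⨆ x, hessNorm V x) * γ k ≤ αV := fun k hk => by
    have h1 := hstep k hk
    refine ⟨h1.trans (min_le_left _ _), ?_⟩
    -- if the supremum vanishes, the second bound in `hS` is a division by zero
    rcases hM.eq_or_lt with h0 | hpos
    · rw [← h0, mul_zero, zero_mul]; exact hV.αV_pos.le
    · have h2 := h1.trans (min_le_right _ _)
      rw [le_div_iff₀ (by positivity)] at h2
      linarith
  have hG : 0 < 1 / (2 * Real.sqrt (CV * c)) := by positivity
  have hup := fun (e : ℝ) (he : 0 < e) =>
    eventually_upper_tail_le hμ hV hb hσc hβ (Real.sqrt_nonneg κ) hσb hγ_pos hG hγS hγ hθ hX₀ hC1 hU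
      hU_law hU_indep hU_X₀ hφ hϑ hvar hPoisson hA he
  have hlow := fun (e : ℝ) (he : 0 < e) =>
    eventually_upper_tail_le hμ hV hb hσc hβ (Real.sqrt_nonneg κ) hσb hγ_pos hG hγS hγ hθ hX₀ hC1 hU
      hU_law hU_indep hU_X₀ hφ.neg hϑ hvar
      (fun x => by rw [carreDuChamp_neg]; exact hPoisson x) hA he
  set p : ℕ → ℝ → Prop := fun n e => ∀ a, 0 < a → a ≤ A n →
    P.real {ω | a ≤ |Real.sqrt (totalTime γ n) *
        ∫ x, generator b σ φ x ∂(empirical γ (fun k => euler b σ γ X₀ U k ω) n)|}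
      ≤ 2 * (1 + e) * Real.exp (-((1 - e) * (a ^ 2 / (2 * v)))) with hp
  have hpe : ∀ e, 0 < e → ∀ᶠ n in atTop, p n e := by
    intro e he
    filter_upwards [hup e he, hlow e he, eventually_ge_atTop 1] with n h1 h2 hn a ha haA
    have hT : 0 < totalTime γ n := Finset.sum_pos
      (fun k hk => hγ_pos k (Finset.mem_Icc.1 hk).1) ⟨1, Finset.mem_Icc.2 ⟨le_rfl, hn⟩⟩
    have hsT := Real.sqrt_pos.2 hT
    have hsub : {ω | a ≤ |Real.sqrt (totalTime γ n) *
        ∫ x, generator b σ φ x ∂(empirical γ (fun k => euler b σ γ X₀ U k ω) n)|}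
        ⊆ {ω | a * Real.sqrt (totalTime γ n) ≤ ∑ k ∈ Finset.range n,
            γ (k + 1) * generator b σ φ (euler b σ γ X₀ U k ω)}
          ∪ {ω | a * Real.sqrt (totalTime γ n) ≤ ∑ k ∈ Finset.range n,
            γ (k + 1) * generator b σ (-φ) (euler b σ γ X₀ U k ω)} := by
      intro ω hω
      rw [Set.mem_ofPred, integral_empirical hγ_pos] at hω
      simp only [Set.mem_union, Set.mem_ofPred, generator_neg, mul_neg, Finset.sum_neg_distrib]
      set S := ∑ k ∈ Finset.range n, γ (k + 1) * generator b σ φ (euler b σ γ X₀ U k ω)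
      have e1 : Real.sqrt (totalTime γ n) * ((totalTime γ n)⁻¹ * S)
          = S / Real.sqrt (totalTime γ n) := by
        rw [← mul_assoc, ← div_eq_mul_inv, Real.sqrt_div_self', div_mul_eq_mul_div, one_mul]
      rw [e1, abs_div, abs_of_pos hsT, le_div_iff₀ hsT] at hω
      exact le_abs.1 hω
    refine (measureReal_mono hsub).trans ((measureReal_union_le _ _).trans ?_)
    linarith [h1 a ha haA, h2 a ha haA]
  have hmono : ∀ n e e', 0 < e → e ≤ e' → p n e → p n e' := by
    intro n e e' he hee h a ha haA
    refine (h a ha haA).trans ?_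
    have : 0 ≤ 2 * (1 + e') := by linarith
    gcongr
  obtain ⟨e, he_anti, he_pos, he_lim, he_ev⟩ := exists_strictAnti_of_eventually hmono hpe
  obtain ⟨N, hN⟩ := eventually_atTop.1 (he_ev.and (he_lim.eventually_lt_const one_pos))
  refine ⟨fun n => if n < N then 0 else 1 - e n, fun n => if n < N then 1 else 1 + e n, ?_,
    ⟨N, ?_, ?_⟩, ?_, ?_, ?_⟩
  · intro n _
    by_cases h : n < N
    · simp [h]
    · have := (hN n (not_lt.1 h)).2
      have := he_pos n
      simp only [h, if_false]
      constructor <;> linarith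
  · intro n hn n' hn' hlt
    simp only [not_lt.2 (Set.mem_Ici.1 hn), not_lt.2 (Set.mem_Ici.1 hn'), if_false]
    linarith [he_anti hlt]
  · intro n hn n' hn' hlt
    simp only [not_lt.2 (Set.mem_Ici.1 hn), not_lt.2 (Set.mem_Ici.1 hn'), if_false]
    linarith [he_anti hlt]
  · have h1 : Tendsto (fun n => 1 - e n) atTop (𝓝 1) := by simpa using he_lim.const_sub 1
    refine h1.congr' ?_
    filter_upwards [eventually_ge_atTop N] with n hn
    rw [if_neg (not_lt.2 hn)]
  · have h1 : Tendsto (fun n => 1 + e n) atTop (𝓝 1) := by simpa using he_lim.const_add 1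
    refine h1.congr' ?_
    filter_upwards [eventually_ge_atTop N] with n hn
    rw [if_neg (not_lt.2 hn)]
  · intro n _ a ha haA
    by_cases h : n < N
    · simp only [h, if_true, zero_mul, neg_zero, Real.exp_zero, mul_one]
      exact measureReal_le_one.trans one_le_two
    · simp only [h, if_false]
      exact (hN n (not_lt.1 h)).1 a ha haA
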